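/- Let $K$ be a field; all tensor products are over $K$. For an associative unital $K$-algebra $\Lambda$ and a $\Lambda$-bimodule $M$ (on which $K$ acts centrally) let $A(\Lambda,M)$ be the simplicial $K$-module with $A(\Lambda,M)_n=M\otimes\Lambda^{\otimes n}$ and $$d_0(m\otimes\lambda_1\otimes\dots\otimes\lambda_n)=m\lambda_1\otimes\lambda_2\otimes\dots\otimes\lambda_n,$$ $$d_i(m\otimes\lambda_1\otimes\dots\otimes\lambda_n)=m\otimes\lambda_1\otimes\dots\otimes\lambda_i\lambda_{i+1}\otimes\dots\otimes\lambda_n\quad(1\le i\le n-1),$$ $$d_n(m\otimes\lambda_1\otimes\dots\otimes\lambda_n)=\lambda_n m\otimes\lambda_1\otimes\dots\otimes\lambda_{n-1},$$ $$s_i(m\otimes\lambda_1\otimes\dots\otimes\lambda_n)=m\otimes\lambda_1\otimes\dots\otimes\lambda_i\otimes 1\otimes\lambda_{i+1}\otimes\dots\otimes\lambda_n\quad(0\le i\le n).$$ Let $N A$ be the Moore complex of a simplicial module $A$, with $N_nA=\bigcap_{i\ne 0}\ker(d_i\colon A_n\to A_{n-1})$ and differential $\partial=d_0$, and let $\rho_n\colon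 A_n\to N_nA$ be the projection whose kernel is the submodule generated by the degenerate elements. A $K$-submodule $V\subseteq\Lambda$ is called pointed if $1\in V$. For a pointed submodule $V$ let $B_n\subseteq A(\Lambda,M)_n$ be the image of $M\otimes V^{\otimes n}$, and put $\overline B_n=\rho_n(B_n)$. Let $\Omega(\Lambda,V,M)$ be the subcomplex of $N A(\Lambda,M)$ with components $$\Omega(\Lambda,V,M)_n=\overline B_n\cap\partial^{-1}(\overline B_{n-1})$$ (with $\overline B_{-1}=0$). Put $\Omega(\Lambda,V)=\Omega(\Lambda,V,\Lambda)$ and $HH_*(\Lambda,V)=H_*(\Omega(\Lambda,V))$. **Proposition.** Let $\Lambda,\Lambda'$ be $K$-algebras, let $V\subseteq\Lambda$ and $V'\subseteq\Lambda'$ be pointed submodules, and let $M$ and $M'$ be bimodules over $\Lambda$ and $\Lambda'$ respectively. Let $V\otimes K+K\otimes V'\subseteq\Lambda\otimes\Lambda'$ be the submodule generated by the elements $v\otimes 1$ and $1\otimes v'$ with $v\in V$, $v'\in V'$. Then there is an isomorphism of chain complexes $$\Omega(\Lambda\otimes\Lambda',\,V\otimes K+K\otimes V',\,M\otimes M')\cong\Omega(\Lambda,V,M)\otimes\Omega(\Lambda',V',M').$$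 In particular, there are an isomorphism of chain complexes $$\Omega(\Lambda\otimes\Lambda',\,V\otimes K+K\otimes V')\cong\Omega(\Lambda,V)\otimes\Omega(\Lambda',V')$$ and an isomorphism of graded $K$-modules $$HH_*(\Lambda\otimes\Lambda',\,V\otimes K+K\otimes V')\cong HH_*(\Lambda,V)\otimes HH_*(\Lambda',V').$$ -/

import Mathlib

open CategoryTheory MonoidalCategory TensorProduct

universe u

noncomputable section

namespace HochschildPath

/-! ### Complexes with a graded submodule -/

section Omega

variable {K : Type u} [CommRing K]

/-- The component `D_i ∩ ∂⁻¹(D_{i-1})` of `ω(C, D)`. (The differential `C.d i j` vanishes unless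
`i = j + 1`, so the condition for the other `j` is vacuous.) -/
def omegaX (C : ChainComplex (ModuleCat.{u} K) ℕ) (D : ∀ n, Submodule K (C.X n)) (i : ℕ) :
    Submodule K (C.X i) :=
  D i ⊓ ⨅ j : ℕ, (D j).comap (C.d i j).hom

theorem mem_omegaX {C : ChainComplex (ModuleCat.{u} K) ℕ} {D : ∀ n, Submodule K (C.X n)} {i : ℕ}
    {x : C.X i} : x ∈ omegaX C D i ↔ x ∈ D i ∧ ∀ j, (C.d i j).hom x ∈ D j := by
  simp [omegaX]

theorem d_mem_omegaX (C : ChainComplex (ModuleCat.{u} K) ℕ) (D : ∀ n, Submodule K (C.X n))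
    (i j : ℕ) : ∀ x ∈ omegaX C D i, (C.d i j).hom x ∈ omegaX C D j := by
  intro x hx
  rw [mem_omegaX] at hx ⊢
  refine ⟨hx.2 j, fun k => ?_⟩
  have h : (C.d j k).hom ((C.d i j).hom x) = 0 := by
    rw [← LinearMap.comp_apply, ← ModuleCat.hom_comp, C.d_comp_d]
    rfl
  rw [h]
  exact (D k).zero_mem

/-- The largest subcomplex `ω(C, D)` of the chain complex `C` whose components are contained in the
graded submodule `D`. -/
def omega (C : ChainComplex (ModuleCat.{u} K) ℕ) (D : ∀ n, Submodule K (C.X n)) :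
    ChainComplex (ModuleCat.{u} K) ℕ where
  X i := ModuleCat.of K (omegaX C D i)
  d i j := ModuleCat.ofHom ((C.d i j).hom.restrict (d_mem_omegaX C D i j))
  shape i j h := by
    ext x : 2
    refine Subtype.ext ?_
    change (C.d i j).hom x.1 = 0
    rw [C.shape i j h]
    rfl
  d_comp_d' i j k _ _ := by
    ext x : 2
    refine Subtype.ext ?_
    change (C.d j k).hom ((C.d i j).hom x.1) = 0
    rw [← LinearMap.comp_apply, ← ModuleCat.hom_comp, C.d_comp_d]
    rfl

end Omega

/-! ### Path pairs of modules -/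

open AlgebraicTopology Simplicial in
/-- A path pair of modules: a simplicial module `A` with a graded submodule `B` that is closed under
all degeneracy maps and under the exterior face maps `d_0` and `d_n`. -/
structure PathPair (K : Type u) [CommRing K] where
  A : SimplicialObject (ModuleCat.{u} K)
  B : ∀ n : ℕ, Submodule K (A _⦋n⦌)
  σ_mem : ∀ (n : ℕ) (i : Fin (n + 1)), ∀ x ∈ B n, (A.σ i).hom x ∈ B (n + 1)
  δ_zero_mem : ∀ n : ℕ, ∀ x ∈ B (n + 1), (A.δ (0 : Fin (n + 2))).hom x ∈ B n
  δ_last_mem : ∀ n : ℕ, ∀ x ∈ B (n + 1), (A.δ (Fin.last (n + 1))).hom x ∈ B n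

namespace PathPair

variable {K : Type u} [CommRing K] (P : PathPair K)

/-- The image `ρ(B_n)` of `B_n` in the Moore complex `N A`, whose `n`-th component is the
intersection of the kernels of `d_1, …, d_n` and whose differential is `d_0`. Here `ρ` is the
projection of the alternating face map complex of `A` onto `N A` along the degenerate part. -/
def Bbar (n : ℕ) : Submodule K (((AlgebraicTopology.normalizedMooreComplex _).obj P.A).X n) :=
  (P.B n).map ((AlgebraicTopology.DoldKan.PInftyToNormalizedMooreComplex P.A).f n).hom

/-- The complex `Ω P = ω(N A, ρ(B))` of a path pair `P = (A, B)`. -/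
def Omega : ChainComplex (ModuleCat.{u} K) ℕ :=
  omega ((AlgebraicTopology.normalizedMooreComplex _).obj P.A) P.Bbar

end PathPair

/-! ### Bimodules over algebras -/

/-- A bimodule over a `K`-algebra `Λ` on which both induced actions of `K` agree with the given
`K`-module structure: a `K`-module with commuting left and right actions of `Λ` by `K`-linear
endomorphisms, written as homomorphisms from `Λ` and from its opposite algebra. -/
structure Bimodule (K : Type u) [CommRing K] (Λ : Type u) [Ring Λ] [Algebra K Λ] where
  carrier : Type u
  [addCommGroup : AddCommGroup carrier]
  [module : Module K carrier]
  left : Λ →ₐ[K] Module.End K carrier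
  right : Λᵐᵒᵖ →ₐ[K] Module.End K carrier
  commute : ∀ (a : Λ) (b : Λᵐᵒᵖ), Commute (left a) (right b)

attribute [instance] Bimodule.addCommGroup Bimodule.module

namespace Bimodule

variable (K : Type u) [CommRing K] (Λ Λ' : Type u) [Ring Λ] [Algebra K Λ] [Ring Λ'] [Algebra K Λ']

/-- The algebra `Λ` as a bimodule over itself. -/
def regular : Bimodule K Λ where
  carrier := Λ
  left := Algebra.lsmul K K Λ
  right := Algebra.lsmul K K Λ
  commute a b := by
    ext x
    simp [mul_assoc]

variable {K Λ Λ'}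

/-- The tensor product `M ⊗ M'` as a bimodule over `Λ ⊗ Λ'`, with
`(a ⊗ a') (m ⊗ m') (b ⊗ b') = a m b ⊗ a' m' b'`. -/
def tensor (M : Bimodule K Λ) (M' : Bimodule K Λ') : Bimodule K (Λ ⊗[K] Λ') where
  carrier := M.carrier ⊗[K] M'.carrier
  left := Module.endTensorEndAlgHom.comp (Algebra.TensorProduct.map M.left M'.left)
  right := (Module.endTensorEndAlgHom.comp (Algebra.TensorProduct.map M.right M'.right)).comp
    (Algebra.TensorProduct.opAlgEquiv K K Λ Λ').symm.toAlgHom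
  commute a b := by
    obtain ⟨b, rfl⟩ := (Algebra.TensorProduct.opAlgEquiv K K Λ Λ').surjective b
    simp only [AlgHom.comp_apply]
    erw [AlgEquiv.symm_apply_apply]
    induction a with
    | zero => simp
    | add x y hx hy => simpa only [map_add] using hx.add_left hy
    | tmul x y =>
      induction b with
      | zero => simp
      | add z w hz hw => simpa only [map_add] using hz.add_right hw
      | tmul z w =>
        have h1 := M.commute x z
        have h2 := M'.commute y w
        apply TensorProduct.ext'
        intro m m'
        have e1 := congrArg (fun f => f m) h1.eq
        have e2 := congrArg (fun f => f m') h2.eq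
        simp only [Module.End.mul_apply] at e1 e2
        simp [Module.endTensorEndAlgHom_apply, e1, e2]

theorem tensor_left_tmul (M : Bimodule K Λ) (M' : Bimodule K Λ') (a : Λ) (a' : Λ')
    (m : M.carrier) (m' : M'.carrier) :
    (M.tensor M').left (a ⊗ₜ a') (m ⊗ₜ[K] m') = M.left a m ⊗ₜ[K] M'.left a' m' := rfl

theorem tensor_right_tmul (M : Bimodule K Λ) (M' : Bimodule K Λ') (a : Λ) (a' : Λ')
    (m : M.carrier) (m' : M'.carrier) :
    (M.tensor M').right (MulOpposite.op (a ⊗ₜ a')) (m ⊗ₜ[K] m') =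
      M.right (MulOpposite.op a) m ⊗ₜ[K] M'.right (MulOpposite.op a') m' := rfl

end Bimodule

/-! ### The Hochschild simplicial module -/

section Interval

variable {K : Type u} [CommRing K] {Λ : Type u} [Ring Λ] [Algebra K Λ]

/-- A finite sequence extended by `1` to all natural numbers. -/
def extendOne {n : ℕ} (l : Fin n → Λ) (k : ℕ) : Λ := if h : k < n then l ⟨k, h⟩ else 1

/-- The ordered product `l_a l_{a+1} ⋯ l_{b-1}` of the entries of `l` (numbered from `0`) with index
in `[a, b)`. -/
def intervalProd {n : ℕ} (l : Fin n → Λ) (a b : ℕ) : Λ := ((List.Ico a b).map (extendOne l)).prod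

theorem intervalProd_self {n : ℕ} (l : Fin n → Λ) (a : ℕ) : intervalProd l a a = 1 := by
  simp [intervalProd]

theorem intervalProd_mul {n : ℕ} (l : Fin n → Λ) {a b c : ℕ} (hab : a ≤ b) (hbc : b ≤ c) :
    intervalProd l a b * intervalProd l b c = intervalProd l a c := by
  simp only [intervalProd, ← List.prod_append, ← List.map_append,
    List.Ico.append_consecutive hab hbc]

theorem intervalProd_succ {n : ℕ} (l : Fin n → Λ) (i : Fin n) :
    intervalProd l i (i + 1) = l i := by
  simp [intervalProd, List.Ico.succ_singleton, extendOne]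

theorem intervalProd_update_of_notMem {n : ℕ} [DecidableEq (Fin n)] (l : Fin n → Λ) (i : Fin n)
    (x : Λ) {a b : ℕ} (h : (i : ℕ) < a ∨ b ≤ i) :
    intervalProd (Function.update l i x) a b = intervalProd l a b := by
  unfold intervalProd
  congr 1
  apply List.map_congr_left
  intro k hk
  rw [List.Ico.mem] at hk
  unfold extendOne
  split_ifs with hkn
  · rw [Function.update_of_ne]
    rintro rfl
    simp at h
    omega
  · rfl

theorem intervalProd_update_of_mem {n : ℕ} [DecidableEq (Fin n)] (l : Fin n → Λ) (i : Fin n)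
    (x : Λ) {a b : ℕ} (ha : a ≤ i) (hb : (i : ℕ) < b) :
    intervalProd (Function.update l i x) a b =
      intervalProd l a i * x * intervalProd l (i + 1) b := by
  rw [← intervalProd_mul _ ha hb.le, ← intervalProd_mul _ (Nat.le_succ (i : ℕ)) hb,
    intervalProd_succ, intervalProd_update_of_notMem l i x (Or.inr le_rfl),
    intervalProd_update_of_notMem l i x (Or.inl (Nat.lt_succ_self _)), Function.update_self,
    mul_assoc]

/-- Products of consecutive blocks multiply to the product of the union of the blocks. -/
theorem intervalProd_blocks {n m : ℕ} (l : Fin n → Λ) (g : Fin (m + 1) →o Fin (n + 1))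
    {a b : ℕ} (hab : a ≤ b) (hb : b < m + 1) :
    intervalProd (fun j : Fin m => intervalProd l (g j.castSucc) (g j.succ)) a b =
      intervalProd l (g ⟨a, by omega⟩) (g ⟨b, hb⟩) := by
  induction b, hab using Nat.le_induction with
  | base => simp [intervalProd_self]
  | succ b hab ih =>
    have hbm : b < m := by omega
    have h1 := intervalProd_succ (fun j : Fin m => intervalProd l (g j.castSucc) (g j.succ)) ⟨b, hbm⟩
    rw [← intervalProd_mul _ hab (Nat.le_succ b), ih (by omega)]
    simp only at h1
    rw [Nat.succ_eq_add_one, h1]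
    exact intervalProd_mul l (g.monotone (by simp [Fin.le_def, hab]))
      (g.monotone (by simp [Fin.le_def]))

end Interval

section Hochschild

variable {K : Type u} [CommRing K] {Λ : Type u} [Ring Λ] [Algebra K Λ]

/-- For a monotone map `f : [m] → [n]` and `l = (λ_1, …, λ_n)`, the sequence of length `m` whose
`j`-th entry is the ordered product of the `λ_i` with `f (j - 1) < i ≤ f j`. -/
def blocks {m n : ℕ} (f : Fin (m + 1) →o Fin (n + 1)) (l : Fin n → Λ) (j : Fin m) : Λ :=
  intervalProd l (f j.castSucc) (f j.succ)

/-- For a monotone map `f : [m] → [n]` and `l = (λ_1, …, λ_n)`, the endomorphism of `M` that sends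
`x` to `(λ_{f(m)+1} ⋯ λ_n) x (λ_1 ⋯ λ_{f(0)})`. -/
def outer (M : Bimodule K Λ) {m n : ℕ} (f : Fin (m + 1) →o Fin (n + 1)) (l : Fin n → Λ) :
    Module.End K M.carrier :=
  M.left (intervalProd l (f (Fin.last m)) n) * M.right (MulOpposite.op (intervalProd l 0 (f 0)))

/-- `x ↦ (λ_{f(m)+1} ⋯ λ_n) x (λ_1 ⋯ λ_{f(0)}) ⊗ (block products of l along f)`. -/
def structureFun (M : Bimodule K Λ) {m n : ℕ} (f : Fin (m + 1) →o Fin (n + 1)) (l : Fin n → Λ) :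
    M.carrier →ₗ[K] M.carrier ⊗[K] (⨂[K] _ : Fin m, Λ) :=
  (TensorProduct.mk K M.carrier (⨂[K] _ : Fin m, Λ)).flip (PiTensorProduct.tprod K (blocks f l)) ∘ₗ
    outer M f l

theorem structureFun_apply (M : Bimodule K Λ) {m n : ℕ} (f : Fin (m + 1) →o Fin (n + 1))
    (l : Fin n → Λ) (x : M.carrier) :
    structureFun M f l x = outer M f l x ⊗ₜ PiTensorProduct.tprod K (blocks f l) := rfl

theorem exists_block {m : ℕ} (f : ℕ → ℕ) (i : ℕ) (h0 : f 0 ≤ i) (hm : i < f m) :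
    ∃ j < m, f j ≤ i ∧ i < f (j + 1) := by
  induction m with
  | zero => omega
  | succ m ih =>
    by_cases h : i < f m
    · obtain ⟨j, hj, hh⟩ := ih h
      exact ⟨j, by omega, hh⟩
    · exact ⟨m, by omega, by omega, hm⟩

theorem structureFun_update (M : Bimodule K Λ) {m n : ℕ} [DecidableEq (Fin n)]
    (f : Fin (m + 1) →o Fin (n + 1)) (l : Fin n → Λ) (i : Fin n) :
    ∃ L : Λ →ₗ[K] (M.carrier →ₗ[K] M.carrier ⊗[K] (⨂[K] _ : Fin m, Λ)),
      ∀ x, structureFun M f (Function.update l i x) = L x := by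
  have hmono : ∀ j : Fin (m + 1), (f 0 : ℕ) ≤ f j ∧ (f j : ℕ) ≤ f (Fin.last m) := fun j =>
    ⟨f.monotone (Fin.zero_le j), f.monotone (Fin.le_last j)⟩
  rcases lt_or_ge (i : ℕ) (f 0) with h0 | h0
  · have hb : ∀ x, blocks f (Function.update l i x) = blocks f l := fun x => funext fun j =>
      intervalProd_update_of_notMem l i x (Or.inl (lt_of_lt_of_le h0 (hmono _).1))
    refine ⟨{ toFun := fun x => structureFun M f (Function.update l i x)
              map_add' := ?_, map_smul' := ?_ }, fun x => rfl⟩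
    · intro x y
      ext z
      simp only [structureFun_apply, hb, outer, LinearMap.add_apply,
        intervalProd_update_of_notMem l i _ (Or.inl (lt_of_lt_of_le h0 (hmono (Fin.last m)).1)),
        intervalProd_update_of_mem l i _ (Nat.zero_le _) h0, mul_add, add_mul, MulOpposite.op_add,
        map_add, TensorProduct.add_tmul]
    · intro c x
      ext z
      simp only [structureFun_apply, hb, outer, LinearMap.smul_apply, RingHom.id_apply,
        intervalProd_update_of_notMem l i _ (Or.inl (lt_of_lt_of_le h0 (hmono (Fin.last m)).1)),
        intervalProd_update_of_mem l i _ (Nat.zero_le _) h0, mul_smul_comm, smul_mul_assoc,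
        MulOpposite.op_smul, map_smul, TensorProduct.smul_tmul']
  rcases lt_or_ge (i : ℕ) (f (Fin.last m)) with h1 | h1
  · obtain ⟨j, hj, hj1, hj2⟩ := exists_block (m := m)
      (fun k => if h : k < m + 1 then (f ⟨k, h⟩ : ℕ) else 0) i (by simpa using h0)
      (by simpa [Fin.last] using h1)
    rw [dif_pos (by omega)] at hj1
    rw [dif_pos (by omega)] at hj2
    have ho : ∀ x, outer M f (Function.update l i x) = outer M f l := fun x => by
      simp only [outer, intervalProd_update_of_notMem l i x (Or.inl h1),
        intervalProd_update_of_notMem l i x (Or.inr h0)]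
    have hb : ∀ x, blocks f (Function.update l i x) = Function.update (blocks f l) ⟨j, hj⟩
        (intervalProd l (f ⟨j, by omega⟩) i * x *
          intervalProd l (i + 1) (f ⟨j + 1, by omega⟩)) := by
      intro x
      funext k
      rcases eq_or_ne k ⟨j, hj⟩ with rfl | hk
      · rw [Function.update_self]
        exact intervalProd_update_of_mem l i x hj1 hj2
      · rw [Function.update_of_ne hk]
        apply intervalProd_update_of_notMem
        have hk' : (k : ℕ) ≠ j := fun h => hk (Fin.ext h)
        rcases lt_or_gt_of_ne hk' with h | h
        · right
          refine le_trans ?_ hj1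
          exact f.monotone (show k.succ ≤ (⟨j, by omega⟩ : Fin (m + 1)) from by
            simp [Fin.le_def]; omega)
        · left
          refine lt_of_lt_of_le hj2 ?_
          exact f.monotone (show (⟨j + 1, by omega⟩ : Fin (m + 1)) ≤ k.castSucc from by
            simp [Fin.le_def]; omega)
    refine ⟨{ toFun := fun x => structureFun M f (Function.update l i x)
              map_add' := ?_, map_smul' := ?_ }, fun x => rfl⟩
    · intro x y
      ext z
      simp only [structureFun_apply, hb, ho, LinearMap.add_apply, mul_add, add_mul,
        MultilinearMap.map_update_add, TensorProduct.tmul_add]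
    · intro c x
      ext z
      simp only [structureFun_apply, hb, ho, LinearMap.smul_apply, RingHom.id_apply,
        mul_smul_comm, smul_mul_assoc, MultilinearMap.map_update_smul, TensorProduct.tmul_smul]
  · have hb : ∀ x, blocks f (Function.update l i x) = blocks f l := fun x => funext fun j =>
      intervalProd_update_of_notMem l i x (Or.inr (le_trans (hmono _).2 h1))
    refine ⟨{ toFun := fun x => structureFun M f (Function.update l i x)
              map_add' := ?_, map_smul' := ?_ }, fun x => rfl⟩
    · intro x y
      ext z
      simp only [structureFun_apply, hb, outer, LinearMap.add_apply,
        intervalProd_update_of_notMem l i _ (Or.inr h0),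
        intervalProd_update_of_mem l i _ h1 i.isLt, mul_add, add_mul,
        map_add, TensorProduct.add_tmul]
    · intro c x
      ext z
      simp only [structureFun_apply, hb, outer, LinearMap.smul_apply, RingHom.id_apply,
        intervalProd_update_of_notMem l i _ (Or.inr h0),
        intervalProd_update_of_mem l i _ h1 i.isLt, mul_smul_comm, smul_mul_assoc,
        map_smul, TensorProduct.smul_tmul']

/-- `structureFun` as a multilinear map in the entries of `l`. -/
def structureMultilinear (M : Bimodule K Λ) {m n : ℕ} (f : Fin (m + 1) →o Fin (n + 1)) :
    MultilinearMap K (fun _ : Fin n => Λ)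
      (M.carrier →ₗ[K] M.carrier ⊗[K] (⨂[K] _ : Fin m, Λ)) where
  toFun := structureFun M f
  map_update_add' l i x y := by
    obtain ⟨L, hL⟩ := structureFun_update M f l i
    simp only [hL, map_add]
  map_update_smul' l i c x := by
    obtain ⟨L, hL⟩ := structureFun_update M f l i
    simp only [hL, map_smul]

/-- The structure map `f^* : M ⊗ Λ^{⊗ n} → M ⊗ Λ^{⊗ m}` of the Hochschild simplicial module for a
monotone map `f : [m] → [n]`, given on pure tensors by `structureMap_tmul_tprod`. -/
def structureMap (M : Bimodule K Λ) {m n : ℕ} (f : Fin (m + 1) →o Fin (n + 1)) :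
    M.carrier ⊗[K] (⨂[K] _ : Fin n, Λ) →ₗ[K] M.carrier ⊗[K] (⨂[K] _ : Fin m, Λ) :=
  TensorProduct.lift (PiTensorProduct.lift (structureMultilinear M f)).flip

theorem structureMap_tmul_tprod (M : Bimodule K Λ) {m n : ℕ} (f : Fin (m + 1) →o Fin (n + 1))
    (x : M.carrier) (l : Fin n → Λ) :
    structureMap M f (x ⊗ₜ PiTensorProduct.tprod K l) =
      (M.left (intervalProd l (f (Fin.last m)) n)
        (M.right (MulOpposite.op (intervalProd l 0 (f 0))) x)) ⊗ₜ
          PiTensorProduct.tprod K fun j : Fin m => intervalProd l (f j.castSucc) (f j.succ) := by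
  simp [structureMap, structureMultilinear, structureFun_apply, outer]
  rfl

theorem hom_ext_tprod {M N : Type u} [AddCommGroup M] [Module K M] [AddCommGroup N] [Module K N]
    {n : ℕ} {f g : M ⊗[K] (⨂[K] _ : Fin n, Λ) →ₗ[K] N}
    (h : ∀ (x : M) (l : Fin n → Λ),
      f (x ⊗ₜ PiTensorProduct.tprod K l) = g (x ⊗ₜ PiTensorProduct.tprod K l)) : f = g := by
  apply TensorProduct.ext
  ext x l
  simpa using h x l

theorem structureMap_id (M : Bimodule K Λ) (n : ℕ) :
    structureMap M (OrderHom.id : Fin (n + 1) →o Fin (n + 1)) = LinearMap.id := by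
  apply hom_ext_tprod
  intro x l
  rw [structureMap_tmul_tprod]
  simp [intervalProd_self, intervalProd_succ]

theorem structureMap_comp (M : Bimodule K Λ) {m n p : ℕ} (f : Fin (m + 1) →o Fin (n + 1))
    (g : Fin (n + 1) →o Fin (p + 1)) :
    structureMap M (g.comp f) = structureMap M f ∘ₗ structureMap M g := by
  apply hom_ext_tprod
  intro x l
  rw [LinearMap.comp_apply, structureMap_tmul_tprod, structureMap_tmul_tprod,
    structureMap_tmul_tprod]
  have hc := fun (a : Λ) (b : Λᵐᵒᵖ) (y : M.carrier) =>
    congrArg (fun e => e y) (M.commute a b).eq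
  simp only [Module.End.mul_apply] at hc
  congr 1
  · rw [intervalProd_blocks l g (Nat.zero_le _) (f 0).isLt,
      intervalProd_blocks l g (Nat.lt_succ_iff.mp (f (Fin.last m)).isLt) (Nat.lt_succ_self n)]
    rw [← hc]
    change _ = (M.left _ * M.left _) ((M.right _ * M.right _) x)
    rw [← map_mul, ← map_mul, ← MulOpposite.op_mul]
    have e1 := intervalProd_mul l (Nat.zero_le (g 0 : ℕ))
      (show (g 0 : ℕ) ≤ g (f 0) from g.monotone (Fin.zero_le _))
    have e2 := intervalProd_mul l
      (show (g (f (Fin.last m)) : ℕ) ≤ g (Fin.last n) from g.monotone (Fin.le_last _))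
      (Nat.lt_succ_iff.mp (g (Fin.last n)).isLt)
    change _ = (M.left (intervalProd l (g (f (Fin.last m))) (g (Fin.last n)) * _))
      ((M.right (MulOpposite.op (_ * intervalProd l (g 0) (g (f 0))))) x)
    rw [e1, e2]
    rfl
  · congr 1
    funext j
    rw [intervalProd_blocks l g _ (f j.succ).isLt]
    · rfl
    · exact f.monotone (Fin.castSucc_lt_succ).le

/-- The simplicial module `A(Λ, M)` with `A(Λ, M)_n = M ⊗ Λ^{⊗ n}`. By `structureMap_tmul_tprod`,
`d_0 (m ⊗ λ_1 ⊗ ⋯ ⊗ λ_n) = m λ_1 ⊗ λ_2 ⊗ ⋯ ⊗ λ_n`, the inner face `d_i` multiplies `λ_i` and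
`λ_{i+1}`, `d_n (m ⊗ λ_1 ⊗ ⋯ ⊗ λ_n) = λ_n m ⊗ λ_1 ⊗ ⋯ ⊗ λ_{n-1}`, and the degeneracy `s_i` inserts
`1` after `λ_i`. -/
def hochschild (M : Bimodule K Λ) : SimplicialObject (ModuleCat.{u} K) where
  obj k := ModuleCat.of K (M.carrier ⊗[K] (⨂[K] _ : Fin k.unop.len, Λ))
  map f := ModuleCat.ofHom (structureMap M f.unop.toOrderHom)
  map_id k := by
    have := structureMap_id M k.unop.len
    ext1
    exact this
  map_comp f g := by
    have := structureMap_comp M g.unop.toOrderHom f.unop.toOrderHom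
    ext1
    exact this

/-- The submodule `M ⊗̄ V^{⊗̄ n}`: the image of `M ⊗ V^{⊗ n}` in `M ⊗ Λ^{⊗ n}`. -/
def hochschildB (V : Submodule K Λ) (M : Bimodule K Λ) (n : ℕ) :
    Submodule K (M.carrier ⊗[K] (⨂[K] _ : Fin n, Λ)) :=
  LinearMap.range (TensorProduct.map (LinearMap.id : M.carrier →ₗ[K] M.carrier)
    (PiTensorProduct.map fun _ : Fin n => V.subtype))

theorem structureMap_mem {V : Submodule K Λ} (hV : (1 : Λ) ∈ V) (M : Bimodule K Λ) {m n : ℕ}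
    (f : Fin (m + 1) →o Fin (n + 1)) (hf : ∀ j : Fin m, (f j.succ : ℕ) ≤ f j.castSucc + 1)
    (x : M.carrier ⊗[K] (⨂[K] _ : Fin n, Λ)) (hx : x ∈ hochschildB V M n) :
    structureMap M f x ∈ hochschildB V M m := by
  obtain ⟨y, rfl⟩ := hx
  have hmem : ∀ (l : Fin n → V) (j : Fin m),
      intervalProd (fun i => (l i : Λ)) (f j.castSucc) (f j.succ) ∈ V := by
    intro l j
    have h1 : (f j.castSucc : ℕ) ≤ f j.succ := f.monotone (Fin.castSucc_lt_succ).le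
    rcases (hf j).eq_or_lt with h | h
    · have hlt : (f j.castSucc : ℕ) < n := by have := (f j.succ).isLt; omega
      have := intervalProd_succ (fun i => (l i : Λ)) ⟨f j.castSucc, hlt⟩
      rw [h]
      simp only at this
      rw [this]
      exact (l _).2
    · have : (f j.succ : ℕ) = f j.castSucc := by omega
      rw [this, intervalProd_self]
      exact hV
  induction y with
  | zero => simp
  | add y z hy hz => simpa only [map_add] using add_mem hy hz
  | tmul a t =>
    induction t using PiTensorProduct.induction_on with
    | smul_tprod r l =>
      rw [TensorProduct.tmul_smul, map_smul, map_smul]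
      apply Submodule.smul_mem
      rw [TensorProduct.map_tmul, PiTensorProduct.map_tprod, structureMap_tmul_tprod]
      refine ⟨(M.left (intervalProd (fun i => (l i : Λ)) (f (Fin.last m)) n)
        (M.right (MulOpposite.op (intervalProd (fun i => (l i : Λ)) 0 (f 0))) a)) ⊗ₜ
          PiTensorProduct.tprod K fun j => ⟨_, hmem l j⟩, ?_⟩
      rw [TensorProduct.map_tmul, PiTensorProduct.map_tprod]
      rfl
    | add s t hs ht => simpa only [TensorProduct.tmul_add, map_add] using add_mem hs ht

/-- The path pair `(A(Λ, M), B(Λ, V, M))` of a pointed submodule `V ∋ 1` of the algebra `Λ` and a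
`Λ`-bimodule `M`, where `B(Λ, V, M)_n = M ⊗̄ V^{⊗̄ n}`. -/
def pathPair (V : Submodule K Λ) (hV : (1 : Λ) ∈ V) (M : Bimodule K Λ) : PathPair K where
  A := hochschild M
  B n := hochschildB V M n
  σ_mem n i x hx := by
    refine structureMap_mem hV M (SimplexCategory.σ i).toOrderHom (fun j => ?_) x hx
    simp only [SimplexCategory.σ]
    simp [Fin.predAbove]
    split_ifs <;> simp <;> omega
  δ_zero_mem n x hx := by
    refine structureMap_mem hV M (SimplexCategory.δ 0).toOrderHom (fun j => ?_) x hx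
    simp [SimplexCategory.δ]
  δ_last_mem n x hx := by
    refine structureMap_mem hV M (SimplexCategory.δ (Fin.last _)).toOrderHom (fun j => ?_) x hx
    simp [SimplexCategory.δ]

/-- The chain complex `Ω(Λ, V, M)`. -/
def Omega (V : Submodule K Λ) (hV : (1 : Λ) ∈ V) (M : Bimodule K Λ) :
    ChainComplex (ModuleCat.{u} K) ℕ :=
  (pathPair V hV M).Omega

/-- The graded module `HH_*(Λ, V, M) = H_*(Ω(Λ, V, M))`. -/
def HH (V : Submodule K Λ) (hV : (1 : Λ) ∈ V) (M : Bimodule K Λ) :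
    GradedObject ℕ (ModuleCat.{u} K) :=
  fun n => (Omega V hV M).homology n

end Hochschild

section TensorSubmodule

variable {K : Type u} [CommRing K] {Λ Λ' : Type u} [Ring Λ] [Algebra K Λ] [Ring Λ'] [Algebra K Λ']

/-- The submodule `V ⊗ K + K ⊗ V'` of `Λ ⊗ Λ'`, where `K` stands for the submodules `K · 1` of `Λ`
and of `Λ'` (the unit submodule `1`), and `⊗` for the span of the pure tensors. -/
def boxSubmodule (V : Submodule K Λ) (V' : Submodule K Λ') : Submodule K (Λ ⊗[K] Λ') :=
  Submodule.map₂ (TensorProduct.mk K Λ Λ') V 1 ⊔ Submodule.map₂ (TensorProduct.mk K Λ Λ') 1 V'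

theorem one_mem_boxSubmodule {V : Submodule K Λ} (hV : (1 : Λ) ∈ V) (V' : Submodule K Λ') :
    (1 : Λ ⊗[K] Λ') ∈ boxSubmodule V V' :=
  Submodule.mem_sup_left
    (Submodule.apply_mem_map₂ (TensorProduct.mk K Λ Λ') hV (Submodule.one_le.mp le_rfl))

end TensorSubmodule

end HochschildPath

end

noncomputable section

namespace HochschildPath

section

/-! ### Tensor products of subspaces -/

section LinearAlgebra

variable {K : Type*} [Field K] {X Y Z W : Type*} [AddCommGroup X] [Module K X] [AddCommGroup Y]
  [Module K Y] [AddCommGroup Z] [Module K Z] [AddCommGroup W] [Module K W]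

/-! The isomorphism is the Eilenberg–Zilber shuffle map, restricted to the subcomplexes `Ω`. The
simplicial module of `Λ ⊗ Λ'` is the degreewise tensor product of the two given ones (`zip`), so
each lattice path `s` from `(0, 0)` to `(p, q)` gives a map `pathMap s` from `A_p ⊗ A'_q` to degree
`p + q`; the shuffle map is their signed sum. It commutes with the normalizing projections
(`shuffle_normProj`) and is a chain map on normalized chains (`chainsD_shuffle`).

The submodule `V ⊗ K + K ⊗ V'` enters through an expansion. A tensor product of elements `v ⊗ 1 + 1
⊗ v'` is a sum of terms with every factor of the form `v ⊗ 1` or `1 ⊗ v'`. If these are read as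
horizontal and vertical steps, each term is a value of `pathMap s` for one path `s`. Hence every
element of `B̄_n` for the tensor product algebra is `ρ(∑ pathMap s (b_s))` with `b_s ∈ B_p ⊗ B'_q`
(`exists_eq_sum_pathMap`).

Suppose that its boundary lies in `B̄_{n-1}`. The face that omits a corner of `s` multiplies `v ⊗ 1`
with `1 ⊗ v'` to a diagonal factor `v ⊗ v'`. After the unit lines are split off, such a factor
cannot occur in `B̄_{n-1}`. Only `s` and its reflection at the corner produce this simplex, and with
the same sign, so their coefficients cancel modulo units (`add_reflect_eq_zero`). Reflections lead
from any path to the one that runs horizontally first, so all coefficients for `(p, q)` agree up to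
the sign of the shuffle (`eq_sgn_smul`), and the element is a sum of shuffles
(`sum_shuffle_retract`). Reading off the coefficient of the horizontal-first path is the inverse map
`retract`.

It remains to see that this inverse lands in `Ω ⊗ Ω'`. The two halves of the tensor differential are
separated by dividing out `B̄_p` in the first factor or `B̄'_q` in the second (`ret_mem_omegaX`),
and exactness of tensor products over a field does the rest (`mem_range_mapIncl_inf_comap`). For
homology, a complex over a field is homotopy equivalent to its homology, which gives the Künneth
isomorphism (`kunnethIso`). -/

theorem mapIncl_injective (S : Submodule K X) (T : Submodule K Y) :
    Function.Injective (TensorProduct.mapIncl S T) :=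
  TensorProduct.map_injective_of_flat_flat _ _ S.subtype_injective T.subtype_injective

/-- Exactness is used twice: once to move `x` into `ker f ⊗ Y`, and once there to move it into `ker
f ⊗ ker g`. In between, injectivity of `ker f ⊗ W → X ⊗ W` shows that `g` still kills the lifted
element. -/
theorem mem_range_mapIncl_ker (f : X →ₗ[K] Z) (g : Y →ₗ[K] W) (x : X ⊗[K] Y) :
    x ∈ LinearMap.range (TensorProduct.mapIncl (LinearMap.ker f) (LinearMap.ker g)) ↔
      f.rTensor Y x = 0 ∧ g.lTensor X x = 0 := by
  constructor
  · rintro ⟨y, rfl⟩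
    simp only [TensorProduct.mapIncl, ← LinearMap.comp_apply, LinearMap.rTensor_comp_map,
      LinearMap.lTensor_comp_map, LinearMap.comp_ker_subtype, TensorProduct.map_zero_left,
      TensorProduct.map_zero_right, LinearMap.zero_apply, and_self]
  · rintro ⟨hf, hg⟩
    obtain ⟨y, rfl⟩ := (Module.Flat.rTensor_exact Y f.exact_subtype_ker_map x).mp hf
    have hy : g.lTensor (LinearMap.ker f) y = 0 := by
      apply Module.Flat.rTensor_preserves_injective_linearMap (M := W) _
        (LinearMap.ker f).subtype_injective
      rw [map_zero, ← hg]
      simp only [← LinearMap.comp_apply, LinearMap.rTensor_comp_lTensor,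
        LinearMap.lTensor_comp_rTensor]
    obtain ⟨z, rfl⟩ := (Module.Flat.lTensor_exact (LinearMap.ker f) g.exact_subtype_ker_map y).mp hy
    refine ⟨z, ?_⟩
    simp only [← LinearMap.comp_apply, LinearMap.rTensor_comp_lTensor]

theorem rTensor_lTensor_comm (f : X →ₗ[K] Z) (g : Y →ₗ[K] W) (x : X ⊗[K] Y) :
    f.rTensor W (g.lTensor X x) = g.lTensor Z (f.rTensor Y x) := by
  rw [← LinearMap.comp_apply, LinearMap.rTensor_comp_lTensor, ← LinearMap.lTensor_comp_rTensor,
    LinearMap.comp_apply]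

theorem rTensor_mkQ_eq_zero {S : Submodule K X} {T : Submodule K Y} {x : X ⊗[K] Y}
    (hx : x ∈ LinearMap.range (TensorProduct.mapIncl S T)) : S.mkQ.rTensor Y x = 0 := by
  obtain ⟨y, rfl⟩ := hx
  have : S.mkQ.rTensor Y ∘ₗ TensorProduct.mapIncl S T = 0 := by
    apply TensorProduct.ext'
    intro a b
    have h : S.mkQ (a : X) = 0 := by simp
    simp [TensorProduct.mapIncl, h]
  exact LinearMap.congr_fun this y

theorem lTensor_mkQ_eq_zero {S : Submodule K X} {T : Submodule K Y} {x : X ⊗[K] Y}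
    (hx : x ∈ LinearMap.range (TensorProduct.mapIncl S T)) : T.mkQ.lTensor X x = 0 := by
  obtain ⟨y, rfl⟩ := hx
  have : T.mkQ.lTensor X ∘ₗ TensorProduct.mapIncl S T = 0 := by
    apply TensorProduct.ext'
    intro a b
    have h : T.mkQ (b : Y) = 0 := by simp
    simp [TensorProduct.mapIncl, h]
  exact LinearMap.congr_fun this y

/-- Membership in `(D ∩ d⁻¹ E) ⊗ (D' ∩ d'⁻¹ E')`. -/
theorem mem_range_mapIncl_inf_comap {X₁ Y₁ : Type*} [AddCommGroup X₁] [Module K X₁]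
    [AddCommGroup Y₁] [Module K Y₁] (D : Submodule K X) (E : Submodule K X₁) (d : X →ₗ[K] X₁)
    (D' : Submodule K Y) (E' : Submodule K Y₁) (d' : Y →ₗ[K] Y₁) (x : X ⊗[K] Y)
    (hx : x ∈ LinearMap.range (TensorProduct.mapIncl D D'))
    (h : (E.mkQ ∘ₗ d).rTensor Y x = 0) (h' : (E'.mkQ ∘ₗ d').lTensor X x = 0) :
    x ∈ LinearMap.range (TensorProduct.mapIncl (D ⊓ E.comap d) (D' ⊓ E'.comap d')) := by
  -- Both submodules become kernels of maps into a product of quotients, so that the kernel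
  -- criterion applies.
  have e1 : D ⊓ E.comap d = LinearMap.ker (LinearMap.prod D.mkQ (E.mkQ ∘ₗ d)) := by
    rw [LinearMap.ker_prod, Submodule.ker_mkQ, LinearMap.ker_comp, Submodule.ker_mkQ]
  have e2 : D' ⊓ E'.comap d' = LinearMap.ker (LinearMap.prod D'.mkQ (E'.mkQ ∘ₗ d')) := by
    rw [LinearMap.ker_prod, Submodule.ker_mkQ, LinearMap.ker_comp, Submodule.ker_mkQ]
  rw [e1, e2, mem_range_mapIncl_ker]
  constructor
  · have : (LinearMap.prod D.mkQ (E.mkQ ∘ₗ d)).rTensor Y =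
        (LinearMap.inl K _ _ ∘ₗ D.mkQ).rTensor Y +
          (LinearMap.inr K _ _ ∘ₗ (E.mkQ ∘ₗ d)).rTensor Y := by
      rw [← LinearMap.rTensor_add]
      congr 1
      ext y <;> simp
    rw [this, LinearMap.add_apply, LinearMap.rTensor_comp, LinearMap.rTensor_comp _ (LinearMap.inr K _ _),
      LinearMap.comp_apply, LinearMap.comp_apply, h, rTensor_mkQ_eq_zero hx]
    simp
  · have : (LinearMap.prod D'.mkQ (E'.mkQ ∘ₗ d')).lTensor X =
        (LinearMap.inl K _ _ ∘ₗ D'.mkQ).lTensor X +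
          (LinearMap.inr K _ _ ∘ₗ (E'.mkQ ∘ₗ d')).lTensor X := by
      rw [← LinearMap.lTensor_add]
      congr 1
      ext y <;> simp
    rw [this, LinearMap.add_apply, LinearMap.lTensor_comp, LinearMap.lTensor_comp _ (LinearMap.inr K _ _),
      LinearMap.comp_apply, LinearMap.comp_apply, h', lTensor_mkQ_eq_zero hx]
    simp

end LinearAlgebra

end

section

/-! ### Subcomplexes of a tensor product of complexes -/

section Omega

variable {K : Type u} [CommRing K]

/-- A single condition suffices because a differential that does not lower the degree by one is
zero. For `i = 0` the truncated `i - 1` is `0` and the condition is empty, since `C.d 0 0 = 0`. -/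
theorem omegaX_eq (C : ChainComplex (ModuleCat.{u} K) ℕ) (D : ∀ n, Submodule K (C.X n)) (i : ℕ) :
    omegaX C D i = D i ⊓ (D (i - 1)).comap (C.d i (i - 1)).hom := by
  ext x
  rw [mem_omegaX, Submodule.mem_inf, Submodule.mem_comap]
  refine and_congr_right fun _ => ⟨fun h => h _, fun h j => ?_⟩
  by_cases hj : j + 1 = i
  · subst hj
    exact h
  · rw [C.shape i j hj]
    exact (D j).zero_mem

theorem omegaX_le (C : ChainComplex (ModuleCat.{u} K) ℕ) (D : ∀ n, Submodule K (C.X n)) (i : ℕ) :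
    omegaX C D i ≤ D i := inf_le_left

end Omega

variable {K : Type u} [Field K]

/-- Maps between `C ⊗ C'` and `E`, in the form of a shuffle map `sh` with a retraction `ret`, that
compare the subcomplexes given by graded submodules `D`, `D'` and `DE`. The submodules `N` and `N'`
are subcomplexes on which `sh` is a chain map. -/
structure ShuffleData (C C' E : ChainComplex (ModuleCat.{u} K) ℕ)
    (D N : ∀ n, Submodule K (C.X n)) (D' N' : ∀ n, Submodule K (C'.X n))
    (DE : ∀ n, Submodule K (E.X n)) where
  sh : ∀ p q n : ℕ, C.X p ⊗[K] C'.X q →ₗ[K] E.X n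
  ret : ∀ p q n : ℕ, E.X n →ₗ[K] C.X p ⊗[K] C'.X q
  le : ∀ n, D n ≤ N n
  le' : ∀ n, D' n ≤ N' n
  d_mem : ∀ n, ∀ x ∈ N n, (C.d n (n - 1)).hom x ∈ N (n - 1)
  d_mem' : ∀ n, ∀ x ∈ N' n, (C'.d n (n - 1)).hom x ∈ N' (n - 1)
  -- For `p = 0` or `q = 0` the truncated subtraction leaves the index at `0`; the differential
  -- there is zero, so the corresponding term disappears.
  d_sh : ∀ p q n, p + q = n + 1 → ∀ x ∈ N p, ∀ y ∈ N' q,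
    (E.d (n + 1) n).hom (sh p q (n + 1) (x ⊗ₜ y)) =
      sh (p - 1) q n ((C.d p (p - 1)).hom x ⊗ₜ y) +
        (-1 : ℤ) ^ p • sh p (q - 1) n (x ⊗ₜ (C'.d q (q - 1)).hom y)
  sh_mem : ∀ p q n, p + q = n → ∀ x ∈ D p, ∀ y ∈ D' q, sh p q n (x ⊗ₜ y) ∈ DE n
  ret_sh : ∀ p q n, p + q = n → ∀ x ∈ N p, ∀ y ∈ N' q, ret p q n (sh p q n (x ⊗ₜ y)) = x ⊗ₜ y
  ret_sh_of_ne : ∀ p q n, p + q = n → ∀ p' q', p' + q' = n → p ≠ p' → ∀ x ∈ N p', ∀ y ∈ N' q',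
    ret p q n (sh p' q' n (x ⊗ₜ y)) = 0
  ret_mem : ∀ p q n, p + q = n → ∀ x ∈ DE n,
    ret p q n x ∈ LinearMap.range (TensorProduct.mapIncl (D p) (D' q))
  -- Required only on `ω(E, DE)`: a general element of `DE n` need not be a sum of shuffles.
  sum_sh_ret : ∀ n, ∀ x ∈ omegaX E DE n,
    ∑ a ∈ Finset.HasAntidiagonal.antidiagonal n, sh a.1 a.2 n (ret a.1 a.2 n x) = x

theorem range_mapIncl_le_iff {X Y : Type*} [AddCommGroup X] [Module K X] [AddCommGroup Y]
    [Module K Y] (S : Submodule K X) (T : Submodule K Y) (U : Submodule K (X ⊗[K] Y)) :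
    LinearMap.range (TensorProduct.mapIncl S T) ≤ U ↔ ∀ x ∈ S, ∀ y ∈ T, x ⊗ₜ y ∈ U := by
  constructor
  · intro h x hx y hy
    exact h ⟨⟨x, hx⟩ ⊗ₜ ⟨y, hy⟩, rfl⟩
  · rintro h _ ⟨z, rfl⟩
    induction z with
    | zero => simp
    | add a b ha hb => simpa only [map_add] using add_mem ha hb
    | tmul a b => exact h _ a.2 _ b.2

theorem range_mapIncl_mono {X Y : Type*} [AddCommGroup X] [Module K X] [AddCommGroup Y]
    [Module K Y] {S S₁ : Submodule K X} {T T₁ : Submodule K Y} (h : S ≤ S₁) (h' : T ≤ T₁) :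
    LinearMap.range (TensorProduct.mapIncl S T) ≤ LinearMap.range (TensorProduct.mapIncl S₁ T₁) :=
  (range_mapIncl_le_iff _ _ _).2 fun x hx y hy => ⟨⟨x, h hx⟩ ⊗ₜ ⟨y, h' hy⟩, rfl⟩

theorem tmul_mem_range_mapIncl {X Y : Type*} [AddCommGroup X] [Module K X] [AddCommGroup Y]
    [Module K Y] {S : Submodule K X} {T : Submodule K Y} {x : X} {y : Y} (h : x ∈ S) (h' : y ∈ T) :
    x ⊗ₜ[K] y ∈ LinearMap.range (TensorProduct.mapIncl S T) := ⟨⟨x, h⟩ ⊗ₜ ⟨y, h'⟩, rfl⟩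

theorem eqOn_range_mapIncl {X Y Z : Type*} [AddCommGroup X] [Module K X] [AddCommGroup Y]
    [Module K Y] [AddCommGroup Z] [Module K Z] {S : Submodule K X} {T : Submodule K Y}
    {f g : X ⊗[K] Y →ₗ[K] Z} (h : ∀ x ∈ S, ∀ y ∈ T, f (x ⊗ₜ y) = g (x ⊗ₜ y)) {z : X ⊗[K] Y}
    (hz : z ∈ LinearMap.range (TensorProduct.mapIncl S T)) : f z = g z :=
  (range_mapIncl_le_iff S T (LinearMap.eqLocus f g)).2 h hz

namespace ShuffleData

variable {C C' E : ChainComplex (ModuleCat.{u} K) ℕ}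
    {D N : ∀ n, Submodule K (C.X n)} {D' N' : ∀ n, Submodule K (C'.X n)}
    {DE : ∀ n, Submodule K (E.X n)} (S : ShuffleData C C' E D N D' N' DE)


theorem d_sh_apply {p q n : ℕ} (h : p + q = n + 1) {c : C.X p ⊗[K] C'.X q}
    (hc : c ∈ LinearMap.range (TensorProduct.mapIncl (N p) (N' q))) :
    (E.d (n + 1) n).hom (S.sh p q (n + 1) c) =
      S.sh (p - 1) q n ((C.d p (p - 1)).hom.rTensor _ c) +
        (-1 : ℤ) ^ p • S.sh p (q - 1) n ((C'.d q (q - 1)).hom.lTensor _ c) :=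
  eqOn_range_mapIncl (f := (E.d (n + 1) n).hom ∘ₗ S.sh p q (n + 1))
    (g := S.sh (p - 1) q n ∘ₗ (C.d p (p - 1)).hom.rTensor _ +
      (-1 : ℤ) ^ p • (S.sh p (q - 1) n ∘ₗ (C'.d q (q - 1)).hom.lTensor _))
    (fun x hx y hy => by simpa using S.d_sh p q n h x hx y hy) hc

theorem sh_mem_apply {p q n : ℕ} (h : p + q = n) {c : C.X p ⊗[K] C'.X q}
    (hc : c ∈ LinearMap.range (TensorProduct.mapIncl (D p) (D' q))) : S.sh p q n c ∈ DE n :=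
  (range_mapIncl_le_iff (D p) (D' q) ((DE n).comap (S.sh p q n))).2 (S.sh_mem p q n h) hc

theorem ret_sh_apply {p q n : ℕ} (h : p + q = n) {c : C.X p ⊗[K] C'.X q}
    (hc : c ∈ LinearMap.range (TensorProduct.mapIncl (N p) (N' q))) :
    S.ret p q n (S.sh p q n c) = c :=
  eqOn_range_mapIncl (f := S.ret p q n ∘ₗ S.sh p q n) (g := LinearMap.id) (S.ret_sh p q n h) hc

theorem ret_sh_apply_of_ne {p q n : ℕ} (h : p + q = n) {p' q' : ℕ} (h' : p' + q' = n)
    (hne : p ≠ p') {c : C.X p' ⊗[K] C'.X q'}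
    (hc : c ∈ LinearMap.range (TensorProduct.mapIncl (N p') (N' q'))) :
    S.ret p q n (S.sh p' q' n c) = 0 :=
  eqOn_range_mapIncl (f := S.ret p q n ∘ₗ S.sh p' q' n) (g := 0)
    (S.ret_sh_of_ne p q n h p' q' h' hne) hc

theorem rTensor_d_mem (S : ShuffleData C C' E D N D' N' DE) {p q : ℕ} {c : C.X p ⊗[K] C'.X q}
    (hc : c ∈ LinearMap.range (TensorProduct.mapIncl (N p) (N' q))) :
    (C.d p (p - 1)).hom.rTensor _ c ∈
      LinearMap.range (TensorProduct.mapIncl (N (p - 1)) (N' q)) :=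
  (range_mapIncl_le_iff _ _ (Submodule.comap ((C.d p (p - 1)).hom.rTensor _)
    (LinearMap.range (TensorProduct.mapIncl (N (p - 1)) (N' q))))).2
    (fun x hx y hy => tmul_mem_range_mapIncl (y := y) (S.d_mem p x hx) hy) hc

theorem lTensor_d_mem (S : ShuffleData C C' E D N D' N' DE) {p q : ℕ} {c : C.X p ⊗[K] C'.X q}
    (hc : c ∈ LinearMap.range (TensorProduct.mapIncl (N p) (N' q))) :
    (C'.d q (q - 1)).hom.lTensor _ c ∈
      LinearMap.range (TensorProduct.mapIncl (N p) (N' (q - 1))) :=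
  (range_mapIncl_le_iff _ _ (Submodule.comap ((C'.d q (q - 1)).hom.lTensor _)
    (LinearMap.range (TensorProduct.mapIncl (N p) (N' (q - 1)))))).2
    (fun x hx y hy => tmul_mem_range_mapIncl (x := x) hx (S.d_mem' q y hy)) hc

theorem sh_mem_omegaX {p q n : ℕ} (h : p + q = n) {c : C.X p ⊗[K] C'.X q}
    (hc : c ∈ LinearMap.range (TensorProduct.mapIncl (omegaX C D p) (omegaX C' D' q))) :
    S.sh p q n c ∈ omegaX E DE n := by
  have hcD := range_mapIncl_mono (omegaX_le C D p) (omegaX_le C' D' q) hc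
  have hcN := range_mapIncl_mono (S.le p) (S.le' q) hcD
  rw [omegaX_eq]
  refine ⟨S.sh_mem_apply h hcD, ?_⟩
  change _ ∈ Submodule.comap _ _
  rw [Submodule.mem_comap]
  rcases n with _ | n
  · rw [E.shape _ _ (by simp)]
    exact zero_mem _
  · change (E.d (n + 1) n).hom _ ∈ DE n
    rw [S.d_sh_apply h hcN]
    refine add_mem ?_ (zsmul_mem ?_ _)
    · rcases p with _ | p
      · rw [C.shape _ _ (by simp)]
        simp
      · refine S.sh_mem_apply (by simp; omega) ?_
        refine (range_mapIncl_le_iff _ _ (Submodule.comap ((C.d (p + 1) p).hom.rTensor _)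
          (LinearMap.range (TensorProduct.mapIncl (D p) (D' q))))).2
          (fun x hx y hy => tmul_mem_range_mapIncl ?_ (omegaX_le C' D' q hy)) hc
        exact (mem_omegaX.1 hx).2 _
    · rcases q with _ | q
      · rw [C'.shape _ _ (by simp)]
        simp
      · refine S.sh_mem_apply (by simp; omega) ?_
        refine (range_mapIncl_le_iff _ _ (Submodule.comap ((C'.d (q + 1) q).hom.lTensor _)
          (LinearMap.range (TensorProduct.mapIncl (D p) (D' q))))).2
          (fun x hx y hy => tmul_mem_range_mapIncl (omegaX_le C D p hx) ?_) hc
        exact (mem_omegaX.1 hy).2 _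

theorem ret_mem_N {p q n : ℕ} (h : p + q = n) {x : E.X n} (hx : x ∈ DE n) :
    S.ret p q n x ∈ LinearMap.range (TensorProduct.mapIncl (N p) (N' q)) :=
  range_mapIncl_mono (S.le p) (S.le' q) (S.ret_mem p q n h x hx)

/-- Write `x` as the sum of the shuffles of its components and apply the Leibniz rule. Only the
components at `(p + 1, q)` and `(p, q + 1)` have boundary terms in bidegree `(p, q)`. -/
theorem ret_d {p q n : ℕ} (h : p + q = n) {x : E.X (n + 1)} (hx : x ∈ omegaX E DE (n + 1)) :
    S.ret p q n ((E.d (n + 1) n).hom x) =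
      (C.d (p + 1) p).hom.rTensor _ (S.ret (p + 1) q (n + 1) x) +
        (-1 : ℤ) ^ p • (C'.d (q + 1) q).hom.lTensor _ (S.ret p (q + 1) (n + 1) x) := by
  have hxD := omegaX_le _ _ _ hx
  conv_lhs => rw [← S.sum_sh_ret _ x hx]
  have key : ∀ a ∈ Finset.HasAntidiagonal.antidiagonal (n + 1),
      S.ret p q n ((E.d (n + 1) n).hom (S.sh a.1 a.2 (n + 1) (S.ret a.1 a.2 (n + 1) x))) =
        S.ret p q n (S.sh (a.1 - 1) a.2 n
          ((C.d a.1 (a.1 - 1)).hom.rTensor _ (S.ret a.1 a.2 (n + 1) x))) +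
        (-1 : ℤ) ^ a.1 • S.ret p q n (S.sh a.1 (a.2 - 1) n
          ((C'.d a.2 (a.2 - 1)).hom.lTensor _ (S.ret a.1 a.2 (n + 1) x))) := by
    intro a ha
    rw [Finset.HasAntidiagonal.mem_antidiagonal] at ha
    rw [S.d_sh_apply ha (S.ret_mem_N ha hxD), map_add, map_zsmul]
  have m1 : (p + 1, q) ∈ Finset.HasAntidiagonal.antidiagonal (n + 1) := by
    rw [Finset.HasAntidiagonal.mem_antidiagonal]
    omega
  have m2 : (p, q + 1) ∈ Finset.HasAntidiagonal.antidiagonal (n + 1) := by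
    rw [Finset.HasAntidiagonal.mem_antidiagonal]
    omega
  rw [map_sum, map_sum, Finset.sum_congr rfl key, Finset.sum_add_distrib]
  congr 1
  · refine (Finset.sum_eq_single_of_mem (p + 1, q) m1 ?_).trans ?_
    rotate_left
    · exact S.ret_sh_apply h (S.rTensor_d_mem (p := p + 1) (q := q) (S.ret_mem_N (by omega) hxD))
    · rintro ⟨a, b⟩ ha hne
      rw [Finset.HasAntidiagonal.mem_antidiagonal] at ha
      simp only at ha ⊢
      rcases a with _ | a
      · rw [C.shape _ _ (by simp)]
        simp
      · refine S.ret_sh_apply_of_ne h (by simp; omega) ?_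
          (S.rTensor_d_mem (p := a + 1) (q := b) (S.ret_mem_N (by omega) hxD))
        intro hp
        apply hne
        rw [Prod.mk.injEq]
        omega
  · refine (Finset.sum_eq_single_of_mem (p, q + 1) m2 ?_).trans ?_
    rotate_left
    · congr 1
      exact S.ret_sh_apply h (S.lTensor_d_mem (p := p) (q := q + 1) (S.ret_mem_N (by omega) hxD))
    · rintro ⟨a, b⟩ ha hne
      rw [Finset.HasAntidiagonal.mem_antidiagonal] at ha
      simp only at ha ⊢
      rcases b with _ | b
      · rw [C'.shape _ _ (by simp)]
        simp
      · rw [S.ret_sh_apply_of_ne h (by simp; omega) _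
          (S.lTensor_d_mem (p := a) (q := b + 1) (S.ret_mem_N (by omega) hxD)), smul_zero]
        intro hp
        apply hne
        rw [Prod.mk.injEq]
        omega

/-- The component of `d x` in bidegree `(p - 1, q)` lies in `D ⊗ D'`, and so does the component of
`x` in bidegree `(p - 1, q + 1)`. Modulo `D (p - 1)` in the first factor, both this component of `d
x` and its vertical summand vanish, hence the horizontal summand does as well. The second factor is
symmetric. -/
theorem ret_mem_omegaX {p q n : ℕ} (h : p + q = n) {x : E.X n} (hx : x ∈ omegaX E DE n) :
    S.ret p q n x ∈
      LinearMap.range (TensorProduct.mapIncl (omegaX C D p) (omegaX C' D' q)) := by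
  have hxD := omegaX_le _ _ _ hx
  rw [omegaX_eq, omegaX_eq]
  apply mem_range_mapIncl_inf_comap _ _ _ _ _ _ _ (S.ret_mem p q n h x hxD)
  · rcases p with _ | p
    · rw [C.shape _ _ (by simp)]
      simp
    · obtain ⟨n, rfl⟩ : ∃ m, n = m + 1 := ⟨p + q, by omega⟩
      have hm : p + q = n := by omega
      have e := S.ret_d hm hx
      have h1 := rTensor_mkQ_eq_zero (S.ret_mem p q n hm _ ((mem_omegaX.1 hx).2 n))
      have h2 := rTensor_mkQ_eq_zero (S.ret_mem p (q + 1) (n + 1) (by omega) x hxD)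
      rw [e, map_add, map_zsmul, ← LinearMap.rTensor_comp_apply, rTensor_lTensor_comm, h2,
        map_zero, smul_zero, add_zero] at h1
      exact h1
  · rcases q with _ | q
    · rw [C'.shape _ _ (by simp)]
      simp
    · obtain ⟨n, rfl⟩ : ∃ m, n = m + 1 := ⟨p + q, by omega⟩
      have hm : p + q = n := by omega
      have e := S.ret_d hm hx
      have h1 := lTensor_mkQ_eq_zero (S.ret_mem p q n hm _ ((mem_omegaX.1 hx).2 n))
      have h2 := lTensor_mkQ_eq_zero (S.ret_mem (p + 1) q (n + 1) (by omega) x hxD)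
      rw [e, map_add, map_zsmul, ← LinearMap.lTensor_comp_apply, ← rTensor_lTensor_comm, h2,
        map_zero, zero_add] at h1
      rcases neg_one_pow_eq_or ℤ p with hp | hp
      · rw [hp, one_smul] at h1
        exact h1
      · rw [hp, neg_one_smul, neg_eq_zero] at h1
        exact h1

end ShuffleData

end

/-! ### The isomorphism of complexes obtained from shuffle data -/

section

variable {K : Type u} [Field K]

namespace ShuffleData

variable {C C' E : ChainComplex (ModuleCat.{u} K) ℕ}
    {D N : ∀ n, Submodule K (C.X n)} {D' N' : ∀ n, Submodule K (C'.X n)}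
    {DE : ∀ n, Submodule K (E.X n)} (S : ShuffleData C C' E D N D' N' DE)

/-- The shuffle map restricted to `ω(C, D) ⊗ ω(C', D')`. -/
def omegaSh {p q n : ℕ} (h : p + q = n) :
    omegaX C D p ⊗[K] omegaX C' D' q →ₗ[K] omegaX E DE n :=
  (S.sh p q n ∘ₗ TensorProduct.mapIncl (omegaX C D p) (omegaX C' D' q)).codRestrict _
    fun c => S.sh_mem_omegaX h ⟨c, rfl⟩

/-- The retraction of the shuffle map restricted to `ω(E, DE)`. -/
def omegaRet {p q n : ℕ} (h : p + q = n) :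
    omegaX E DE n →ₗ[K] omegaX C D p ⊗[K] omegaX C' D' q :=
  (LinearEquiv.ofInjective _ (mapIncl_injective (omegaX C D p) (omegaX C' D' q))).symm.toLinearMap ∘ₗ
    (S.ret p q n ∘ₗ (omegaX E DE n).subtype).codRestrict
      (LinearMap.range (TensorProduct.mapIncl (omegaX C D p) (omegaX C' D' q)))
      fun x => S.ret_mem_omegaX h x.2

theorem mapIncl_omegaRet {p q n : ℕ} (h : p + q = n) (x : omegaX E DE n) :
    TensorProduct.mapIncl _ _ (S.omegaRet h x) = S.ret p q n x := by
  have := LinearEquiv.apply_symm_apply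
    (LinearEquiv.ofInjective _ (mapIncl_injective (omegaX C D p) (omegaX C' D' q)))
    ⟨S.ret p q n x, S.ret_mem_omegaX h x.2⟩
  exact congrArg Subtype.val this

theorem omegaRet_omegaSh {p q n : ℕ} (h : p + q = n) (x : omegaX C D p ⊗[K] omegaX C' D' q) :
    S.omegaRet h (S.omegaSh h x) = x := by
  apply mapIncl_injective
  rw [mapIncl_omegaRet]
  exact S.ret_sh_apply h (range_mapIncl_mono ((omegaX_le C D p).trans (S.le p))
    ((omegaX_le C' D' q).trans (S.le' q)) ⟨x, rfl⟩)

theorem omegaRet_omegaSh_of_ne {p q n : ℕ} (h : p + q = n) {p' q' : ℕ} (h' : p' + q' = n)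
    (hne : p ≠ p') (x : omegaX C D p' ⊗[K] omegaX C' D' q') :
    S.omegaRet h (S.omegaSh h' x) = 0 := by
  apply mapIncl_injective
  rw [mapIncl_omegaRet, map_zero]
  exact S.ret_sh_apply_of_ne h h' hne (range_mapIncl_mono ((omegaX_le C D p').trans (S.le p'))
    ((omegaX_le C' D' q').trans (S.le' q')) ⟨x, rfl⟩)

theorem sum_omegaSh_omegaRet {n : ℕ} (x : omegaX E DE n) :
    ∑ a : Finset.HasAntidiagonal.antidiagonal n,
      S.omegaSh (Finset.HasAntidiagonal.mem_antidiagonal.1 a.2)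
        (S.omegaRet (Finset.HasAntidiagonal.mem_antidiagonal.1 a.2) x) = x := by
  apply Subtype.ext
  rw [AddSubmonoidClass.coe_finsetSum]
  refine ((Finset.sum_congr rfl fun a _ => ?_).trans (Finset.sum_coe_sort
    (Finset.HasAntidiagonal.antidiagonal n)
    fun a => S.sh a.1 a.2 n (S.ret a.1 a.2 n x.1))).trans (S.sum_sh_ret n x.1 x.2)
  exact congrArg (S.sh a.1.1 a.1.2 n) (S.mapIncl_omegaRet _ x)

/-- The comparison takes place in `E`: for `p = 0` or `q = 0` the truncated indices no longer add up
to `n`, so `omegaSh` is not available for the vanishing term, whereas `S.sh` is. -/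
theorem d_omegaSh {p q n : ℕ} (h : p + q = n + 1) (x : omegaX C D p ⊗[K] omegaX C' D' q) :
    (omegaX E DE n).subtype (((omega E DE).d (n + 1) n).hom (S.omegaSh h x)) =
      S.sh (p - 1) q n (TensorProduct.mapIncl (omegaX C D (p - 1)) (omegaX C' D' q)
        (((omega C D).d p (p - 1)).hom.rTensor _ x)) +
      (-1 : ℤ) ^ p • S.sh p (q - 1) n (TensorProduct.mapIncl (omegaX C D p) (omegaX C' D' (q - 1))
        (((omega C' D').d q (q - 1)).hom.lTensor _ x)) := by
  refine (S.d_sh_apply h (range_mapIncl_mono ((omegaX_le C D p).trans (S.le p))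
    ((omegaX_le C' D' q).trans (S.le' q)) ⟨x, rfl⟩)).trans ?_
  have e1 : (C.d p (p - 1)).hom.rTensor _ ∘ₗ TensorProduct.mapIncl (omegaX C D p) (omegaX C' D' q) =
      TensorProduct.mapIncl (omegaX C D (p - 1)) (omegaX C' D' q) ∘ₗ
        ((omega C D).d p (p - 1)).hom.rTensor _ := by
    apply TensorProduct.ext'
    intro a b
    rfl
  have e2 : (C'.d q (q - 1)).hom.lTensor _ ∘ₗ TensorProduct.mapIncl (omegaX C D p) (omegaX C' D' q) =
      TensorProduct.mapIncl (omegaX C D p) (omegaX C' D' (q - 1)) ∘ₗ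
        ((omega C' D').d q (q - 1)).hom.lTensor _ := by
    apply TensorProduct.ext'
    intro a b
    rfl
  exact congrArg₂ (fun a b => S.sh (p - 1) q n a + (-1 : ℤ) ^ p • S.sh p (q - 1) n b)
    (LinearMap.congr_fun e1 x) (LinearMap.congr_fun e2 x)

/-- The inclusion of `ω(E, DE)` into `E` in degree `n`. -/
def omegaIncl (E : ChainComplex (ModuleCat.{u} K) ℕ) (DE : ∀ n, Submodule K (E.X n)) (n : ℕ) :
    (omega E DE).X n ⟶ E.X n :=
  ModuleCat.ofHom (omegaX E DE n).subtype

instance (E : ChainComplex (ModuleCat.{u} K) ℕ) (DE : ∀ n, Submodule K (E.X n)) (n : ℕ) :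
    Mono (omegaIncl E DE n) :=
  (ModuleCat.mono_iff_injective _).2 (omegaX E DE n).subtype_injective

/-- The shuffle map restricted to `ω(C, D) ⊗ ω(C', D')`, with values in `E`. -/
def preShHom (p q n : ℕ) : (omega C D).X p ⊗ (omega C' D').X q ⟶ E.X n :=
  ModuleCat.ofHom (S.sh p q n ∘ₗ TensorProduct.mapIncl (omegaX C D p) (omegaX C' D' q))

/-- The shuffle map restricted to `ω(C, D) ⊗ ω(C', D')`, as a morphism. -/
def shHom {p q n : ℕ} (h : p + q = n) :
    (omega C D).X p ⊗ (omega C' D').X q ⟶ (omega E DE).X n :=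
  ModuleCat.ofHom (S.omegaSh h)

/-- The morphism to a summand of the tensor product of complexes induced by the retraction. -/
def retHom {p q n : ℕ} (h : p + q = n) :
    (omega E DE).X n ⟶ (omega C D).X p ⊗ (omega C' D').X q :=
  ModuleCat.ofHom (S.omegaRet h)

theorem shHom_retHom {p q n : ℕ} (h : p + q = n) : S.shHom h ≫ S.retHom h = 𝟙 _ := by
  ext1
  exact LinearMap.ext (S.omegaRet_omegaSh h)

theorem shHom_retHom_of_ne {p q n : ℕ} (h : p + q = n) {p' q' : ℕ} (h' : p' + q' = n)
    (hne : p ≠ p') : S.shHom h' ≫ S.retHom h = 0 := by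
  ext1
  exact LinearMap.ext (S.omegaRet_omegaSh_of_ne h h' hne)

theorem sum_retHom_shHom (n : ℕ) :
    ∑ a : Finset.HasAntidiagonal.antidiagonal n,
      S.retHom (Finset.HasAntidiagonal.mem_antidiagonal.1 a.2) ≫
        S.shHom (Finset.HasAntidiagonal.mem_antidiagonal.1 a.2) = 𝟙 ((omega E DE).X n) := by
  ext1
  rw [ModuleCat.hom_sum]
  ext1 x
  rw [LinearMap.sum_apply]
  exact S.sum_omegaSh_omegaRet x

theorem shHom_d {p q n : ℕ} (h : p + q = n + 1) :
    S.shHom h ≫ (omega E DE).d (n + 1) n ≫ omegaIncl E DE n =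
      (omega C D).d p (p - 1) ▷ _ ≫ S.preShHom (p - 1) q n +
        (-1 : ℤ) ^ p • (_ ◁ (omega C' D').d q (q - 1) ≫ S.preShHom p (q - 1) n) := by
  ext1
  exact LinearMap.ext (S.d_omegaSh h)

/-- The morphism from the tensor product of complexes induced by the shuffle map, in degree `n`. -/
def tensorXHom (n : ℕ) : (omega C D ⊗ omega C' D').X n ⟶ (omega E DE).X n :=
  HomologicalComplex.mapBifunctorDesc (K₁ := omega C D) (K₂ := omega C' D')
    (F := curriedTensor _) (c := ComplexShape.down ℕ) fun _ _ h => S.shHom h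

theorem ι_tensorXHom {p q n : ℕ} (h : p + q = n) :
    HomologicalComplex.ιTensorObj (omega C D) (omega C' D') p q n h ≫ S.tensorXHom n =
      S.shHom h :=
  HomologicalComplex.ι_mapBifunctorDesc _ _ _ _

/-- The inverse of `tensorXHom`. -/
def tensorXInv (n : ℕ) : (omega E DE).X n ⟶ (omega C D ⊗ omega C' D').X n :=
  ∑ a : Finset.HasAntidiagonal.antidiagonal n,
    S.retHom (Finset.HasAntidiagonal.mem_antidiagonal.1 a.2) ≫
      HomologicalComplex.ιTensorObj (omega C D) (omega C' D') a.1.1 a.1.2 n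
        (Finset.HasAntidiagonal.mem_antidiagonal.1 a.2)

theorem tensorXHom_inv (n : ℕ) : S.tensorXHom n ≫ S.tensorXInv n = 𝟙 _ := by
  apply HomologicalComplex.mapBifunctor.hom_ext
  intro p q h
  have key : HomologicalComplex.ιTensorObj (omega C D) (omega C' D') p q n h ≫ S.tensorXHom n ≫
      S.tensorXInv n = HomologicalComplex.ιTensorObj (omega C D) (omega C' D') p q n h := by
    rw [← Category.assoc, S.ι_tensorXHom, tensorXInv, Preadditive.comp_sum]
    rw [Finset.sum_eq_single ⟨(p, q), Finset.HasAntidiagonal.mem_antidiagonal.2 h⟩]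
    · rw [← Category.assoc, S.shHom_retHom, Category.id_comp]
    · rintro ⟨⟨p', q'⟩, h'⟩ - hne
      rw [Finset.HasAntidiagonal.mem_antidiagonal] at h'
      rw [← Category.assoc, S.shHom_retHom_of_ne h' h, Limits.zero_comp]
      rintro rfl
      apply hne
      have : q' = q := Nat.add_left_cancel (h'.trans h.symm)
      subst this
      rfl
    · intro h
      exact absurd (Finset.mem_univ _) h
  exact key.trans (Category.comp_id _).symm

theorem tensorXInv_hom (n : ℕ) : S.tensorXInv n ≫ S.tensorXHom n = 𝟙 _ := by
  rw [tensorXInv, Preadditive.sum_comp, ← S.sum_retHom_shHom]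
  refine Finset.sum_congr rfl fun a _ => ?_
  rw [Category.assoc, S.ι_tensorXHom]

theorem d₁_tensorXHom {p q n : ℕ} (h : p + q = n + 1) :
    HomologicalComplex.mapBifunctor.d₁ (omega C D) (omega C' D') (curriedTensor _)
      (ComplexShape.down ℕ) p q n ≫ S.tensorXHom n ≫ omegaIncl E DE n =
    (omega C D).d p (p - 1) ▷ _ ≫ S.preShHom (p - 1) q n := by
  rcases p with _ | p
  -- No horizontal differential leaves degree `0`, so both sides vanish.
  · rw [HomologicalComplex.mapBifunctor.d₁_eq_zero _ _ _ _ _ _ _ (by simp),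
      (omega C D).shape _ _ (by simp), MonoidalPreadditive.zero_whiskerRight, Limits.zero_comp,
      Limits.zero_comp]
  · have h' : p + q = n := by omega
    rw [HomologicalComplex.mapBifunctor.d₁_eq (omega C D) (omega C' D') (curriedTensor _)
      (ComplexShape.down ℕ) (i₁ := p + 1) (i₁' := p) rfl q n h']
    have e : ComplexShape.ε₁ (ComplexShape.down ℕ) (ComplexShape.down ℕ) (ComplexShape.down ℕ)
      (p + 1, q) = 1 := rfl
    rw [e, one_smul, Category.assoc, ← Category.assoc _ (S.tensorXHom n), S.ι_tensorXHom]
    rfl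

theorem d₂_tensorXHom {p q n : ℕ} (h : p + q = n + 1) :
    HomologicalComplex.mapBifunctor.d₂ (omega C D) (omega C' D') (curriedTensor _)
      (ComplexShape.down ℕ) p q n ≫ S.tensorXHom n ≫ omegaIncl E DE n =
    (-1 : ℤ) ^ p • (_ ◁ (omega C' D').d q (q - 1) ≫ S.preShHom p (q - 1) n) := by
  rcases q with _ | q
  · rw [HomologicalComplex.mapBifunctor.d₂_eq_zero _ _ _ _ _ _ _ (by simp),
      (omega C' D').shape _ _ (by simp), MonoidalPreadditive.whiskerLeft_zero, Limits.zero_comp,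
      Limits.zero_comp, smul_zero]
  · have h' : p + q = n := by omega
    rw [HomologicalComplex.mapBifunctor.d₂_eq (omega C D) (omega C' D') (curriedTensor _)
      (ComplexShape.down ℕ) p (i₂ := q + 1) (i₂' := q) rfl n h']
    have e : ComplexShape.ε₂ (ComplexShape.down ℕ) (ComplexShape.down ℕ) (ComplexShape.down ℕ)
      (p, q + 1) = (-1) ^ p := rfl
    rw [e, Linear.units_smul_comp, Category.assoc, ← Category.assoc _ (S.tensorXHom n),
      S.ι_tensorXHom, Units.smul_def, Units.val_pow_eq_pow_val, Units.val_neg, Units.val_one]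
    rfl

/-- The isomorphism of complexes `ω(C, D) ⊗ ω(C', D') ≅ ω(E, DE)`. -/
def tensorIso : omega C D ⊗ omega C' D' ≅ omega E DE :=
  HomologicalComplex.Hom.isoOfComponents
    (fun n => ⟨S.tensorXHom n, S.tensorXInv n, S.tensorXHom_inv n, S.tensorXInv_hom n⟩) <| by
    rintro _ n rfl
    rw [← cancel_mono (omegaIncl E DE n)]
    apply HomologicalComplex.mapBifunctor.hom_ext
    intro p q h
    change p + q = n + 1 at h
    have e1 : HomologicalComplex.ιTensorObj (omega C D) (omega C' D') p q (n + 1) h ≫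
        (omega C D ⊗ omega C' D').d (n + 1) n =
        HomologicalComplex.mapBifunctor.d₁ (omega C D) (omega C' D') (curriedTensor _)
          (ComplexShape.down ℕ) p q n +
        HomologicalComplex.mapBifunctor.d₂ (omega C D) (omega C' D') (curriedTensor _)
          (ComplexShape.down ℕ) p q n := by
      refine (congrArg (_ ≫ ·) (HomologicalComplex.mapBifunctor.d_eq (omega C D) (omega C' D')
        (curriedTensor _) (ComplexShape.down ℕ) (n + 1) n)).trans ?_
      rw [Preadditive.comp_add, HomologicalComplex.mapBifunctor.ι_D₁,
        HomologicalComplex.mapBifunctor.ι_D₂]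
    have e2 : HomologicalComplex.ιTensorObj (omega C D) (omega C' D') p q (n + 1) h ≫
        S.tensorXHom (n + 1) ≫ (omega E DE).d (n + 1) n ≫ omegaIncl E DE n =
        HomologicalComplex.ιTensorObj (omega C D) (omega C' D') p q (n + 1) h ≫
          (omega C D ⊗ omega C' D').d (n + 1) n ≫ S.tensorXHom n ≫ omegaIncl E DE n := by
      rw [← Category.assoc, S.ι_tensorXHom, S.shHom_d h, ← Category.assoc _ ((_ ⊗ _ : ChainComplex _ _).d _ _), e1,
        Preadditive.add_comp, S.d₁_tensorXHom h, S.d₂_tensorXHom h]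
    rw [Category.assoc, Category.assoc]
    exact e2

end ShuffleData

end

section

/-! ### The Künneth isomorphism over a field -/

section Kunneth

variable {K : Type u} [Field K]

/-- Over a field the image of `f` is a direct summand of `Y` and `f` splits over its image; `g` is
the projection followed by the section. -/
theorem exists_generalizedInverse {X Y : ModuleCat.{u} K} (f : X ⟶ Y) :
    ∃ g : Y ⟶ X, f ≫ g ≫ f = f := by
  obtain ⟨s, hs⟩ := f.hom.rangeRestrict.exists_rightInverse_of_surjective f.hom.range_rangeRestrict
  obtain ⟨r, hr⟩ := (LinearMap.range f.hom).subtype.exists_leftInverse_of_injective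
    (LinearMap.range f.hom).ker_subtype
  refine ⟨ModuleCat.ofHom (s ∘ₗ r), ?_⟩
  ext x
  have h1 : r (f.hom x) = f.hom.rangeRestrict x :=
    LinearMap.congr_fun hr (f.hom.rangeRestrict x)
  have h2 := congrArg Subtype.val (LinearMap.congr_fun hs (f.hom.rangeRestrict x))
  change f.hom (s (r (f.hom x))) = f.hom x
  rw [h1]
  exact h2

variable (C C' : ChainComplex (ModuleCat.{u} K) ℕ)

/-- Maps `h` with `d h d = d`. -/
def contraction (i j : ℕ) : C.X i ⟶ C.X j :=
  if (ComplexShape.down ℕ).Rel j i then (exists_generalizedInverse (C.d j i)).choose else 0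

theorem contraction_eq_zero (i j : ℕ) (h : ¬(ComplexShape.down ℕ).Rel j i) :
    contraction C i j = 0 := if_neg h

theorem d_contraction_d (j i : ℕ) : C.d j i ≫ contraction C i j ≫ C.d j i = C.d j i := by
  by_cases h : (ComplexShape.down ℕ).Rel j i
  · rw [contraction, if_pos h]
    exact (exists_generalizedInverse (C.d j i)).choose_spec
  · rw [C.shape _ _ h, Limits.zero_comp]

/-- The endomorphism `1 - d h - h d`. -/
def toHarmonic : C ⟶ C := 𝟙 C - Homotopy.nullHomotopicMap (contraction C)

/-- `1 - d h - h d` is homotopic to the identity. -/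
def toHarmonicHomotopy : Homotopy (toHarmonic C) (𝟙 C) :=
  (Homotopy.equivSubZero.symm ((Homotopy.ofEq (sub_sub_cancel _ _)).trans
    (Homotopy.nullHomotopy _ (contraction_eq_zero C)))).symm

theorem toHarmonic_f (i : ℕ) : (toHarmonic C).f i = 𝟙 _ -
    (C.d i ((ComplexShape.down ℕ).next i) ≫ contraction C _ i +
      contraction C i ((ComplexShape.down ℕ).prev i) ≫ C.d _ i) := rfl

/-- Composing with the differential leaves `d - d h d = 0`. As both composites with `d` vanish,
`toHarmonic` takes values in cycles and kills boundaries, so it factors through homology from either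
side. -/
theorem d_toHarmonic (j i : ℕ) : C.d j i ≫ (toHarmonic C).f i = 0 := by
  by_cases h : (ComplexShape.down ℕ).Rel j i
  · obtain rfl := (ComplexShape.down ℕ).prev_eq' h
    rw [toHarmonic_f, Preadditive.comp_sub, Preadditive.comp_add, C.d_comp_d_assoc,
      Limits.zero_comp, d_contraction_d, Category.comp_id, zero_add, sub_self]
  · rw [C.shape _ _ h, Limits.zero_comp]

theorem toHarmonic_d (i j : ℕ) : (toHarmonic C).f i ≫ C.d i j = 0 := by
  rw [(toHarmonic C).comm, d_toHarmonic]

/-- The homology as a complex with zero differentials. -/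
def homologyComplex : ChainComplex (ModuleCat.{u} K) ℕ where
  X n := C.homology n
  d _ _ := 0
  shape _ _ _ := rfl
  d_comp_d' _ _ _ _ _ := Limits.comp_zero

/-- The projection of a complex onto its homology. -/
def toHomologyComplex : C ⟶ homologyComplex C where
  f n := C.liftCycles ((toHarmonic C).f n) _ rfl (toHarmonic_d C _ _) ≫ C.homologyπ n
  comm' i j _ := by
    have : C.d i j ≫ C.liftCycles ((toHarmonic C).f j) _ rfl (toHarmonic_d C _ _) = 0 := by
      rw [← cancel_mono (C.iCycles j), Category.assoc, C.liftCycles_i, d_toHarmonic,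
        Limits.zero_comp]
    have e := congrArg (· ≫ C.homologyπ j) this
    exact Limits.comp_zero.trans (((Category.assoc _ _ _).symm.trans e).trans Limits.zero_comp).symm

/-- The inclusion of the homology into a complex. -/
def ofHomologyComplex : homologyComplex C ⟶ C where
  f n := C.homologyι n ≫ C.descOpcycles ((toHarmonic C).f n) _ rfl (d_toHarmonic C _ _)
  comm' i j _ := by
    have : C.descOpcycles ((toHarmonic C).f i) _ rfl (d_toHarmonic C _ _) ≫ C.d i j = 0 := by
      rw [← cancel_epi (C.pOpcycles i), C.p_descOpcycles_assoc, toHarmonic_d, Limits.comp_zero]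
    have e := congrArg (C.homologyι i ≫ ·) this
    exact (((Category.assoc _ _ _).trans e).trans Limits.comp_zero).trans Limits.zero_comp.symm

/-- Idempotence of `toHarmonic` is not needed: its square is homotopic to the identity because
`toHarmonic` is. -/
theorem toHomologyComplex_ofHomologyComplex :
    toHomologyComplex C ≫ ofHomologyComplex C = toHarmonic C ≫ toHarmonic C := by
  ext1 n
  change (_ ≫ C.homologyπ n) ≫ C.homologyι n ≫ _ = _
  rw [Category.assoc, C.homology_π_ι_assoc, C.liftCycles_i_assoc, C.p_descOpcycles]
  rfl

/-- On cycles, `toHarmonic` differs from the identity by a boundary, so it acts as the identity on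
homology. The two displayed equations express this before `C.homologyι` and `C.homologyπ` are
cancelled. -/
theorem ofHomologyComplex_toHomologyComplex :
    ofHomologyComplex C ≫ toHomologyComplex C = 𝟙 _ := by
  ext1 n
  change (C.homologyι n ≫ _) ≫ _ ≫ C.homologyπ n = 𝟙 (C.homology n)
  rw [← cancel_epi (C.homologyπ n), ← cancel_mono (C.homologyι n)]
  simp only [Category.assoc, C.homology_π_ι, C.homology_π_ι_assoc, C.liftCycles_i_assoc,
    C.p_descOpcycles_assoc, Category.comp_id]
  have h1 : C.iCycles n ≫ (toHarmonic C).f n = C.iCycles n -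
      C.iCycles n ≫ contraction C n _ ≫ C.d ((ComplexShape.down ℕ).prev n) n := by
    rw [toHarmonic_f, Preadditive.comp_sub, Preadditive.comp_add, C.iCycles_d_assoc,
      Limits.zero_comp, zero_add, Category.comp_id]
  have h2 : (toHarmonic C).f n ≫ C.pOpcycles n = C.pOpcycles n -
      C.d n ((ComplexShape.down ℕ).next n) ≫ contraction C _ n ≫ C.pOpcycles n := by
    rw [toHarmonic_f, Preadditive.sub_comp, Preadditive.add_comp, Category.assoc, Category.assoc,
      C.d_pOpcycles, Limits.comp_zero, add_zero, Category.id_comp]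
  rw [← Category.assoc, h1, Preadditive.sub_comp, h2]
  simp [Preadditive.comp_sub]

/-- Over a field, a complex is homotopy equivalent to its homology. -/
def homologyComplexEquiv : HomotopyEquiv C (homologyComplex C) where
  hom := toHomologyComplex C
  inv := ofHomologyComplex C
  homotopyHomInvId := (Homotopy.ofEq (toHomologyComplex_ofHomologyComplex C)).trans
    (((toHarmonicHomotopy C).comp (toHarmonicHomotopy C)).trans (Homotopy.ofEq (Category.comp_id _)))
  homotopyInvHomId := Homotopy.ofEq (ofHomologyComplex_toHomologyComplex C)

/-- Tensor products of homotopic morphisms are homotopic. -/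
def tensorHomotopy {A B A' B' : ChainComplex (ModuleCat.{u} K) ℕ} {f g : A ⟶ B} {f' g' : A' ⟶ B'}
    (h : Homotopy f g) (h' : Homotopy f' g') : Homotopy (f ⊗ₘ f') (g ⊗ₘ g') :=
  (HomologicalComplex.mapBifunctorMapHomotopy₁ h f' (curriedTensor _) (ComplexShape.down ℕ)).trans
    (HomologicalComplex.mapBifunctorMapHomotopy₂ g h' (curriedTensor _) (ComplexShape.down ℕ))

/-- Tensor products of homotopy equivalences are homotopy equivalences. -/
def tensorHomotopyEquiv {A B A' B' : ChainComplex (ModuleCat.{u} K) ℕ} (e : HomotopyEquiv A B)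
    (e' : HomotopyEquiv A' B') : HomotopyEquiv (A ⊗ A') (B ⊗ B') where
  hom := e.hom ⊗ₘ e'.hom
  inv := e.inv ⊗ₘ e'.inv
  homotopyHomInvId := (Homotopy.ofEq (tensorHom_comp_tensorHom _ _ _ _)).trans
    ((tensorHomotopy e.homotopyHomInvId e'.homotopyHomInvId).trans
      (Homotopy.ofEq (id_tensorHom_id _ _)))
  homotopyInvHomId := (Homotopy.ofEq (tensorHom_comp_tensorHom _ _ _ _)).trans
    ((tensorHomotopy e.homotopyInvHomId e'.homotopyInvHomId).trans
      (Homotopy.ofEq (id_tensorHom_id _ _)))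

theorem homologyComplex_tensor_d (i j : ℕ) : (homologyComplex C ⊗ homologyComplex C').d i j = 0 := by
  by_cases h : (ComplexShape.down ℕ).Rel i j
  · apply HomologicalComplex.mapBifunctor.hom_ext
    intro p q hpq
    refine (congrArg (_ ≫ ·) (HomologicalComplex.mapBifunctor.d_eq (homologyComplex C)
      (homologyComplex C') (curriedTensor _) (ComplexShape.down ℕ) i j)).trans ?_
    have e1 : HomologicalComplex.mapBifunctor.d₁ (homologyComplex C) (homologyComplex C')
        (curriedTensor _) (ComplexShape.down ℕ) p q j = 0 := by
      by_cases hp : (ComplexShape.down ℕ).Rel p ((ComplexShape.down ℕ).next p)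
      · rw [HomologicalComplex.mapBifunctor.d₁_eq' _ _ _ _ hp]
        have : (homologyComplex C).d p ((ComplexShape.down ℕ).next p) = 0 := rfl
        rw [this, Functor.map_zero, NatTrans.app_zero, Limits.zero_comp, smul_zero]
      · exact HomologicalComplex.mapBifunctor.d₁_eq_zero _ _ _ _ _ _ _ hp
    have e2 : HomologicalComplex.mapBifunctor.d₂ (homologyComplex C) (homologyComplex C')
        (curriedTensor _) (ComplexShape.down ℕ) p q j = 0 := by
      by_cases hq : (ComplexShape.down ℕ).Rel q ((ComplexShape.down ℕ).next q)
      · rw [HomologicalComplex.mapBifunctor.d₂_eq' _ _ _ _ _ hq]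
        have : (homologyComplex C').d q ((ComplexShape.down ℕ).next q) = 0 := rfl
        rw [this, Functor.map_zero, Limits.zero_comp, smul_zero]
      · exact HomologicalComplex.mapBifunctor.d₂_eq_zero _ _ _ _ _ _ _ hq
    rw [Preadditive.comp_add, HomologicalComplex.mapBifunctor.ι_D₁,
      HomologicalComplex.mapBifunctor.ι_D₂, e1, e2, add_zero]
    exact Limits.comp_zero.symm
  · exact HomologicalComplex.shape _ _ _ h

/-- The homology of a complex with zero differentials. -/
def homologyIsoOfZero (C : ChainComplex (ModuleCat.{u} K) ℕ) (h : ∀ i j, C.d i j = 0) (n : ℕ) :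
    C.homology n ≅ C.X n :=
  (C.isoHomologyπ _ n rfl (h _ _)).symm ≪≫ C.iCyclesIso n _ rfl (h _ _)

/-- The Künneth isomorphism over a field. -/
def kunnethIso :
    (show GradedObject ℕ (ModuleCat.{u} K) from fun n => (C ⊗ C').homology n) ≅
      (show GradedObject ℕ (ModuleCat.{u} K) from fun n => C.homology n) ⊗
        (show GradedObject ℕ (ModuleCat.{u} K) from fun n => C'.homology n) :=
  GradedObject.isoMk _ _ fun n =>
    (tensorHomotopyEquiv (homologyComplexEquiv C) (homologyComplexEquiv C')).toHomologyIso n ≪≫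
      -- The degree `n` term of the tensor product of the two homology complexes is, by definition,
      -- that of the tensor product of graded objects.
      homologyIsoOfZero _ (homologyComplex_tensor_d C C') n

end Kunneth

end

section

/-! ### The complex of a path pair inside the alternating face map complex -/

section OmegaMap

variable {K : Type u} [CommRing K]

/-- This moves `Ω` from the Moore complex, whose terms are subobjects, to the alternating face map
complex, whose elements are plain chains. Injectivity recovers `d x ∈ D` from its image. -/
theorem omegaX_map {C C' : ChainComplex (ModuleCat.{u} K) ℕ} (i : C ⟶ C')
    (hi : ∀ n, Function.Injective (i.f n).hom) (D : ∀ n, Submodule K (C.X n)) (n : ℕ) :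
    omegaX C' (fun n => (D n).map (i.f n).hom) n = (omegaX C D n).map (i.f n).hom := by
  have hc : ∀ (j : ℕ) (x : C.X n), (C'.d n j).hom ((i.f n).hom x) = (i.f j).hom ((C.d n j).hom x) :=
    fun j x => congrArg (fun f => f.hom x) (i.comm n j)
  ext y
  rw [mem_omegaX, Submodule.mem_map, Submodule.mem_map]
  constructor
  · rintro ⟨⟨x, hx, rfl⟩, h⟩
    refine ⟨x, mem_omegaX.2 ⟨hx, fun j => ?_⟩, rfl⟩
    obtain ⟨z, hz, e⟩ := h j
    rw [hc] at e
    rwa [← hi j e]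
  · rintro ⟨x, hx, rfl⟩
    rw [mem_omegaX] at hx
    exact ⟨⟨x, hx.1, rfl⟩, fun j => ⟨_, hx.2 j, (hc j x).symm⟩⟩

/-- A degreewise injective chain map identifies `ω(C, D)` with `ω(C', i(D))`. -/
def omegaMapIso {C C' : ChainComplex (ModuleCat.{u} K) ℕ} (i : C ⟶ C')
    (hi : ∀ n, Function.Injective (i.f n).hom) (D : ∀ n, Submodule K (C.X n)) :
    omega C D ≅ omega C' (fun n => (D n).map (i.f n).hom) :=
  HomologicalComplex.Hom.isoOfComponents
    (fun n => (((omegaX C D n).equivMapOfInjective _ (hi n)).trans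
      (LinearEquiv.ofEq _ _ (omegaX_map i hi D n).symm)).toModuleIso) <| by
    intro n j _
    ext x
    refine Subtype.ext ?_
    exact congrArg (fun f => f.hom x.1) (i.comm n j)

end OmegaMap

variable {K : Type u} [CommRing K] {Λ : Type u} [Ring Λ] [Algebra K Λ]

/-- The module `M ⊗ Λ^{⊗ n}`. -/
abbrev chains (M : Bimodule K Λ) (n : ℕ) : Type u := M.carrier ⊗[K] (⨂[K] _ : Fin n, Λ)

open AlgebraicTopology DoldKan

/-- The alternating face map complex of the Hochschild simplicial module. -/
abbrev hochschildComplex (M : Bimodule K Λ) : ChainComplex (ModuleCat.{u} K) ℕ :=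
  (alternatingFaceMapComplex (ModuleCat.{u} K)).obj (hochschild M)

/-- The projection of `M ⊗ Λ^{⊗ n}` onto the Moore complex along the degenerate part. -/
def normProj (M : Bimodule K Λ) (n : ℕ) : chains M n →ₗ[K] chains M n :=
  ((PInfty (X := hochschild M)).f n).hom

/-- The map `[n] → [n + 1]` that misses `i`. -/
def face {n : ℕ} (i : Fin (n + 2)) : Fin (n + 1) →o Fin (n + 2) :=
  (Fin.succAboveOrderEmb i).toOrderHom

theorem face_apply {n : ℕ} (i : Fin (n + 2)) (k : Fin (n + 1)) :
    (face i k : ℕ) = if (k : ℕ) < i then (k : ℕ) else k + 1 := by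
  change ((i.succAbove k : Fin (n + 2)) : ℕ) = _
  rw [Fin.succAbove]
  split_ifs with h1 h2 h2
  · rfl
  · exact absurd h1 h2
  · exact absurd h2 h1
  · rfl

/-- The complex `Ω(Λ, V, M)` inside the alternating face map complex. -/
def omegaIso (V : Submodule K Λ) (hV : (1 : Λ) ∈ V) (M : Bimodule K Λ) :
    Omega V hV M ≅ omega (hochschildComplex M) fun n => (hochschildB V M n).map (normProj M n) :=
  omegaMapIso (inclusionOfMooreComplexMap (hochschild M)) (fun n => by
    rw [← ModuleCat.mono_iff_injective]
    change Mono (Subobject.arrow _)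
    infer_instance) (pathPair V hV M).Bbar ≪≫ eqToIso (by
    congr 1
    funext n
    refine (Submodule.map_comp _ _ _).symm.trans ?_
    -- Projecting to the Moore complex and including it again is `PInfty`, that is, `normProj`.
    have := congrArg (fun f => (f.f n).hom)
      (PInftyToNormalizedMooreComplex_comp_inclusionOfMooreComplexMap (hochschild M))
    exact congrArg (fun f => (hochschildB V M n).map f) this)

theorem normProj_idem (M : Bimodule K Λ) {n : ℕ} (x : chains M n) :
    normProj M n (normProj M n x) = normProj M n x :=
  congrArg (fun f => f.hom x) (PInfty_f_idem (X := hochschild M) n)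

theorem normProj_structureMap (M : Bimodule K Λ) {n m : ℕ} (f : Fin (n + 1) →o Fin (m + 1))
    (hf : ¬Function.Injective f) (x : chains M m) : normProj M n (structureMap M f x) = 0 := by
  have h : ¬Mono (SimplexCategory.mkHom f) := by
    rw [SimplexCategory.mono_iff_injective]
    exact hf
  exact congrArg (fun f => f.hom x) (degeneracy_comp_PInfty (hochschild M) n _ h)

theorem structureMap_face_normProj (M : Bimodule K Λ) {n : ℕ} (i : Fin (n + 1))
    (x : chains M (n + 1)) : structureMap M (face i.succ) (normProj M (n + 1) x) = 0 := by
  have := HigherFacesVanish.of_P (X := hochschild M) (n + 1) n i le_add_self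
  exact congrArg (fun f => f.hom x) this

theorem normProj_eq_self (M : Bimodule K Λ) {n : ℕ} (x : chains M (n + 1))
    (h : ∀ i : Fin (n + 1), structureMap M (face i.succ) x = 0) : normProj M (n + 1) x = x := by
  let N : Submodule K (chains M (n + 1)) :=
    ⨅ i : Fin (n + 1), LinearMap.ker (structureMap M (face i.succ))
  -- `HigherFacesVanish` concerns morphisms, so `x` is treated as an element of the source of the
  -- inclusion of all chains with vanishing higher faces.
  let φ : ModuleCat.of K N ⟶ (hochschild M).obj (Opposite.op (SimplexCategory.mk (n + 1))) :=
    ModuleCat.ofHom N.subtype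
  have v : HigherFacesVanish (n + 1) φ := by
    intro j _
    ext y
    exact LinearMap.mem_ker.1 ((Submodule.mem_iInf _).1 y.2 j)
  exact congrArg (fun f => f.hom ⟨x, (Submodule.mem_iInf _).2 h⟩) v.comp_P_eq_self

theorem normProj_zero (M : Bimodule K Λ) (x : chains M 0) : normProj M 0 x = x := by
  have := PInfty_f_0 (X := hochschild M)
  exact congrArg (fun f => f.hom x) this

/-- Maps that vanish on degenerate elements factor through `normProj`. -/
theorem apply_normProj (M : Bimodule K Λ) {n : ℕ} {W : Type u} [AddCommGroup W] [Module K W]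
    (φ : chains M n →ₗ[K] W) (h : ∀ (m : ℕ) (f : Fin (n + 1) →o Fin (m + 1)),
      ¬Function.Injective f → ∀ x, φ (structureMap M f x) = 0) (x : chains M n) :
    φ (normProj M n x) = φ x := by
  have hd : DegeneraciesVanish (X := hochschild M) (n := n) (ModuleCat.ofHom φ) := by
    rcases n with _ | n
    · trivial
    · intro i
      ext y
      refine h n (SimplexCategory.σ i).toOrderHom (fun hi => ?_) y
      have := Fintype.card_le_of_injective _ hi
      simp only [Fintype.card_fin] at this
      omega
  have h1 := congrArg (fun f => f.hom x) (PInfty_f_add_QInfty_f (X := hochschild M) n)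
  have h2 := congrArg (fun f => f.hom x) ((degeneraciesVanish_iff_QInfty_f_comp _).1 hd)
  -- `Q` is the complementary projection onto the degenerate part, which `φ` kills.
  let Q : chains M n →ₗ[K] chains M n := ((QInfty (X := hochschild M)).f n).hom
  change normProj M n x + Q x = x at h1
  change φ (Q x) = 0 at h2
  rw [← add_zero (φ (normProj M n x)), ← h2, ← map_add, h1]

theorem hochschildComplex_d (M : Bimodule K Λ) {n : ℕ} (x : chains M (n + 1)) :
    ((hochschildComplex M).d (n + 1) n).hom x =
      ∑ i : Fin (n + 2), (-1 : ℤ) ^ (i : ℕ) • structureMap M (face i) x := by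
  have := congrArg (fun f => f.hom x) (AlternatingFaceMapComplex.obj_d_eq (hochschild M) n)
  refine this.trans ?_
  rw [ModuleCat.hom_sum]
  exact LinearMap.sum_apply (M := chains M (n + 1)) (M₂ := chains M n) Finset.univ
    (fun i : Fin (n + 2) => (-1 : ℤ) ^ (i : ℕ) • structureMap M (face i)) x

theorem hochschildComplex_d_of_normProj (M : Bimodule K Λ) {n : ℕ} {x : chains M (n + 1)}
    (h : normProj M (n + 1) x = x) :
    ((hochschildComplex M).d (n + 1) n).hom x = structureMap M (face 0) x := by
  rw [hochschildComplex_d, Fin.sum_univ_succ, Finset.sum_eq_zero, add_zero, Fin.val_zero, pow_zero,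
    one_smul]
  intro i _
  rw [← h, structureMap_face_normProj, smul_zero]

theorem normProj_d (M : Bimodule K Λ) {n m : ℕ} (x : chains M n) :
    ((hochschildComplex M).d n m).hom (normProj M n x) =
      normProj M m (((hochschildComplex M).d n m).hom x) :=
  congrArg (fun f => f.hom x) ((PInfty (X := hochschild M)).comm n m)

end

section

/-! ### Shuffling the tensor factors -/

section Zip

variable (K : Type u) [Field K] (A A' L L' : Type u) [AddCommGroup A] [Module K A]
  [AddCommGroup A'] [Module K A'] [AddCommGroup L] [Module K L] [AddCommGroup L'] [Module K L']

/-- The map `(A ⊗ L^{⊗ n}) ⊗ (A' ⊗ L'^{⊗ n}) → (A ⊗ A') ⊗ (L ⊗ L')^{⊗ n}`. -/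
def zipLinear (n : ℕ) :
    (A ⊗[K] (⨂[K] _ : Fin n, L)) ⊗[K] (A' ⊗[K] (⨂[K] _ : Fin n, L')) →ₗ[K]
      (A ⊗[K] A') ⊗[K] (⨂[K] _ : Fin n, L ⊗[K] L') :=
  TensorProduct.map LinearMap.id
    (TensorProduct.lift (PiTensorProduct.map₂ fun _ : Fin n => TensorProduct.mk K L L')) ∘ₗ
      (TensorProduct.tensorTensorTensorComm K A (⨂[K] _ : Fin n, L) A'
        (⨂[K] _ : Fin n, L')).toLinearMap

theorem zipLinear_tmul (n : ℕ) (a : A) (l : Fin n → L) (a' : A') (l' : Fin n → L') :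
    zipLinear K A A' L L' n ((a ⊗ₜ PiTensorProduct.tprod K l) ⊗ₜ
      (a' ⊗ₜ PiTensorProduct.tprod K l')) =
        (a ⊗ₜ a') ⊗ₜ PiTensorProduct.tprod K fun i => l i ⊗ₜ[K] l' i := by
  simp [zipLinear, PiTensorProduct.map₂_tprod_tprod]

/-- The map sends a basis of pure tensors of basis vectors to a basis of the same kind, up to the
reindexing `e`. -/
theorem zipLinear_bijective (n : ℕ) : Function.Bijective (zipLinear K A A' L L' n) := by
  let bA := Module.Basis.ofVectorSpace K A
  let bA' := Module.Basis.ofVectorSpace K A'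
  let bL := Module.Basis.ofVectorSpace K L
  let bL' := Module.Basis.ofVectorSpace K L'
  let b₁ := (bA.tensorProduct (Basis.piTensorProduct fun _ : Fin n => bL)).tensorProduct
    (bA'.tensorProduct (Basis.piTensorProduct fun _ : Fin n => bL'))
  let b₂ := (bA.tensorProduct bA').tensorProduct
    (Basis.piTensorProduct fun _ : Fin n => bL.tensorProduct bL')
  let e := (Equiv.prodProdProdComm (Module.Basis.ofVectorSpaceIndex K A)
    (Fin n → Module.Basis.ofVectorSpaceIndex K L) (Module.Basis.ofVectorSpaceIndex K A')
    (Fin n → Module.Basis.ofVectorSpaceIndex K L')).trans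
      (Equiv.prodCongr (Equiv.refl _) (Equiv.arrowProdEquivProdArrow (Fin n)
        (fun _ => Module.Basis.ofVectorSpaceIndex K L)
        (fun _ => Module.Basis.ofVectorSpaceIndex K L')).symm)
  have h : zipLinear K A A' L L' n = (b₁.equiv b₂ e).toLinearMap := by
    apply b₁.ext
    rintro ⟨⟨i, j⟩, i', j'⟩
    rw [LinearEquiv.coe_coe, Module.Basis.equiv_apply]
    simp only [b₁, b₂, Module.Basis.tensorProduct_apply, Basis.piTensorProduct_apply, zipLinear_tmul]
    simp [e, Module.Basis.tensorProduct_apply, Equiv.arrowProdEquivProdArrow]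
  rw [h]
  exact (b₁.equiv b₂ e).bijective

end Zip

section Chains

variable {K : Type u} [Field K] {Λ Λ' : Type u} [Ring Λ] [Algebra K Λ] [Ring Λ'] [Algebra K Λ']

theorem chains_ext₂ {M : Bimodule K Λ} {M' : Bimodule K Λ'} {p q : ℕ} {W : Type u} [AddCommGroup W]
    [Module K W] {f g : chains M p ⊗[K] chains M' q →ₗ[K] W}
    (h : ∀ (m : M.carrier) (l : Fin p → Λ) (m' : M'.carrier) (l' : Fin q → Λ'),
      f ((m ⊗ₜ PiTensorProduct.tprod K l) ⊗ₜ (m' ⊗ₜ PiTensorProduct.tprod K l')) =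
        g ((m ⊗ₜ PiTensorProduct.tprod K l) ⊗ₜ (m' ⊗ₜ PiTensorProduct.tprod K l'))) : f = g := by
  apply TensorProduct.ext
  apply hom_ext_tprod
  intro m l
  apply hom_ext_tprod
  intro m' l'
  exact h m l m' l'

/-- The isomorphism `A(Λ, M)_n ⊗ A(Λ', M')_n ≅ A(Λ ⊗ Λ', M ⊗ M')_n`. -/
def zip (M : Bimodule K Λ) (M' : Bimodule K Λ') (n : ℕ) :
    chains M n ⊗[K] chains M' n ≃ₗ[K] chains (M.tensor M') n :=
  LinearEquiv.ofBijective (zipLinear K M.carrier M'.carrier Λ Λ' n) (zipLinear_bijective K _ _ _ _ n)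

theorem zip_tmul (M : Bimodule K Λ) (M' : Bimodule K Λ') {n : ℕ} (m : M.carrier) (l : Fin n → Λ)
    (m' : M'.carrier) (l' : Fin n → Λ') :
    zip M M' n ((m ⊗ₜ PiTensorProduct.tprod K l) ⊗ₜ (m' ⊗ₜ PiTensorProduct.tprod K l')) =
      (show (M.tensor M').carrier from m ⊗ₜ m') ⊗ₜ
        PiTensorProduct.tprod K fun i => l i ⊗ₜ[K] l' i :=
  zipLinear_tmul K _ _ _ _ n m l m' l'

theorem list_prod_tmul (L : List ℕ) (f : ℕ → Λ) (g : ℕ → Λ') :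
    (L.map fun k => f k ⊗ₜ[K] g k).prod = (L.map f).prod ⊗ₜ[K] (L.map g).prod := by
  induction L with
  | nil => rfl
  | cons a L ih => simp [ih]

theorem intervalProd_tmul {n : ℕ} (l : Fin n → Λ) (l' : Fin n → Λ') (a b : ℕ) :
    intervalProd (fun i => l i ⊗ₜ[K] l' i) a b = intervalProd l a b ⊗ₜ[K] intervalProd l' a b := by
  rw [intervalProd, intervalProd, intervalProd, ← list_prod_tmul]
  congr 2
  funext k
  unfold extendOne
  split_ifs <;> rfl

/-- Naturality of `zip`: products and bimodule actions over `Λ ⊗ Λ'` are computed in each tensor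
factor. This makes shuffles available on Hochschild chains. -/
theorem structureMap_zip (M : Bimodule K Λ) (M' : Bimodule K Λ') {m n : ℕ}
    (f : Fin (m + 1) →o Fin (n + 1)) (x : chains M n ⊗[K] chains M' n) :
    structureMap (M.tensor M') f (zip M M' n x) =
      zip M M' m (TensorProduct.map (structureMap M f) (structureMap M' f) x) := by
  suffices h : structureMap (M.tensor M') f ∘ₗ (zip M M' n).toLinearMap =
      (zip M M' m).toLinearMap ∘ₗ TensorProduct.map (structureMap M f) (structureMap M' f) from
    LinearMap.congr_fun h x
  apply chains_ext₂
  intro m l m' l'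
  rw [LinearMap.comp_apply, LinearMap.comp_apply, TensorProduct.map_tmul, LinearEquiv.coe_coe,
    LinearEquiv.coe_coe, zip_tmul, structureMap_tmul_tprod, structureMap_tmul_tprod,
    structureMap_tmul_tprod, zip_tmul]
  simp only [intervalProd_tmul]
  rfl

/-! ### Maps of simplices -/

theorem exists_castSucc_eq_succ {n m : ℕ} (f : Fin (n + 1) →o Fin (m + 1))
    (hf : ¬Function.Injective f) : ∃ i : Fin n, f i.castSucc = f i.succ := by
  by_contra! h
  exact hf (Fin.strictMono_iff_lt_succ.2 fun i =>
    lt_of_le_of_ne (f.monotone (Fin.castSucc_lt_succ).le) (h i)).injective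

theorem structureMap_of_endpoints (M : Bimodule K Λ) {m n : ℕ} (f : Fin (m + 1) →o Fin (n + 1))
    (h0 : f 0 = 0) (h1 : f (Fin.last m) = Fin.last n) (x : M.carrier) (l : Fin n → Λ) :
    structureMap M f (x ⊗ₜ PiTensorProduct.tprod K l) =
      x ⊗ₜ PiTensorProduct.tprod K fun j : Fin m => intervalProd l (f j.castSucc) (f j.succ) := by
  rw [structureMap_tmul_tprod, h0, h1]
  simp [intervalProd_self]

theorem intervalProd_step {n : ℕ} (l : Fin n → Λ) {a b : ℕ} (h : a = b ∨ b = a + 1) :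
    intervalProd l a b = if a = b then 1 else extendOne l a := by
  rcases h with rfl | rfl
  · rw [if_pos rfl, intervalProd_self]
  · rw [if_neg (by omega), intervalProd, List.Ico.succ_singleton]
    simp

/-- A map that misses a vertex `j ≥ 1` factors through the face `d_j`, which kills normalized
chains. Vertex `0` is excluded because `d_0` is the differential of the Moore complex. -/
theorem structureMap_eq_zero_of_missed (M : Bimodule K Λ) {m p : ℕ}
    (f : Fin (m + 1) →o Fin (p + 1)) (x : chains M p) (hx : normProj M p x = x) (j : ℕ)
    (hj : 1 ≤ j) (hjp : j ≤ p) (h : ∀ k, (f k : ℕ) ≠ j) : structureMap M f x = 0 := by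
  obtain ⟨p, rfl⟩ : ∃ p', p = p' + 1 := ⟨p - 1, by omega⟩
  let g : Fin (m + 1) →o Fin (p + 1) :=
    ⟨fun k => ⟨if (f k : ℕ) < j then f k else f k - 1, by
      have := (f k).isLt
      have := h k
      split_ifs <;> omega⟩, by
      intro a b hab
      have h1 : (f a : ℕ) ≤ f b := f.monotone hab
      have := h a
      have := h b
      simp only [Fin.mk_le_mk]
      split_ifs <;> omega⟩
  have hg : f = (face (⟨j - 1, by omega⟩ : Fin (p + 1)).succ).comp g := by
    ext k
    have := h k
    have hgk : (g k : ℕ) = if (f k : ℕ) < j then (f k : ℕ) else f k - 1 := rfl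
    rw [OrderHom.comp_coe, Function.comp_apply, face_apply, hgk, Fin.val_succ]
    simp only
    split_ifs <;> omega
  rw [hg, structureMap_comp, LinearMap.comp_apply, ← hx, structureMap_face_normProj, map_zero]

/-! ### Splitting off the unit -/

section Counit

variable (K Λ)

/-- The normalization `ε 1 • 1 = 1` replaces `ε 1 = 1` so that the zero algebra is covered, where `ε
= 0` works. -/
theorem exists_counit : ∃ ε : Λ →ₗ[K] K, ε 1 • (1 : Λ) = 1 := by
  rcases subsingleton_or_nontrivial Λ with h | h
  · exact ⟨0, Subsingleton.elim _ _⟩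
  · obtain ⟨ε, hε⟩ := (Algebra.linearMap K Λ).exists_leftInverse_of_injective
      (LinearMap.ker_eq_bot.2 (algebraMap K Λ).injective)
    refine ⟨ε, ?_⟩
    have : ε 1 = 1 := by simpa using LinearMap.congr_fun hε 1
    rw [this, one_smul]

/-- A linear form on `Λ` that is normalized on the unit. -/
def counit : Λ →ₗ[K] K := (exists_counit K Λ).choose

theorem counit_one_smul : counit K Λ 1 • (1 : Λ) = 1 := (exists_counit K Λ).choose_spec

/-- The projection onto the line of the unit. -/
def unitProj : Λ →ₗ[K] Λ := (counit K Λ).smulRight 1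

/-- The projection along the line of the unit. -/
def redProj : Λ →ₗ[K] Λ := LinearMap.id - unitProj K Λ

variable {K Λ}

theorem unitProj_one : unitProj K Λ 1 = 1 := counit_one_smul K Λ

theorem redProj_apply (x : Λ) : redProj K Λ x = x - counit K Λ x • 1 := rfl

theorem redProj_one : redProj K Λ 1 = 0 := by
  rw [redProj_apply, counit_one_smul, sub_self]

end Counit

/-- The projection onto the part of `M ⊗ Λ^{⊗ n}` that is reduced in the factors selected by `s` and
spanned by the unit in the others. -/
def selectProj (M : Bimodule K Λ) {n : ℕ} (s : Fin n → Bool) : chains M n →ₗ[K] chains M n :=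
  TensorProduct.map LinearMap.id
    (PiTensorProduct.map fun i => if s i then redProj K Λ else unitProj K Λ)

theorem selectProj_tmul (M : Bimodule K Λ) {n : ℕ} (s : Fin n → Bool) (m : M.carrier)
    (l : Fin n → Λ) :
    selectProj M s (m ⊗ₜ PiTensorProduct.tprod K l) =
      m ⊗ₜ PiTensorProduct.tprod K fun i =>
        if s i then redProj K Λ (l i) else unitProj K Λ (l i) := by
  rw [selectProj, TensorProduct.map_tmul, PiTensorProduct.map_tprod]
  congr 2
  funext i
  split_ifs <;> rfl

/-- The projection onto the reduced part of `M ⊗ Λ^{⊗ n}`. -/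
abbrev reduce (M : Bimodule K Λ) (n : ℕ) : chains M n →ₗ[K] chains M n :=
  selectProj M fun _ : Fin n => true

theorem reduce_tmul (M : Bimodule K Λ) {n : ℕ} (m : M.carrier) (l : Fin n → Λ) :
    reduce M n (m ⊗ₜ PiTensorProduct.tprod K l) =
      m ⊗ₜ PiTensorProduct.tprod K fun i => redProj K Λ (l i) := by
  rw [selectProj_tmul]
  simp

theorem selectProj_structureMap_of_eq (M : Bimodule K Λ) {n m : ℕ} (s : Fin n → Bool)
    (f : Fin (n + 1) →o Fin (m + 1)) (i : Fin n) (hs : s i = true)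
    (hf : f i.castSucc = f i.succ) (x : chains M m) : selectProj M s (structureMap M f x) = 0 := by
  suffices h : selectProj M s ∘ₗ structureMap M f = 0 from LinearMap.congr_fun h x
  apply hom_ext_tprod
  intro x l
  rw [LinearMap.comp_apply, structureMap_tmul_tprod, selectProj_tmul, MultilinearMap.map_coord_zero
    (i := i), TensorProduct.tmul_zero, LinearMap.zero_apply]
  rw [if_pos hs, hf, intervalProd_self, redProj_one]

/-- The steps of a map of simplices. -/
def steps {n m : ℕ} (f : Fin (n + 1) →o Fin (m + 1)) (i : Fin n) : Bool :=
  decide (f i.castSucc ≠ f i.succ)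

/-- At a step of `f` the factor is an entry of the original chain and gets reduced; at a constant
edge it is `1`, which `unitProj` fixes. -/
theorem selectProj_steps (M : Bimodule K Λ) {n m : ℕ} (f : Fin (n + 1) →o Fin (m + 1))
    (h0 : f 0 = 0) (h1 : f (Fin.last n) = Fin.last m)
    (hf : ∀ i : Fin n, (f i.succ : ℕ) ≤ f i.castSucc + 1) (x : chains M m) :
    selectProj M (steps f) (structureMap M f x) = structureMap M f (reduce M m x) := by
  suffices h : selectProj M (steps f) ∘ₗ structureMap M f = structureMap M f ∘ₗ reduce M m from
    LinearMap.congr_fun h x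
  apply hom_ext_tprod
  intro x l
  rw [LinearMap.comp_apply, LinearMap.comp_apply, reduce_tmul, structureMap_of_endpoints M f h0 h1,
    structureMap_of_endpoints M f h0 h1, selectProj_tmul]
  congr 2
  funext i
  have hm : (f i.castSucc : ℕ) ≤ f i.succ := f.monotone (Fin.castSucc_lt_succ).le
  have hi := hf i
  have hc : (f i.castSucc : ℕ) = f i.succ ∨ (f i.succ : ℕ) = f i.castSucc + 1 := by omega
  rw [intervalProd_step _ hc, intervalProd_step _ hc]
  by_cases h : (f i.castSucc : ℕ) = f i.succ
  · have : steps f i = false := by simp [steps, Fin.ext_iff, h]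
    simp [this, h, unitProj_one]
  · have : steps f i = true := by simp [steps, Fin.ext_iff, h]
    have hlt : (f i.castSucc : ℕ) < m := by
      have := (f i.succ).isLt
      omega
    simp [this, h, extendOne, hlt]

/-- Together with `normProj_reduce` this says that the two projections have the same kernel, the
degenerate chains. The reduced form can be read off factor by factor, the normalized form is
compatible with faces. -/
theorem reduce_normProj (M : Bimodule K Λ) {n : ℕ} (x : chains M n) :
    reduce M n (normProj M n x) = reduce M n x := by
  apply apply_normProj
  intro m f hf y
  obtain ⟨i, hi⟩ := exists_castSucc_eq_succ f hf
  exact selectProj_structureMap_of_eq M _ f i rfl hi y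

/-- The chain is degenerate: it arises from the one with the `i`-th factor removed by the map `σ`
that repeats the vertex `i`. -/
theorem normProj_tmul_of_one (M : Bimodule K Λ) {n : ℕ} (m : M.carrier) (l : Fin n → Λ) (i : Fin n)
    (hi : l i = 1) : normProj M n (m ⊗ₜ PiTensorProduct.tprod K l) = 0 := by
  obtain ⟨n, rfl⟩ : ∃ n', n = n' + 1 := ⟨n - 1, by have := i.isLt; omega⟩
  let σ : Fin (n + 1 + 1) →o Fin (n + 1) :=
    ⟨fun k => ⟨if (k : ℕ) ≤ i then k else k - 1, by split_ifs <;> omega⟩, by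
      intro a b hab
      have : (a : ℕ) ≤ b := hab
      simp only [Fin.mk_le_mk]
      split_ifs <;> omega⟩
  have hσ : ∀ k, (σ k : ℕ) = if (k : ℕ) ≤ i then (k : ℕ) else k - 1 := fun k => rfl
  have h : m ⊗ₜ PiTensorProduct.tprod K l =
      structureMap M σ (m ⊗ₜ PiTensorProduct.tprod K fun j => l (i.succAbove j)) := by
    rw [structureMap_of_endpoints]
    · congr 2
      funext j
      have hs : (σ j.castSucc : ℕ) = σ j.succ ∨ (σ j.succ : ℕ) = σ j.castSucc + 1 := by
        rw [hσ, hσ]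
        simp only [Fin.val_castSucc, Fin.val_succ]
        split_ifs <;> omega
      have hA := hσ j.castSucc
      have hB := hσ j.succ
      rw [Fin.val_castSucc] at hA
      rw [Fin.val_succ] at hB
      rw [intervalProd_step _ hs]
      rcases lt_trichotomy j i with hj | rfl | hj
      · rw [Fin.lt_def] at hj
        rw [if_pos (by omega)] at hA
        rw [if_pos (by omega)] at hB
        rw [hA, hB, if_neg (by omega), extendOne, dif_pos (by omega)]
        congr 1
        rw [Fin.succAbove_of_castSucc_lt]
        · rfl
        · exact Fin.lt_def.2 hj
      · rw [if_pos le_rfl] at hA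
        rw [if_neg (by omega)] at hB
        rw [hA, hB, hi, if_pos (by omega)]
      · rw [Fin.lt_def] at hj
        rw [if_neg (by omega)] at hA
        rw [if_neg (by omega)] at hB
        rw [hA, hB, if_neg (by omega), extendOne, dif_pos (by omega)]
        congr 1
        rw [Fin.succAbove_of_le_castSucc]
        · refine Fin.ext ?_
          change (j : ℕ) = (j : ℕ) - 1 + 1
          omega
        · change (i : ℕ) ≤ (j : ℕ) - 1
          omega
    · ext
      simp [hσ]
    · ext
      have := i.isLt
      simp only [hσ, Fin.val_last]
      split_ifs <;> omega
  rw [h, normProj_structureMap]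
  intro hinj
  have := Fintype.card_le_of_injective _ hinj
  simp only [Fintype.card_fin] at this
  omega

theorem normProj_tmul_congr (M : Bimodule K Λ) {n : ℕ} (m : M.carrier) (l l' : Fin n → Λ)
    (h : ∀ i, ∃ c : K, l' i = l i + c • 1) :
    normProj M n (m ⊗ₜ PiTensorProduct.tprod K l) =
      normProj M n (m ⊗ₜ PiTensorProduct.tprod K l') := by
  -- The entries are replaced one at a time; each replacement changes the chain by a multiple of one
  -- with an entry `1`.
  suffices ∀ s : Finset (Fin n), normProj M n (m ⊗ₜ PiTensorProduct.tprod K l) =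
      normProj M n (m ⊗ₜ PiTensorProduct.tprod K fun i => if i ∈ s then l' i else l i) by
    simpa using this Finset.univ
  intro s
  induction s using Finset.induction_on with
  | empty => simp
  | insert a s ha ih =>
    rw [ih]
    obtain ⟨c, hc⟩ := h a
    have e1 : (fun i => if i ∈ insert a s then l' i else l i) =
        Function.update (fun i => if i ∈ s then l' i else l i) a (l a + c • 1) := by
      funext i
      by_cases hi : i = a
      · subst hi
        simp [hc]
      · simp [hi]
    have e2 : (fun i => if i ∈ s then l' i else l i) =
        Function.update (fun i => if i ∈ s then l' i else l i) a (l a) := by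
      funext i
      by_cases hi : i = a
      · subst hi
        simp [ha]
      · simp [hi]
    rw [e1, MultilinearMap.map_update_add, MultilinearMap.map_update_smul, ← e2,
      TensorProduct.tmul_add, TensorProduct.tmul_smul, map_add, map_smul,
      normProj_tmul_of_one M m _ a (Function.update_self _ _ _), smul_zero, add_zero]

theorem normProj_reduce (M : Bimodule K Λ) {n : ℕ} (x : chains M n) :
    normProj M n (reduce M n x) = normProj M n x := by
  suffices h : normProj M n ∘ₗ reduce M n = normProj M n from LinearMap.congr_fun h x
  apply hom_ext_tprod
  intro m l
  rw [LinearMap.comp_apply, reduce_tmul]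
  symm
  apply normProj_tmul_congr
  intro i
  exact ⟨-counit K Λ (l i), by rw [redProj_apply, neg_smul, sub_eq_add_neg]⟩

end Chains

end

section

/-! ### Shuffle paths -/

/-- A lattice path of length `n` from `(0, 0)` to `(p, q)`: a nondegenerate simplex of top dimension
`n = p + q` of the product of the simplices of dimensions `p` and `q`. -/
structure ShufflePath (n p q : ℕ) where
  fst : Fin (n + 1) →o Fin (p + 1)
  snd : Fin (n + 1) →o Fin (q + 1)
  add_eq : ∀ k, (fst k : ℕ) + snd k = k
  add_len : p + q = n

namespace ShufflePath

variable {n p q : ℕ}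

theorem ext_snd {s t : ShufflePath n p q} (h : ∀ k, (s.snd k : ℕ) = t.snd k) : s = t := by
  have h2 : s.snd = t.snd := OrderHom.ext _ _ (funext fun k => Fin.ext (h k))
  have h1 : s.fst = t.fst := OrderHom.ext _ _ (funext fun k => Fin.ext (by
    have := s.add_eq k
    have := t.add_eq k
    have := h k
    omega))
  cases s
  cases t
  simp only at h1 h2
  subst h1 h2
  rfl

instance : Finite (ShufflePath n p q) :=
  Finite.of_injective (fun s k => s.snd k) fun _ _ h =>
    ext_snd fun k => congrArg Fin.val (congrFun h k)

instance : Fintype (ShufflePath n p q) := Fintype.ofFinite _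

variable (s : ShufflePath n p q)

theorem fst_mono {a b : Fin (n + 1)} (h : a ≤ b) : (s.fst a : ℕ) ≤ s.fst b := s.fst.monotone h

theorem snd_mono {a b : Fin (n + 1)} (h : a ≤ b) : (s.snd a : ℕ) ≤ s.snd b := s.snd.monotone h

theorem fst_zero : s.fst 0 = 0 := Fin.ext (by
  have := s.add_eq 0
  simp only [Fin.val_zero] at *
  omega)

theorem snd_zero : s.snd 0 = 0 := Fin.ext (by
  have := s.add_eq 0
  simp only [Fin.val_zero] at *
  omega)

theorem fst_last : s.fst (Fin.last n) = Fin.last p := Fin.ext (by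
  have := s.add_eq (Fin.last n)
  have := s.add_len
  have := (s.fst (Fin.last n)).isLt
  have := (s.snd (Fin.last n)).isLt
  simp only [Fin.val_last] at *
  omega)

theorem snd_last : s.snd (Fin.last n) = Fin.last q := Fin.ext (by
  have := s.add_eq (Fin.last n)
  have := s.add_len
  have := (s.fst (Fin.last n)).isLt
  have := (s.snd (Fin.last n)).isLt
  simp only [Fin.val_last] at *
  omega)

theorem step (i : Fin n) :
    ((s.fst i.succ : ℕ) = s.fst i.castSucc + 1 ∧ (s.snd i.succ : ℕ) = s.snd i.castSucc) ∨
      ((s.fst i.succ : ℕ) = s.fst i.castSucc ∧ (s.snd i.succ : ℕ) = s.snd i.castSucc + 1) := by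
  have h1 := s.add_eq i.castSucc
  have h2 := s.add_eq i.succ
  have h3 := s.fst_mono (Fin.castSucc_lt_succ (i := i)).le
  have h4 := s.snd_mono (Fin.castSucc_lt_succ (i := i)).le
  simp only [Fin.val_castSucc, Fin.val_succ] at h1 h2
  omega

/-- The sign of a shuffle. -/
def sgn : ℤ := (-1) ^ (∑ k, (s.snd k : ℕ) + ∑ i ∈ Finset.range (q + 1), i)

/-! #### The first step -/

/-- Prepend a horizontal step. -/
def hcons : ShufflePath (n + 1) (p + 1) q where
  fst := ⟨Fin.cons 0 fun k => (s.fst k).succ, Fin.monotone_iff_le_succ.2 fun i => by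
    refine Fin.cases ?_ (fun i => ?_) i
    · exact Fin.zero_le _
    · rw [← Fin.succ_castSucc, Fin.cons_succ, Fin.cons_succ]
      exact Fin.succ_le_succ_iff.2 (s.fst_mono (Fin.castSucc_lt_succ (i := i)).le)⟩
  snd := ⟨Fin.cons 0 s.snd, Fin.monotone_iff_le_succ.2 fun i => by
    refine Fin.cases ?_ (fun i => ?_) i
    · exact Fin.zero_le _
    · rw [← Fin.succ_castSucc, Fin.cons_succ, Fin.cons_succ]
      exact s.snd_mono (Fin.castSucc_lt_succ (i := i)).le⟩
  add_eq k := by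
    refine Fin.cases ?_ (fun k => ?_) k
    · rfl
    · have := s.add_eq k
      change ((s.fst k : ℕ) + 1) + s.snd k = k + 1
      omega
  add_len := by
    have := s.add_len
    omega

/-- Prepend a vertical step. -/
def vcons : ShufflePath (n + 1) p (q + 1) where
  fst := ⟨Fin.cons 0 s.fst, Fin.monotone_iff_le_succ.2 fun i => by
    refine Fin.cases ?_ (fun i => ?_) i
    · exact Fin.zero_le _
    · rw [← Fin.succ_castSucc, Fin.cons_succ, Fin.cons_succ]
      exact s.fst_mono (Fin.castSucc_lt_succ (i := i)).le⟩
  snd := ⟨Fin.cons 0 fun k => (s.snd k).succ, Fin.monotone_iff_le_succ.2 fun i => by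
    refine Fin.cases ?_ (fun i => ?_) i
    · exact Fin.zero_le _
    · rw [← Fin.succ_castSucc, Fin.cons_succ, Fin.cons_succ]
      exact Fin.succ_le_succ_iff.2 (s.snd_mono (Fin.castSucc_lt_succ (i := i)).le)⟩
  add_eq k := by
    refine Fin.cases ?_ (fun k => ?_) k
    · rfl
    · have := s.add_eq k
      change (s.fst k : ℕ) + (s.snd k + 1) = k + 1
      omega
  add_len := by
    have := s.add_len
    omega

theorem hcons_fst_succ (k : Fin (n + 1)) : (s.hcons.fst k.succ : ℕ) = s.fst k + 1 := rfl

theorem hcons_snd_succ (k : Fin (n + 1)) : (s.hcons.snd k.succ : ℕ) = s.snd k := rfl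

theorem vcons_fst_succ (k : Fin (n + 1)) : (s.vcons.fst k.succ : ℕ) = s.fst k := rfl

theorem vcons_snd_succ (k : Fin (n + 1)) : (s.vcons.snd k.succ : ℕ) = s.snd k + 1 := rfl

theorem hcons_injective : Function.Injective (hcons : ShufflePath n p q → _) := fun _ _ h =>
  ext_snd fun k => congrArg (fun t : ShufflePath (n + 1) (p + 1) q => (t.snd k.succ : ℕ)) h

theorem vcons_injective : Function.Injective (vcons : ShufflePath n p q → _) := fun _ _ h =>
  ext_snd fun k => Nat.succ_injective
    (congrArg (fun t : ShufflePath (n + 1) p (q + 1) => (t.snd k.succ : ℕ)) h)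

theorem exists_hcons (s : ShufflePath (n + 1) (p + 1) q) (h : (s.snd 1 : ℕ) = 0) :
    ∃ t : ShufflePath n p q, t.hcons = s := by
  have h1 : ∀ k : Fin (n + 1), 1 ≤ (s.fst k.succ : ℕ) := fun k => by
    have h2 := s.fst_mono (show (1 : Fin (n + 2)) ≤ k.succ from by
      rw [Fin.le_def, Fin.val_succ, Fin.val_one]; omega)
    have h3 := s.add_eq 1
    rw [Fin.val_one] at h3
    omega
  refine ⟨⟨⟨fun k => ⟨s.fst k.succ - 1, by
      have := (s.fst k.succ).isLt
      have := h1 k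
      omega⟩, fun a b hab => Nat.sub_le_sub_right (s.fst_mono (Fin.succ_le_succ_iff.2 hab)) 1⟩,
    ⟨fun k => s.snd k.succ, fun a b hab => s.snd_mono (Fin.succ_le_succ_iff.2 hab)⟩, fun k => ?_, ?_⟩,
    ext_snd fun k => ?_⟩
  · have h2 := s.add_eq k.succ
    have := h1 k
    rw [Fin.val_succ] at h2
    change (s.fst k.succ : ℕ) - 1 + s.snd k.succ = k
    omega
  · have := s.add_len
    omega
  · refine Fin.cases ?_ (fun k => ?_) k
    · rw [snd_zero, snd_zero]
    · rfl

theorem exists_vcons (s : ShufflePath (n + 1) p (q + 1)) (h : (s.snd 1 : ℕ) ≠ 0) :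
    ∃ t : ShufflePath n p q, t.vcons = s := by
  have h1 : ∀ k : Fin (n + 1), 1 ≤ (s.snd k.succ : ℕ) := fun k => by
    have h2 := s.snd_mono (show (1 : Fin (n + 2)) ≤ k.succ from by
      rw [Fin.le_def, Fin.val_succ, Fin.val_one]; omega)
    omega
  refine ⟨⟨⟨fun k => s.fst k.succ, fun a b hab => s.fst_mono (Fin.succ_le_succ_iff.2 hab)⟩,
    ⟨fun k => ⟨s.snd k.succ - 1, by
      have := (s.snd k.succ).isLt
      have := h1 k
      omega⟩, fun a b hab => Nat.sub_le_sub_right (s.snd_mono (Fin.succ_le_succ_iff.2 hab)) 1⟩,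
    fun k => ?_, ?_⟩, ext_snd fun k => ?_⟩
  · have h2 := s.add_eq k.succ
    have := h1 k
    rw [Fin.val_succ] at h2
    change (s.fst k.succ : ℕ) + (s.snd k.succ - 1) = k
    omega
  · have := s.add_len
    omega
  · refine Fin.cases ?_ (fun k => ?_) k
    · rw [snd_zero, snd_zero]
    · rw [vcons_snd_succ]
      exact Nat.sub_add_cancel (h1 k)

theorem hcons_snd_one : (s.hcons.snd 1 : ℕ) = 0 := by
  have h := s.hcons_snd_succ 0
  rw [s.snd_zero] at h
  exact h

theorem vcons_snd_one : (s.vcons.snd 1 : ℕ) = 1 := by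
  have h := s.vcons_snd_succ 0
  rw [s.snd_zero] at h
  exact h

theorem sgn_hcons : s.hcons.sgn = s.sgn := by
  simp only [sgn, Fin.sum_univ_succ (n := n + 1), hcons_snd_succ, snd_zero, Fin.val_zero, zero_add]

/-- The new step raises the `n + 1` later vertices by one and lengthens the normalizing sum by `q +
1`. The exponent grows by `p + 2q + 2`, which has the parity of `p`. -/
theorem sgn_vcons : s.vcons.sgn = (-1) ^ p * s.sgn := by
  simp only [sgn, Fin.sum_univ_succ (n := n + 1), vcons_snd_succ, snd_zero, Fin.val_zero, zero_add,
    Finset.sum_add_distrib, Finset.sum_const, Finset.card_univ, Fintype.card_fin, smul_eq_mul,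
    mul_one, Finset.sum_range_succ _ (q + 1), ← pow_add]
  have := s.add_len
  apply neg_one_pow_congr
  rw [← Nat.not_odd_iff_even, ← Nat.not_odd_iff_even]
  simp only [Nat.odd_iff]
  omega

theorem hcons_fst_comp_face : s.hcons.fst.comp (face 0) = (face 0).comp s.fst := rfl

theorem hcons_snd_comp_face : s.hcons.snd.comp (face 0) = s.snd := rfl

theorem vcons_fst_comp_face : s.vcons.fst.comp (face 0) = s.fst := rfl

theorem vcons_snd_comp_face : s.vcons.snd.comp (face 0) = (face 0).comp s.snd := rfl

theorem sum_hcons {W : Type*} [AddCommMonoid W] (f : ShufflePath (n + 1) (p + 1) q → W) :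
    ∑ s with (ShufflePath.snd s 1 : ℕ) = 0, f s = ∑ t : ShufflePath n p q, f t.hcons :=
  (Finset.sum_bij (fun t _ => t.hcons)
    (fun t _ => Finset.mem_filter.2 ⟨Finset.mem_univ _, t.hcons_snd_one⟩)
    (fun _ _ _ _ h => hcons_injective h) (fun s hs => by
      obtain ⟨t, rfl⟩ := exists_hcons s (Finset.mem_filter.1 hs).2
      exact ⟨t, Finset.mem_univ _, rfl⟩) fun _ _ => rfl).symm

theorem sum_vcons {W : Type*} [AddCommMonoid W] (f : ShufflePath (n + 1) p (q + 1) → W) :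
    ∑ s with ¬(ShufflePath.snd s 1 : ℕ) = 0, f s = ∑ t : ShufflePath n p q, f t.vcons :=
  (Finset.sum_bij (fun t _ => t.vcons)
    (fun t _ => Finset.mem_filter.2 ⟨Finset.mem_univ _, by rw [t.vcons_snd_one]; exact one_ne_zero⟩)
    (fun _ _ _ _ h => vcons_injective h) (fun s hs => by
      obtain ⟨t, rfl⟩ := exists_vcons s (Finset.mem_filter.1 hs).2
      exact ⟨t, Finset.mem_univ _, rfl⟩) fun _ _ => rfl).symm

theorem snd_one_ne_zero (s : ShufflePath (n + 1) 0 q) : (s.snd 1 : ℕ) ≠ 0 := by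
  have h1 := s.add_eq 1
  have h2 := (s.fst 1).isLt
  rw [Fin.val_one] at h1
  omega

theorem snd_one_eq_zero (s : ShufflePath (n + 1) p 0) : (s.snd 1 : ℕ) = 0 := by
  have h2 := (s.snd 1).isLt
  omega

/-! #### Reflection at a corner -/

section Reflect

variable (s : ShufflePath (n + 1) p q) (i : Fin n)

theorem reflect_aux :
    ((s.fst i.castSucc.castSucc : ℕ) ≤ s.fst i.castSucc.succ ∧
      (s.fst i.castSucc.succ : ℕ) ≤ s.fst i.succ.succ) ∧
    ((s.snd i.castSucc.castSucc : ℕ) ≤ s.snd i.castSucc.succ ∧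
      (s.snd i.castSucc.succ : ℕ) ≤ s.snd i.succ.succ) ∧
    (s.fst i.castSucc.castSucc : ℕ) + s.snd i.castSucc.castSucc = i ∧
    (s.fst i.castSucc.succ : ℕ) + s.snd i.castSucc.succ = i + 1 ∧
    (s.fst i.succ.succ : ℕ) + s.snd i.succ.succ = i + 2 :=
  ⟨⟨s.fst_mono (Fin.castSucc_lt_succ).le, s.fst_mono (Fin.succ_le_succ_iff.2 Fin.castSucc_lt_succ.le)⟩,
    ⟨s.snd_mono (Fin.castSucc_lt_succ).le, s.snd_mono (Fin.succ_le_succ_iff.2 Fin.castSucc_lt_succ.le)⟩,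
    s.add_eq _, s.add_eq _, s.add_eq _⟩

theorem le_of_lt_mid {i : Fin n} {k : Fin (n + 2)} (h : k < i.castSucc.succ) :
    k ≤ i.castSucc.castSucc := by
  rw [Fin.lt_def, Fin.val_succ] at h
  rw [Fin.le_def, Fin.val_castSucc]
  omega

theorem le_of_mid_lt {i : Fin n} {k : Fin (n + 2)} (h : i.castSucc.succ < k) : i.succ.succ ≤ k := by
  rw [Fin.lt_def, Fin.val_succ, Fin.val_castSucc] at h
  rw [Fin.le_def, Fin.val_succ, Fin.val_succ]
  omega

theorem monotone_reflect {m : ℕ} (f : Fin (n + 2) →o Fin (m + 1)) (i : Fin n) (v : Fin (m + 1))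
    (h1 : f i.castSucc.castSucc ≤ v) (h2 : v ≤ f i.succ.succ) :
    Monotone (Function.update f i.castSucc.succ v) := by
  intro a b hab
  rcases eq_or_ne a i.castSucc.succ with rfl | ha
  · rcases eq_or_ne b i.castSucc.succ with rfl | hb
    · exact le_rfl
    · rw [Function.update_self, Function.update_of_ne hb]
      exact h2.trans (f.monotone (le_of_mid_lt (lt_of_le_of_ne hab hb.symm)))
  · rcases eq_or_ne b i.castSucc.succ with rfl | hb
    · rw [Function.update_self, Function.update_of_ne ha]
      exact (f.monotone (le_of_lt_mid (lt_of_le_of_ne hab ha))).trans h1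
    · rw [Function.update_of_ne ha, Function.update_of_ne hb]
      exact f.monotone hab

/-- Reflection of a path at an interior vertex, which exchanges the two steps at this vertex. -/
def reflect : ShufflePath (n + 1) p q where
  fst := ⟨Function.update s.fst i.castSucc.succ
    -- Point reflection in the midpoint of the two neighbouring vertices; a vertex between parallel
    -- steps is fixed.
    ⟨s.fst i.castSucc.castSucc + s.fst i.succ.succ - s.fst i.castSucc.succ, by
      have := s.reflect_aux i
      have := (s.fst i.succ.succ).isLt
      omega⟩, monotone_reflect s.fst i _
        (by have := s.reflect_aux i; rw [Fin.le_def]; simp only; omega)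
        (by have := s.reflect_aux i; rw [Fin.le_def]; simp only; omega)⟩
  snd := ⟨Function.update s.snd i.castSucc.succ
    ⟨s.snd i.castSucc.castSucc + s.snd i.succ.succ - s.snd i.castSucc.succ, by
      have := s.reflect_aux i
      have := (s.snd i.succ.succ).isLt
      omega⟩, monotone_reflect s.snd i _
        (by have := s.reflect_aux i; rw [Fin.le_def]; simp only; omega)
        (by have := s.reflect_aux i; rw [Fin.le_def]; simp only; omega)⟩
  add_eq k := by
    simp only [OrderHom.coe_mk]
    rcases eq_or_ne k i.castSucc.succ with rfl | hk
    · rw [Function.update_self, Function.update_self]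
      have := s.reflect_aux i
      simp only [Fin.val_succ, Fin.val_castSucc]
      omega
    · rw [Function.update_of_ne hk, Function.update_of_ne hk, s.add_eq]
  add_len := s.add_len

theorem reflect_fst_of_ne {k : Fin (n + 2)} (hk : k ≠ i.castSucc.succ) :
    (s.reflect i).fst k = s.fst k :=
  Function.update_of_ne hk _ _

theorem reflect_snd_of_ne {k : Fin (n + 2)} (hk : k ≠ i.castSucc.succ) :
    (s.reflect i).snd k = s.snd k :=
  Function.update_of_ne hk _ _

theorem reflect_snd_self : ((s.reflect i).snd i.castSucc.succ : ℕ) =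
    s.snd i.castSucc.castSucc + s.snd i.succ.succ - s.snd i.castSucc.succ := by
  change ((Function.update s.snd i.castSucc.succ _ i.castSucc.succ : Fin (q + 1)) : ℕ) = _
  rw [Function.update_self]

theorem castSucc_castSucc_ne (i : Fin n) : i.castSucc.castSucc ≠ i.castSucc.succ :=
  (Fin.castSucc_lt_succ).ne

theorem succ_succ_ne (i : Fin n) : i.succ.succ ≠ i.castSucc.succ :=
  (Fin.succ_lt_succ_iff.2 Fin.castSucc_lt_succ).ne'

theorem reflect_reflect : (s.reflect i).reflect i = s := by
  apply ext_snd
  intro k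
  rcases eq_or_ne k i.castSucc.succ with rfl | hk
  · have := s.reflect_aux i
    rw [reflect_snd_self, reflect_snd_of_ne _ _ (castSucc_castSucc_ne i),
      reflect_snd_of_ne _ _ (succ_succ_ne i), reflect_snd_self]
    omega
  · rw [reflect_snd_of_ne _ _ hk, reflect_snd_of_ne _ _ hk]

theorem face_ne {m : ℕ} (j : Fin (m + 2)) (k : Fin (m + 1)) : face j k ≠ j := Fin.succAbove_ne j k

theorem reflect_fst_comp_face :
    (s.reflect i).fst.comp (face i.castSucc.succ) = s.fst.comp (face i.castSucc.succ) :=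
  OrderHom.ext _ _ (funext fun k => reflect_fst_of_ne s i (face_ne _ k))

theorem reflect_snd_comp_face :
    (s.reflect i).snd.comp (face i.castSucc.succ) = s.snd.comp (face i.castSucc.succ) :=
  OrderHom.ext _ _ (funext fun k => reflect_snd_of_ne s i (face_ne _ k))

/-- The two steps at the interior vertex have different directions. -/
def IsCorner : Prop := (s.snd i.succ.succ : ℕ) = s.snd i.castSucc.castSucc + 1

variable {s i}

theorem IsCorner.reflect_ne (h : s.IsCorner i) : s.reflect i ≠ s := fun e => by
  have h1 := s.reflect_snd_self i
  have h2 := s.reflect_aux i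
  unfold IsCorner at h
  rw [e] at h1
  omega

/-- Reflection at a corner changes one second coordinate, by exactly one. -/
theorem IsCorner.sgn_reflect (h : s.IsCorner i) : (s.reflect i).sgn = -s.sgn := by
  have h0 := s.reflect_snd_self i
  have h2 := s.reflect_aux i
  have h3 : ∑ k ∈ Finset.univ.erase i.castSucc.succ, ((s.reflect i).snd k : ℕ) =
      ∑ k ∈ Finset.univ.erase i.castSucc.succ, (s.snd k : ℕ) :=
    Finset.sum_congr rfl fun k hk => by rw [reflect_snd_of_ne _ _ (Finset.ne_of_mem_erase hk)]
  unfold IsCorner at h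
  rw [sgn, sgn, ← Finset.add_sum_erase _ _ (Finset.mem_univ i.castSucc.succ), h3,
    ← Finset.add_sum_erase _ (fun k => (s.snd k : ℕ)) (Finset.mem_univ i.castSucc.succ)]
  refine Eq.trans ?_ (neg_one_mul _)
  rw [← pow_succ']
  apply neg_one_pow_congr
  rw [← Nat.not_odd_iff_even, ← Nat.not_odd_iff_even]
  simp only [Nat.odd_iff]
  omega

end Reflect

end ShufflePath

end

section

section Shuffle

variable {K : Type u} [Field K] {Λ Λ' : Type u} [Ring Λ] [Algebra K Λ] [Ring Λ'] [Algebra K Λ']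
  (M : Bimodule K Λ) (M' : Bimodule K Λ')

/-! ### The shuffle map -/

/-- The differential of the Hochschild complex. -/
def chainsD (p q : ℕ) : chains M p →ₗ[K] chains M q := ((hochschildComplex M).d p q).hom

theorem chainsD_of_normProj {n : ℕ} {x : chains M (n + 1)} (h : normProj M (n + 1) x = x) :
    chainsD M (n + 1) n x = structureMap M (face 0) x :=
  hochschildComplex_d_of_normProj M h

theorem chainsD_zero : chainsD M 0 0 = 0 :=
  congrArg ModuleCat.Hom.hom ((hochschildComplex M).shape 0 0 (by simp))

theorem normProj_chainsD (m n : ℕ) (x : chains M m) :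
    chainsD M m n (normProj M m x) = normProj M n (chainsD M m n x) :=
  normProj_d M x

/-- The summand of the shuffle map that belongs to a path, without its sign. -/
def pathMap {n p q : ℕ} (s : ShufflePath n p q) :
    chains M p ⊗[K] chains M' q →ₗ[K] chains (M.tensor M') n :=
  (zip M M' n).toLinearMap ∘ₗ TensorProduct.map (structureMap M s.fst) (structureMap M' s.snd)

theorem pathMap_apply {n p q : ℕ} (s : ShufflePath n p q) (x : chains M p ⊗[K] chains M' q) :
    pathMap M M' s x =
      zip M M' n (TensorProduct.map (structureMap M s.fst) (structureMap M' s.snd) x) := rfl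

theorem pathMap_tmul {n p q : ℕ} (s : ShufflePath n p q) (a : chains M p) (a' : chains M' q) :
    pathMap M M' s (a ⊗ₜ a') = zip M M' n (structureMap M s.fst a ⊗ₜ structureMap M' s.snd a') := rfl

theorem structureMap_pathMap {m n p q : ℕ} (s : ShufflePath n p q) (f : Fin (m + 1) →o Fin (n + 1))
    (x : chains M p ⊗[K] chains M' q) :
    structureMap (M.tensor M') f (pathMap M M' s x) =
      zip M M' m (TensorProduct.map (structureMap M (s.fst.comp f))
        (structureMap M' (s.snd.comp f)) x) := by
  rw [pathMap_apply, structureMap_zip, structureMap_comp, structureMap_comp, TensorProduct.map_comp,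
    LinearMap.comp_apply]

/-- The shuffle map. It vanishes unless `p + q = n`. -/
def shuffle (p q n : ℕ) : chains M p ⊗[K] chains M' q →ₗ[K] chains (M.tensor M') n :=
  ∑ s : ShufflePath n p q, s.sgn • pathMap M M' s

theorem shuffle_apply (p q n : ℕ) (x : chains M p ⊗[K] chains M' q) :
    shuffle M M' p q n x = ∑ s : ShufflePath n p q, s.sgn • pathMap M M' s x := by
  rw [shuffle, LinearMap.sum_apply]
  rfl

theorem structureMap_shuffle (p q : ℕ) {m n : ℕ} (f : Fin (m + 1) →o Fin (n + 1))
    (x : chains M p ⊗[K] chains M' q) :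
    structureMap (M.tensor M') f (shuffle M M' p q n x) =
      ∑ s : ShufflePath n p q, s.sgn • zip M M' m (TensorProduct.map
        (structureMap M (s.fst.comp f)) (structureMap M' (s.snd.comp f)) x) := by
  rw [shuffle_apply, map_sum]
  exact Finset.sum_congr rfl fun s _ => by rw [map_zsmul, structureMap_pathMap]

variable {M M'}

/-- The shuffle of normalized chains is normalized. A face that omits the last vertex or a vertex
between parallel steps misses a vertex in one coordinate, so its term dies; corner terms cancel in
pairs under reflection. -/
theorem structureMap_face_shuffle {p q n : ℕ} {a : chains M p} {a' : chains M' q}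
    (ha : normProj M p a = a) (ha' : normProj M' q a' = a') (i : Fin (n + 1)) :
    structureMap (M.tensor M') (face i.succ) (shuffle M M' p q (n + 1) (a ⊗ₜ a')) = 0 := by
  rw [structureMap_shuffle]
  refine Fin.lastCases ?_ (fun i => ?_) i
  -- The last face: without its final step the path misses `p` or `q`, according to the direction of
  -- that step.
  · refine Finset.sum_eq_zero fun s _ => ?_
    have hle : ∀ k : Fin (n + 1), face (Fin.last n).succ k ≤ (Fin.last n).castSucc := fun k => by
      have := k.isLt
      rw [Fin.le_def, face_apply, Fin.val_succ, Fin.val_castSucc, Fin.val_last]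
      rw [if_pos (by omega)]
      omega
    have h1 := congrArg Fin.val s.fst_last
    have h2 := congrArg Fin.val s.snd_last
    rw [← Fin.succ_last, Fin.val_last] at h1 h2
    rw [TensorProduct.map_tmul]
    rcases s.step (Fin.last n) with ⟨h, -⟩ | ⟨-, h⟩
    · rw [structureMap_eq_zero_of_missed M _ a ha p (by omega) le_rfl, TensorProduct.zero_tmul,
        map_zero, smul_zero]
      intro k
      have := s.fst_mono (hle k)
      change (s.fst (face (Fin.last n).succ k) : ℕ) ≠ p
      omega
    · rw [structureMap_eq_zero_of_missed M' _ a' ha' q (by omega) le_rfl, TensorProduct.tmul_zero,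
        map_zero, smul_zero]
      intro k
      have := s.snd_mono (hle k)
      change (s.snd (face (Fin.last n).succ k) : ℕ) ≠ q
      omega
  · have key : ∀ s : ShufflePath (n + 1) p q, s.IsCorner i ∨
        TensorProduct.map (structureMap M (s.fst.comp (face i.castSucc.succ)))
          (structureMap M' (s.snd.comp (face i.castSucc.succ))) (a ⊗ₜ a') = 0 := by
      intro s
      rw [or_iff_not_imp_left]
      intro hs
      have haux := s.reflect_aux i
      have hk : ∀ k : Fin (n + 1), face i.castSucc.succ k ≤ i.castSucc.castSucc ∨
          i.succ.succ ≤ face i.castSucc.succ k := fun k =>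
        (lt_or_gt_of_ne (ShufflePath.face_ne i.castSucc.succ k)).imp ShufflePath.le_of_lt_mid
          ShufflePath.le_of_mid_lt
      unfold ShufflePath.IsCorner at hs
      rw [TensorProduct.map_tmul]
      rcases Nat.lt_or_ge (s.snd i.castSucc.castSucc) (s.snd i.succ.succ) with h | h
      · rw [structureMap_eq_zero_of_missed M' _ a' ha' (s.snd i.castSucc.succ) (by omega)
          (Nat.lt_succ_iff.1 (s.snd i.castSucc.succ).isLt), TensorProduct.tmul_zero]
        intro k
        change (s.snd (face i.castSucc.succ k) : ℕ) ≠ _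
        rcases hk k with h' | h'
        · have := s.snd_mono h'
          omega
        · have := s.snd_mono h'
          omega
      · rw [structureMap_eq_zero_of_missed M _ a ha (s.fst i.castSucc.succ) (by omega)
          (Nat.lt_succ_iff.1 (s.fst i.castSucc.succ).isLt), TensorProduct.zero_tmul]
        intro k
        change (s.fst (face i.castSucc.succ k) : ℕ) ≠ _
        rcases hk k with h' | h'
        · have := s.fst_mono h'
          omega
        · have := s.fst_mono h'
          omega
    -- A path and its reflection have the same face and, at a corner, opposite signs; where there is
    -- no corner, the term itself is zero.
    refine Finset.sum_involution (fun s _ => s.reflect i) (fun s _ => ?_) (fun s _ hs => ?_)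
      (fun s _ => Finset.mem_univ _) (fun s _ => s.reflect_reflect i)
    · rw [s.reflect_fst_comp_face, s.reflect_snd_comp_face]
      rcases key s with h | h
      · rw [h.sgn_reflect, neg_smul, add_neg_cancel]
      · rw [h, map_zero, smul_zero, smul_zero, add_zero]
    · rcases key s with h | h
      · exact h.reflect_ne
      · rw [h, map_zero, smul_zero] at hs
        exact absurd rfl hs

theorem normProj_shuffle {p q n : ℕ} {a : chains M p} {a' : chains M' q}
    (ha : normProj M p a = a) (ha' : normProj M' q a' = a') :
    normProj (M.tensor M') n (shuffle M M' p q n (a ⊗ₜ a')) = shuffle M M' p q n (a ⊗ₜ a') := by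
  rcases n with _ | n
  · exact normProj_zero _ _
  · exact normProj_eq_self _ _ (structureMap_face_shuffle ha ha')

/-- On normalized chains the boundary is `d_0`, which deletes the first step of each path. Paths
that begin horizontally yield the shuffles of `∂a ⊗ a'`, the others those of `a ⊗ ∂a'`, with the
sign from `sgn_vcons`. -/
theorem chainsD_shuffle {p q n : ℕ} {a : chains M p} {a' : chains M' q}
    (ha : normProj M p a = a) (ha' : normProj M' q a' = a') :
    chainsD (M.tensor M') (n + 1) n (shuffle M M' p q (n + 1) (a ⊗ₜ a')) =
      shuffle M M' (p - 1) q n (chainsD M p (p - 1) a ⊗ₜ a') +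
        (-1 : ℤ) ^ p • shuffle M M' p (q - 1) n (a ⊗ₜ chainsD M' q (q - 1) a') := by
  rw [chainsD_of_normProj _ (normProj_shuffle ha ha'), structureMap_shuffle,
    ← Finset.sum_filter_add_sum_filter_not Finset.univ
      fun s : ShufflePath (n + 1) p q => (s.snd 1 : ℕ) = 0]
  congr 1
  · rcases p with _ | p
    · rw [Finset.filter_false_of_mem fun s _ => s.snd_one_ne_zero, Finset.sum_empty,
        show chainsD M 0 (0 - 1) = 0 from chainsD_zero M, LinearMap.zero_apply,
        TensorProduct.zero_tmul, map_zero]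
    · rw [ShufflePath.sum_hcons]
      refine Eq.trans ?_ (shuffle_apply M M' p q n _).symm
      refine Finset.sum_congr rfl fun t _ => ?_
      rw [t.sgn_hcons, t.hcons_fst_comp_face, t.hcons_snd_comp_face, structureMap_comp,
        TensorProduct.map_tmul, LinearMap.comp_apply, ← chainsD_of_normProj _ ha]
      rfl
  · rcases q with _ | q
    · rw [Finset.filter_false_of_mem fun s _ => not_not.2 s.snd_one_eq_zero, Finset.sum_empty,
        show chainsD M' 0 (0 - 1) = 0 from chainsD_zero M', LinearMap.zero_apply,
        TensorProduct.tmul_zero, map_zero, smul_zero]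
    · rw [ShufflePath.sum_vcons]
      refine Eq.trans ?_ (congrArg ((-1 : ℤ) ^ p • ·) (shuffle_apply M M' p q n _).symm)
      rw [Finset.smul_sum]
      refine Finset.sum_congr rfl fun t _ => ?_
      rw [t.sgn_vcons, t.vcons_fst_comp_face, t.vcons_snd_comp_face, structureMap_comp,
        TensorProduct.map_tmul, LinearMap.comp_apply, ← chainsD_of_normProj _ ha', mul_smul]
      rfl

/-! ### Reduction to normalized chains -/

/-- Since a path has no diagonal step, every factor is `λ ⊗ 1` or `1 ⊗ λ'`, and reducing `λ` or `λ'`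
changes it only by a multiple of `1 ⊗ 1`, hence not modulo degenerate chains. -/
theorem normProj_pathMap_reduce {p q n : ℕ} (s : ShufflePath n p q)
    (x : chains M p ⊗[K] chains M' q) :
    normProj (M.tensor M') n (pathMap M M' s (TensorProduct.map (reduce M p) (reduce M' q) x)) =
      normProj (M.tensor M') n (pathMap M M' s x) := by
  suffices h : (normProj (M.tensor M') n ∘ₗ pathMap M M' s) ∘ₗ
      TensorProduct.map (reduce M p) (reduce M' q) = normProj (M.tensor M') n ∘ₗ pathMap M M' s from
    LinearMap.congr_fun h x
  apply chains_ext₂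
  intro m l m' l'
  simp only [LinearMap.comp_apply, TensorProduct.map_tmul, reduce_tmul, pathMap_tmul]
  rw [structureMap_of_endpoints M _ s.fst_zero s.fst_last,
    structureMap_of_endpoints M' _ s.snd_zero s.snd_last,
    structureMap_of_endpoints M _ s.fst_zero s.fst_last,
    structureMap_of_endpoints M' _ s.snd_zero s.snd_last, zip_tmul, zip_tmul]
  symm
  apply normProj_tmul_congr
  intro i
  rcases s.step i with ⟨h1, h2⟩ | ⟨h1, h2⟩
  · have hlt : (s.fst i.castSucc : ℕ) < p := by
      have := (s.fst i.succ).isLt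
      omega
    rw [h1, h2, intervalProd_self, intervalProd_self, intervalProd_step _ (Or.inr rfl),
      intervalProd_step _ (Or.inr rfl), if_neg (by omega), if_neg (by omega), extendOne, extendOne,
      dif_pos hlt, dif_pos hlt, redProj_apply, TensorProduct.sub_tmul, sub_eq_add_neg]
    exact ⟨-counit K Λ (l ⟨_, hlt⟩), by rw [neg_smul, ← TensorProduct.smul_tmul']; rfl⟩
  · have hlt : (s.snd i.castSucc : ℕ) < q := by
      have := (s.snd i.succ).isLt
      omega
    rw [h1, h2, intervalProd_self, intervalProd_self, intervalProd_step _ (Or.inr rfl),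
      intervalProd_step _ (Or.inr rfl), if_neg (by omega), if_neg (by omega), extendOne, extendOne,
      dif_pos hlt, dif_pos hlt, redProj_apply, TensorProduct.tmul_sub, sub_eq_add_neg]
    exact ⟨-counit K Λ' (l' ⟨_, hlt⟩), by rw [neg_smul, TensorProduct.tmul_smul]; rfl⟩

theorem normProj_shuffle_reduce {p q n : ℕ} (x : chains M p ⊗[K] chains M' q) :
    normProj (M.tensor M') n (shuffle M M' p q n (TensorProduct.map (reduce M p) (reduce M' q) x)) =
      normProj (M.tensor M') n (shuffle M M' p q n x) := by
  rw [shuffle_apply, shuffle_apply, map_sum, map_sum]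
  exact Finset.sum_congr rfl fun s _ => by rw [map_zsmul, map_zsmul, normProj_pathMap_reduce]

theorem map_reduce_normProj {p q : ℕ} (x : chains M p ⊗[K] chains M' q) :
    TensorProduct.map (reduce M p) (reduce M' q)
      (TensorProduct.map (normProj M p) (normProj M' q) x) =
      TensorProduct.map (reduce M p) (reduce M' q) x := by
  rw [← LinearMap.comp_apply, ← TensorProduct.map_comp]
  congr 2 <;> exact LinearMap.ext (reduce_normProj _)

theorem map_normProj_reduce {p q : ℕ} (x : chains M p ⊗[K] chains M' q) :
    TensorProduct.map (normProj M p) (normProj M' q)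
      (TensorProduct.map (reduce M p) (reduce M' q) x) =
      TensorProduct.map (normProj M p) (normProj M' q) x := by
  rw [← LinearMap.comp_apply, ← TensorProduct.map_comp]
  congr 2 <;> exact LinearMap.ext (normProj_reduce _)

/-- The left side is already normalized, so `normProj` may be applied to it. After that only the
reduced part of the argument matters, and this is the same for `x` and its normalization. -/
theorem shuffle_normProj {p q n : ℕ} (x : chains M p ⊗[K] chains M' q) :
    shuffle M M' p q n (TensorProduct.map (normProj M p) (normProj M' q) x) =
      normProj (M.tensor M') n (shuffle M M' p q n x) := by
  have h : normProj (M.tensor M') n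
      (shuffle M M' p q n (TensorProduct.map (normProj M p) (normProj M' q) x)) =
      shuffle M M' p q n (TensorProduct.map (normProj M p) (normProj M' q) x) := by
    induction x with
    | zero => simp only [map_zero]
    | tmul a a' => exact normProj_shuffle (normProj_idem M a) (normProj_idem M' a')
    | add x y hx hy => simp only [map_add, hx, hy]
  rw [← h, ← normProj_shuffle_reduce, map_reduce_normProj, normProj_shuffle_reduce]

end Shuffle

end

/-! ### The horizontal-first path, reflections and comparison of paths -/

section

namespace ShufflePath

variable {n p q : ℕ}

/-- The path that runs horizontally first. -/
def base (h : p + q = n) : ShufflePath n p q where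
  fst := ⟨fun k => ⟨min k p, by omega⟩, fun a b hab => by
    have : (a : ℕ) ≤ b := hab
    rw [Fin.le_def]
    simp only
    omega⟩
  snd := ⟨fun k => ⟨k - p, by omega⟩, fun a b hab => by
    have : (a : ℕ) ≤ b := hab
    rw [Fin.le_def]
    simp only
    omega⟩
  add_eq k := by
    change min (k : ℕ) p + (k - p) = k
    omega
  add_len := h

theorem base_snd (h : p + q = n) (k : Fin (n + 1)) : ((base h).snd k : ℕ) = k - p := rfl

/-- The second sum in `sgn` is the coordinate sum of this path, so the exponent is even. -/
theorem sgn_base (h : p + q = n) : (base h).sgn = 1 := by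
  have h1 : ∑ k, ((base h).snd k : ℕ) = ∑ i ∈ Finset.range (q + 1), i := by
    simp only [base_snd]
    rw [Fin.sum_univ_eq_sum_range (fun k => k - p) (n + 1), ← h, add_assoc, Finset.sum_range_add,
      Finset.sum_eq_zero, zero_add]
    · exact Finset.sum_congr rfl fun k _ => by omega
    · intro k hk
      have := Finset.mem_range.1 hk
      omega
  rw [sgn, h1, ← two_mul]
  exact (even_two_mul _).neg_one_pow

theorem reflect_snd_lt {s : ShufflePath (n + 1) p q} {i : Fin n} (h : s.IsCorner i)
    (h' : (s.snd i.castSucc.succ : ℕ) = s.snd i.succ.succ) :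
    ∑ k, ((s.reflect i).snd k : ℕ) < ∑ k, (s.snd k : ℕ) := by
  have h0 := s.reflect_snd_self i
  unfold IsCorner at h
  refine Finset.sum_lt_sum (fun k _ => ?_) ⟨i.castSucc.succ, Finset.mem_univ _, by omega⟩
  rcases eq_or_ne k i.castSucc.succ with rfl | hk
  · omega
  · rw [reflect_snd_of_ne _ _ hk]

theorem eq_base_of_forall_step (s : ShufflePath n p q)
    (h : ∀ i : Fin n, (s.fst i.succ : ℕ) = s.fst i.castSucc → (s.fst i.castSucc : ℕ) = p) :
    s = base s.add_len := by
  apply ext_snd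
  intro k
  rw [base_snd]
  induction k using Fin.induction with
  | zero =>
    rw [s.snd_zero]
    simp
  | succ i ih =>
    have h1 := s.add_eq i.castSucc
    have h2 := (s.fst i.succ).isLt
    rw [Fin.val_castSucc] at h1 ih
    rw [Fin.val_succ]
    rcases s.step i with h3 | h3
    · omega
    · have := h i h3.1
      omega

/-- Without a corner that goes up and then right, a vertical step is followed only by vertical
steps. Working back from the end, such a step therefore lies on the line where the first coordinate
is `p`. -/
theorem eq_base_of_forall_corner (s : ShufflePath (n + 1) p q)
    (h : ∀ i : Fin n, s.IsCorner i → (s.snd i.castSucc.succ : ℕ) ≠ s.snd i.succ.succ) :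
    s = base s.add_len := by
  apply eq_base_of_forall_step
  intro i
  induction i using Fin.reverseInduction with
  | last =>
    intro h1
    rw [← h1, Fin.succ_last, s.fst_last, Fin.val_last]
  | cast i ih =>
    intro h1
    have h2 := h i
    have h3 := s.step i.succ
    have h4 := s.step i.castSucc
    rw [← Fin.succ_castSucc] at ih h3
    unfold IsCorner at h2
    omega

/-- Induction on the sum of second coordinates: reflecting an up-right corner lowers it, and changes
the sign of both sides. A path without such a corner is `base`. -/
theorem eq_sgn_smul {W : Type*} [AddCommGroup W] (φ : ShufflePath (n + 1) p q → W)
    (h : ∀ s i, s.IsCorner i → φ s + φ (s.reflect i) = 0) (s : ShufflePath (n + 1) p q) :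
    φ s = s.sgn • φ (base s.add_len) := by
  induction hN : ∑ k, (s.snd k : ℕ) using Nat.strong_induction_on generalizing s with
  | _ N ih =>
    by_cases hs : ∃ i : Fin n, s.IsCorner i ∧ (s.snd i.castSucc.succ : ℕ) = s.snd i.succ.succ
    · obtain ⟨i, hi, hi'⟩ := hs
      rw [eq_neg_of_add_eq_zero_left (h s i hi), ih _ (hN ▸ reflect_snd_lt hi hi') _ rfl,
        hi.sgn_reflect, neg_smul, neg_neg]
    · have hb := s.eq_base_of_forall_corner fun i hi hi' => hs ⟨i, hi, hi'⟩
      conv_lhs => rw [hb]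
      conv_rhs => rw [hb]
      rw [sgn_base, one_smul]

/-- If every step of `t` had the same direction in `s`, the two paths would coincide vertex by
vertex. -/
theorem exists_step_ne {p' q' : ℕ} (s : ShufflePath n p q) (t : ShufflePath n p' q')
    (h : ∃ k, (s.snd k : ℕ) ≠ t.snd k) :
    ∃ i : Fin n, ((t.fst i.castSucc ≠ t.fst i.succ) ∧ s.fst i.castSucc = s.fst i.succ) ∨
      ((t.snd i.castSucc ≠ t.snd i.succ) ∧ s.snd i.castSucc = s.snd i.succ) := by
  by_contra! hc
  obtain ⟨k, hk⟩ := h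
  apply hk
  clear hk
  induction k using Fin.induction with
  | zero => rw [s.snd_zero, t.snd_zero]; rfl
  | succ i ih =>
    have h1 := s.step i
    have h2 := t.step i
    have h3 := hc i
    simp only [Ne, Fin.ext_iff] at h3
    omega

theorem exists_of_steps (c : Fin n → Bool) : ∃ (p q : ℕ) (s : ShufflePath n p q), ∀ i : Fin n,
    if c i then (s.snd i.succ : ℕ) = s.snd i.castSucc else (s.fst i.succ : ℕ) = s.fst i.castSucc := by
  induction n with
  | zero => exact ⟨0, 0, base rfl, fun i => i.elim0⟩
  | succ n ih =>
    obtain ⟨p, q, s, hs⟩ := ih fun i => c i.succ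
    cases h0 : c 0
    · refine ⟨p, q + 1, s.vcons, fun i => ?_⟩
      refine Fin.cases ?_ (fun i => ?_) i
      · rw [h0, if_neg Bool.false_ne_true, vcons_fst_succ, s.fst_zero]
        rfl
      · have := hs i
        rw [← Fin.succ_castSucc, vcons_fst_succ, vcons_fst_succ, vcons_snd_succ, vcons_snd_succ]
        simpa using this
    · refine ⟨p + 1, q, s.hcons, fun i => ?_⟩
      refine Fin.cases ?_ (fun i => ?_) i
      · rw [h0, if_pos rfl, hcons_snd_succ, s.snd_zero]
        rfl
      · have := hs i
        rw [← Fin.succ_castSucc, hcons_fst_succ, hcons_fst_succ, hcons_snd_succ, hcons_snd_succ]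
        simpa using this

/-! #### Faces of paths -/

/-- Deleting a vertex merges the two edges at it and leaves the other edges unchanged. -/
theorem face_step (i k : Fin n) :
    (k = i ∧ face i.castSucc.succ k.castSucc = i.castSucc.castSucc ∧
      face i.castSucc.succ k.succ = i.succ.succ) ∨
    ∃ j : Fin (n + 1), face i.castSucc.succ k.castSucc = j.castSucc ∧
      face i.castSucc.succ k.succ = j.succ := by
  have h1 := face_apply i.castSucc.succ k.castSucc
  have h2 := face_apply i.castSucc.succ k.succ
  simp only [Fin.val_succ, Fin.val_castSucc] at h1 h2
  rcases lt_trichotomy k i with h | h | h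
  · rw [Fin.lt_def] at h
    rw [if_pos (by omega)] at h1 h2
    exact Or.inr ⟨k.castSucc, Fin.ext h1, Fin.ext h2⟩
  · subst h
    rw [if_pos (by omega)] at h1
    rw [if_neg (by omega)] at h2
    exact Or.inl ⟨rfl, Fin.ext h1, Fin.ext h2⟩
  · rw [Fin.lt_def] at h
    rw [if_neg (by omega)] at h1 h2
    exact Or.inr ⟨k.succ, Fin.ext h1, Fin.ext h2⟩

/-- The path with a corner cut off. -/
theorem cut_step (s : ShufflePath (n + 1) p q) {i : Fin n} (h : s.IsCorner i) (k : Fin n) :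
    (s.fst (face i.castSucc.succ k.succ) : ℕ) ≤ s.fst (face i.castSucc.succ k.castSucc) + 1 ∧
    (s.snd (face i.castSucc.succ k.succ) : ℕ) ≤ s.snd (face i.castSucc.succ k.castSucc) + 1 ∧
    (s.fst (face i.castSucc.succ k.castSucc) ≠ s.fst (face i.castSucc.succ k.succ) ∨
      s.snd (face i.castSucc.succ k.castSucc) ≠ s.snd (face i.castSucc.succ k.succ)) := by
  simp only [Ne, Fin.ext_iff]
  have h1 := s.reflect_aux i
  unfold IsCorner at h
  rcases face_step i k with ⟨rfl, h2, h3⟩ | ⟨j, h2, h3⟩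
  · rw [h2, h3]
    omega
  · rw [h2, h3]
    have := s.step j
    omega

theorem cut_step_self (s : ShufflePath (n + 1) p q) {i : Fin n} (h : s.IsCorner i) :
    (s.fst (face i.castSucc.succ i.castSucc) : ℕ) < s.fst (face i.castSucc.succ i.succ) ∧
    (s.snd (face i.castSucc.succ i.castSucc) : ℕ) < s.snd (face i.castSucc.succ i.succ) := by
  have h1 := s.reflect_aux i
  unfold IsCorner at h
  have e1 : face i.castSucc.succ i.castSucc = i.castSucc.castSucc := Fin.ext (by
    rw [face_apply, if_pos (by simp)]
    rfl)
  have e2 : face i.castSucc.succ i.succ = i.succ.succ := Fin.ext (by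
    rw [face_apply, if_neg (by simp)]
    rfl)
  rw [e1, e2]
  omega

theorem face_interior_zero (i : Fin n) : face i.castSucc.succ 0 = 0 := Fin.ext (by
  rw [face_apply, if_pos (by simp)]
  rfl)

theorem face_interior_last (i : Fin n) : face i.castSucc.succ (Fin.last n) = Fin.last (n + 1) :=
  Fin.ext (by
    have := i.isLt
    rw [face_apply, if_neg (by simp only [Fin.val_last, Fin.val_succ, Fin.val_castSucc]; omega)]
    rfl)

/-- A face of a path that has at least the steps of the path `s` with the corner `i` cut off is
the face of `s` or of its reflection at this corner. -/
theorem eq_of_face_steps {p' q' : ℕ} (s : ShufflePath (n + 1) p q) {i : Fin n} (h : s.IsCorner i)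
    (t : ShufflePath (n + 1) p' q') (j : Fin (n + 2))
    (hF : ∀ k : Fin n, s.fst (face i.castSucc.succ k.castSucc) ≠ s.fst (face i.castSucc.succ k.succ) →
      t.fst (face j k.castSucc) ≠ t.fst (face j k.succ))
    (hG : ∀ k : Fin n, s.snd (face i.castSucc.succ k.castSucc) ≠ s.snd (face i.castSucc.succ k.succ) →
      t.snd (face j k.castSucc) ≠ t.snd (face j k.succ)) :
    j = i.castSucc.succ ∧ ∀ k ≠ i.castSucc.succ, (t.snd k : ℕ) = s.snd k := by
  -- In either coordinate the cut path rises by at most one per edge, and `t` rises whenever it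
  -- does.
  have hle : ∀ k, (s.fst (face i.castSucc.succ k) : ℕ) ≤ t.fst (face j k) ∧
      (s.snd (face i.castSucc.succ k) : ℕ) ≤ t.snd (face j k) := by
    intro k
    induction k using Fin.induction with
    | zero =>
      rw [face_interior_zero, s.fst_zero, s.snd_zero]
      exact ⟨Nat.zero_le _, Nat.zero_le _⟩
    | succ k ih =>
      have h1 := hF k
      have h2 := hG k
      have h3 := s.cut_step h k
      have h4 := t.fst_mono ((face j).monotone (Fin.castSucc_lt_succ (i := k)).le)
      have h5 := t.snd_mono ((face j).monotone (Fin.castSucc_lt_succ (i := k)).le)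
      have h6 := s.fst_mono ((face i.castSucc.succ).monotone (Fin.castSucc_lt_succ (i := k)).le)
      have h7 := s.snd_mono ((face i.castSucc.succ).monotone (Fin.castSucc_lt_succ (i := k)).le)
      simp only [Ne, Fin.ext_iff] at h1 h2
      omega
  have hsum : ∀ k, (s.fst (face i.castSucc.succ k) : ℕ) + s.snd (face i.castSucc.succ k) =
      if (k : ℕ) < i + 1 then (k : ℕ) else k + 1 := fun k => by
    rw [s.add_eq, face_apply]
    rfl
  have hsum' : ∀ k, (t.fst (face j k) : ℕ) + t.snd (face j k) =
      if (k : ℕ) < j then (k : ℕ) else k + 1 := fun k => by rw [t.add_eq, face_apply]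
  -- At edge `i` the face of `t` moves in both directions, so this edge must skip a vertex of `t`,
  -- namely `j`.
  have hj : (j : ℕ) = i + 1 := by
    have h1 := hF i
    have h2 := hG i
    have h3 := s.cut_step_self h
    have h4 := t.fst_mono ((face j).monotone (Fin.castSucc_lt_succ (i := i)).le)
    have h5 := t.snd_mono ((face j).monotone (Fin.castSucc_lt_succ (i := i)).le)
    simp only [Ne, Fin.ext_iff] at h1 h2
    have h6 := hsum i.succ
    have h7 := hsum' i.succ
    have h8 := hsum' i.castSucc
    have h9 := hle i.succ
    rw [Fin.val_succ] at h6 h7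
    rw [Fin.val_castSucc] at h8
    rw [if_neg (by omega)] at h6
    split_ifs at h7 h8 <;> omega
  have hj' : j = i.castSucc.succ := Fin.ext hj
  refine ⟨hj', fun k hk => ?_⟩
  obtain ⟨k, rfl⟩ : ∃ k', face i.castSucc.succ k' = k := Fin.exists_succAbove_eq hk
  have h1 := hsum k
  have h2 := hsum' k
  have h3 := hle k
  rw [hj] at h2
  rw [hj'] at h2 h3
  omega

end ShufflePath

/-- The paths of length `n`, to any endpoint. -/
abbrev PathIndex (n : ℕ) : Type :=
  Σ a : {a : ℕ × ℕ // a ∈ Finset.HasAntidiagonal.antidiagonal n}, ShufflePath n a.1.1 a.1.2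

/-- A path as an index. -/
def ShufflePath.toIndex {n p q : ℕ} (s : ShufflePath n p q) : PathIndex n :=
  ⟨⟨(p, q), Finset.HasAntidiagonal.mem_antidiagonal.2 s.add_len⟩, s⟩

theorem PathIndex.ext {n : ℕ} {s t : PathIndex n} (h : ∀ k, (s.2.snd k : ℕ) = t.2.snd k) :
    s = t := by
  obtain ⟨⟨⟨p, q⟩, ha⟩, s⟩ := s
  obtain ⟨⟨⟨p', q'⟩, ha'⟩, t⟩ := t
  simp only at s t h
  have h1 := h (Fin.last n)
  rw [s.snd_last, t.snd_last, Fin.val_last, Fin.val_last] at h1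
  subst h1
  have h2 : p = p' := Nat.add_right_cancel (s.add_len.trans t.add_len.symm)
  subst h2
  rw [ShufflePath.ext_snd h]

end

/-! ### Detection of chains by their steps, and expansion along paths -/

section

/-- A discrete intermediate value argument: if `j` were missed, the values could never rise past it.
-/
theorem surjective_of_steps {n m : ℕ} (f : Fin (n + 1) →o Fin (m + 1)) (h0 : f 0 = 0)
    (h1 : f (Fin.last n) = Fin.last m) (hf : ∀ i : Fin n, (f i.succ : ℕ) ≤ f i.castSucc + 1) :
    Function.Surjective f := by
  intro j
  by_contra! h
  have key : ∀ k, (f k : ℕ) < j := by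
    intro k
    have hk := h k
    induction k using Fin.induction with
    | zero =>
      rw [h0] at hk ⊢
      exact Nat.pos_of_ne_zero fun e => hk (Fin.ext e.symm)
    | succ k ih =>
      have h2 := ih (h _)
      have h3 := hf k
      rw [Ne, Fin.ext_iff] at hk
      omega
  have := key (Fin.last n)
  rw [h1, Fin.val_last] at this
  omega

theorem exists_section {n m : ℕ} (f : Fin (n + 1) →o Fin (m + 1)) (hf : Function.Surjective f) :
    ∃ k : Fin (m + 1) →o Fin (n + 1), f.comp k = OrderHom.id := by
  refine ⟨⟨Function.surjInv hf, fun a b hab => ?_⟩, OrderHom.ext _ _ (funext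
    (Function.surjInv_eq hf))⟩
  by_contra! h
  have h1 := f.monotone h.le
  rw [Function.surjInv_eq hf, Function.surjInv_eq hf] at h1
  rw [le_antisymm hab h1] at h
  exact lt_irrefl _ h

section Retract

variable {K : Type u} [Field K] {Λ Λ' : Type u} [Ring Λ] [Algebra K Λ] [Ring Λ'] [Algebra K Λ']
  (M : Bimodule K Λ) (M' : Bimodule K Λ')

/-- A map that detects the part of a chain that comes from a given pair of maps of simplices,
kills degenerate chains and the part that comes from pairs with fewer steps. -/
theorem exists_detect {n p q : ℕ} (F : Fin (n + 1) →o Fin (p + 1)) (G : Fin (n + 1) →o Fin (q + 1))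
    (hF0 : F 0 = 0) (hF1 : F (Fin.last n) = Fin.last p) (hG0 : G 0 = 0)
    (hG1 : G (Fin.last n) = Fin.last q)
    (h : ∀ i : Fin n, (F i.succ : ℕ) ≤ F i.castSucc + 1 ∧ (G i.succ : ℕ) ≤ G i.castSucc + 1 ∧
      (F i.castSucc ≠ F i.succ ∨ G i.castSucc ≠ G i.succ)) :
    ∃ r : chains (M.tensor M') n →ₗ[K] chains M p ⊗[K] chains M' q,
      (∀ x, r (normProj (M.tensor M') n x) = r x) ∧
      (∀ x, r (zip M M' n (TensorProduct.map (structureMap M F) (structureMap M' G) x)) =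
        TensorProduct.map (reduce M p) (reduce M' q) x) ∧
      ∀ (p' q' : ℕ) (F' : Fin (n + 1) →o Fin (p' + 1)) (G' : Fin (n + 1) →o Fin (q' + 1)),
        (∃ i : Fin n, (F i.castSucc ≠ F i.succ ∧ F' i.castSucc = F' i.succ) ∨
          (G i.castSucc ≠ G i.succ ∧ G' i.castSucc = G' i.succ)) →
        ∀ x, r (zip M M' n (TensorProduct.map (structureMap M F') (structureMap M' G') x)) = 0 := by
  obtain ⟨k, hk⟩ := exists_section F (surjective_of_steps F hF0 hF1 fun i => (h i).1)
  obtain ⟨l, hl⟩ := exists_section G (surjective_of_steps G hG0 hG1 fun i => (h i).2.1)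
  -- In each tensor factor, keep what is reduced at the steps and a unit elsewhere, then go down
  -- along a section: since `F.comp k = id`, the structure map of `k` undoes that of `F`.
  let r₁ : chains M n ⊗[K] chains M' n →ₗ[K] chains M p ⊗[K] chains M' q :=
    TensorProduct.map (structureMap M k ∘ₗ selectProj M (steps F))
      (structureMap M' l ∘ₗ selectProj M' (steps G))
  let r := r₁ ∘ₗ (zip M M' n).symm.toLinearMap
  have hr : ∀ y, r (zip M M' n y) = r₁ y := fun y => by
    change r₁ ((zip M M' n).symm (zip M M' n y)) = r₁ y
    rw [LinearEquiv.symm_apply_apply]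
  have hzero : ∀ (p' q' : ℕ) (F' : Fin (n + 1) →o Fin (p' + 1)) (G' : Fin (n + 1) →o Fin (q' + 1)),
        (∃ i : Fin n, (F i.castSucc ≠ F i.succ ∧ F' i.castSucc = F' i.succ) ∨
          (G i.castSucc ≠ G i.succ ∧ G' i.castSucc = G' i.succ)) →
        ∀ x, r₁ (TensorProduct.map (structureMap M F') (structureMap M' G') x) = 0 := by
    rintro p' q' F' G' ⟨i, hi⟩ x
    rw [← LinearMap.comp_apply, ← TensorProduct.map_comp, LinearMap.comp_assoc,
      LinearMap.comp_assoc]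
    rcases hi with ⟨h1, h2⟩ | ⟨h1, h2⟩
    · rw [show selectProj M (steps F) ∘ₗ structureMap M F' = 0 from LinearMap.ext fun y =>
        selectProj_structureMap_of_eq M _ F' i (decide_eq_true h1) h2 y, LinearMap.comp_zero,
        TensorProduct.map_zero_left, LinearMap.zero_apply]
    · rw [show selectProj M' (steps G) ∘ₗ structureMap M' G' = 0 from LinearMap.ext fun y =>
        selectProj_structureMap_of_eq M' _ G' i (decide_eq_true h1) h2 y, LinearMap.comp_zero,
        TensorProduct.map_zero_right, LinearMap.zero_apply]
  refine ⟨r, fun x => ?_, fun x => ?_, fun p' q' F' G' hi x => ?_⟩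
  · apply apply_normProj
    intro m f hf y
    obtain ⟨y, rfl⟩ := (zip M M' m).surjective y
    rw [structureMap_zip, hr]
    obtain ⟨i, hi⟩ := exists_castSucc_eq_succ f hf
    -- A degenerate chain has the unit of both algebras at some edge `i`; `F` or `G` steps there,
    -- and `redProj` kills the unit.
    exact hzero _ _ f f ⟨i, (h i).2.2.imp (⟨·, hi⟩) (⟨·, hi⟩)⟩ y
  · rw [hr, ← LinearMap.comp_apply, ← TensorProduct.map_comp, LinearMap.comp_assoc,
      LinearMap.comp_assoc,
      show selectProj M (steps F) ∘ₗ structureMap M F = structureMap M F ∘ₗ reduce M p from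
        LinearMap.ext (selectProj_steps M F hF0 hF1 fun i => (h i).1),
      show selectProj M' (steps G) ∘ₗ structureMap M' G = structureMap M' G ∘ₗ reduce M' q from
        LinearMap.ext (selectProj_steps M' G hG0 hG1 fun i => (h i).2.1),
      ← LinearMap.comp_assoc, ← LinearMap.comp_assoc, ← structureMap_comp, ← structureMap_comp, hk,
      hl, structureMap_id, structureMap_id, LinearMap.id_comp, LinearMap.id_comp]
  · rw [hr, hzero p' q' F' G' hi]

variable {M M'}

/-! ### Expansion along paths -/

theorem hochschildB_span (V : Submodule K Λ) (n : ℕ) (S : Submodule K (chains M n))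
    (h : ∀ (m : M.carrier) (l : Fin n → Λ), (∀ i, l i ∈ V) →
      m ⊗ₜ PiTensorProduct.tprod K l ∈ S) : hochschildB V M n ≤ S := by
  rintro _ ⟨y, rfl⟩
  induction y with
  | zero => rw [map_zero]; exact S.zero_mem
  | add y z hy hz => rw [map_add]; exact S.add_mem hy hz
  | tmul a t =>
    induction t using PiTensorProduct.induction_on with
    | smul_tprod c l =>
      rw [TensorProduct.tmul_smul, map_smul, TensorProduct.map_tmul, PiTensorProduct.map_tprod]
      exact S.smul_mem _ (h _ _ fun i => (l i).2)
    | add s t hs ht => rw [TensorProduct.tmul_add, map_add]; exact S.add_mem hs ht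

theorem tmul_tprod_mem_hochschildB (V : Submodule K Λ) {n : ℕ} (m : M.carrier) (l : Fin n → Λ)
    (h : ∀ i, l i ∈ V) : m ⊗ₜ PiTensorProduct.tprod K l ∈ hochschildB V M n := by
  refine ⟨m ⊗ₜ PiTensorProduct.tprod K fun i => ⟨l i, h i⟩, ?_⟩
  rw [TensorProduct.map_tmul, PiTensorProduct.map_tprod]
  rfl

/-- The image of `B_p ⊗ B'_q` in the tensor product of the chains. -/
abbrev hochschildBTensor (V : Submodule K Λ) (M : Bimodule K Λ) (V' : Submodule K Λ')
    (M' : Bimodule K Λ') (p q : ℕ) : Submodule K (chains M p ⊗[K] chains M' q) :=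
  LinearMap.range (TensorProduct.mapIncl (hochschildB V M p) (hochschildB V' M' q))

variable {V : Submodule K Λ} {V' : Submodule K Λ'}

theorem mem_boxSubmodule {x : Λ ⊗[K] Λ'} (hx : x ∈ boxSubmodule V V') :
    ∃ v ∈ V, ∃ v' ∈ V', x = v ⊗ₜ 1 + 1 ⊗ₜ v' := by
  obtain ⟨y, hy, z, hz, rfl⟩ := Submodule.mem_sup.1 hx
  have h1 : ∃ v ∈ V, y = v ⊗ₜ[K] (1 : Λ') := by
    have : Submodule.map₂ (TensorProduct.mk K Λ Λ') V 1 ≤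
        V.map ((TensorProduct.mk K Λ Λ').flip 1) := by
      rw [Submodule.map₂_le]
      rintro v hv _ ⟨c, rfl⟩
      refine ⟨c • v, V.smul_mem c hv, ?_⟩
      simp
    obtain ⟨v, hv, rfl⟩ := this hy
    exact ⟨v, hv, rfl⟩
  have h2 : ∃ v' ∈ V', z = (1 : Λ) ⊗ₜ[K] v' := by
    have : Submodule.map₂ (TensorProduct.mk K Λ Λ') 1 V' ≤
        V'.map (TensorProduct.mk K Λ Λ' 1) := by
      rw [Submodule.map₂_le]
      rintro _ ⟨c, rfl⟩ v hv
      refine ⟨c • v, V'.smul_mem c hv, ?_⟩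
      simp
    obtain ⟨v, hv, rfl⟩ := this hz
    exact ⟨v, hv, rfl⟩
  obtain ⟨v, hv, rfl⟩ := h1
  obtain ⟨v', hv', rfl⟩ := h2
  exact ⟨v, hv, v', hv', rfl⟩

theorem tmul_one_mem_boxSubmodule {v : Λ} (hv : v ∈ V) : v ⊗ₜ[K] (1 : Λ') ∈ boxSubmodule V V' :=
  Submodule.mem_sup_left (Submodule.apply_mem_map₂ (TensorProduct.mk K Λ Λ') hv
    (Submodule.one_le.1 le_rfl))

theorem one_tmul_mem_boxSubmodule {v : Λ'} (hv : v ∈ V') : (1 : Λ) ⊗ₜ[K] v ∈ boxSubmodule V V' :=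
  Submodule.mem_sup_right (Submodule.apply_mem_map₂ (TensorProduct.mk K Λ Λ')
    (Submodule.one_le.1 le_rfl) hv)

theorem pathMap_tmul_tprod {n p q : ℕ} (s : ShufflePath n p q) (m : M.carrier) (l : Fin p → Λ)
    (m' : M'.carrier) (l' : Fin q → Λ') :
    pathMap M M' s ((m ⊗ₜ PiTensorProduct.tprod K l) ⊗ₜ (m' ⊗ₜ PiTensorProduct.tprod K l')) =
      (show (M.tensor M').carrier from m ⊗ₜ m') ⊗ₜ PiTensorProduct.tprod K fun i =>
        (if (s.fst i.castSucc : ℕ) = s.fst i.succ then 1 else extendOne l (s.fst i.castSucc)) ⊗ₜ[K]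
          (if (s.snd i.castSucc : ℕ) = s.snd i.succ then 1
            else extendOne l' (s.snd i.castSucc)) := by
  rw [pathMap_tmul, structureMap_of_endpoints M _ s.fst_zero s.fst_last,
    structureMap_of_endpoints M' _ s.snd_zero s.snd_last, zip_tmul]
  congr 2
  funext i
  have := s.step i
  rw [intervalProd_step _ (by omega), intervalProd_step _ (by omega)]

theorem extendOne_mem (hV : (1 : Λ) ∈ V) {n : ℕ} {l : Fin n → Λ} (h : ∀ i, l i ∈ V) (k : ℕ) :
    extendOne l k ∈ V := by
  unfold extendOne
  split_ifs
  · exact h _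
  · exact hV

theorem pathMap_mem (hV : (1 : Λ) ∈ V) (hV' : (1 : Λ') ∈ V') {n p q : ℕ} (s : ShufflePath n p q)
    {x : chains M p ⊗[K] chains M' q} (hx : x ∈ hochschildBTensor V M V' M' p q) :
    pathMap M M' s x ∈ hochschildB (boxSubmodule V V') (M.tensor M') n := by
  let S := (hochschildB (boxSubmodule V V') (M.tensor M') n).comap (pathMap M M' s)
  suffices h : ∀ a ∈ hochschildB V M p, ∀ a' ∈ hochschildB V' M' q, a ⊗ₜ a' ∈ S from
    (range_mapIncl_le_iff _ _ S).2 h hx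
  intro a ha a' ha'
  refine hochschildB_span V p (S.comap ((TensorProduct.mk K _ _).flip a')) (fun m l hl => ?_) ha
  refine hochschildB_span V' q (S.comap (TensorProduct.mk K _ _ (m ⊗ₜ PiTensorProduct.tprod K l)))
    (fun m' l' hl' => ?_) ha'
  refine Submodule.mem_comap.2 (Submodule.mem_comap.2 ?_)
  rw [TensorProduct.mk_apply, pathMap_tmul_tprod]
  apply tmul_tprod_mem_hochschildB
  intro i
  have := s.step i
  rcases this with ⟨h1, h2⟩ | ⟨h1, h2⟩
  · rw [if_neg (by omega), if_pos h2.symm]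
    exact tmul_one_mem_boxSubmodule (extendOne_mem hV hl _)
  · rw [if_neg (show ¬(s.snd i.castSucc : ℕ) = s.snd i.succ by omega), if_pos h1.symm]
    exact one_tmul_mem_boxSubmodule (extendOne_mem hV' hl' _)

theorem shuffle_mem (hV : (1 : Λ) ∈ V) (hV' : (1 : Λ') ∈ V') {n p q : ℕ}
    {x : chains M p ⊗[K] chains M' q} (hx : x ∈ hochschildBTensor V M V' M' p q) :
    shuffle M M' p q n x ∈ hochschildB (boxSubmodule V V') (M.tensor M') n := by
  rw [shuffle_apply]
  exact Submodule.sum_mem _ fun s _ => zsmul_mem (pathMap_mem hV hV' s hx) _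

/-- A sequence on the steps of a monotone map that is `1` on constant steps comes from a sequence
on the target. -/
theorem exists_of_steps {n p : ℕ} (f : Fin (n + 1) →o Fin (p + 1)) (h0 : f 0 = 0)
    (h1 : f (Fin.last n) = Fin.last p) (hf : ∀ i : Fin n, (f i.succ : ℕ) ≤ f i.castSucc + 1)
    (v : Fin n → Λ) (hv : ∀ i, v i ∈ V) :
    ∃ l : Fin p → Λ, (∀ j, l j ∈ V) ∧ ∀ i : Fin n, (f i.castSucc : ℕ) ≠ f i.succ →
      extendOne l (f i.castSucc) = v i := by
  have key : ∀ j : Fin p, ∃ i : Fin n, (f i.castSucc : ℕ) = j ∧ (f i.succ : ℕ) = j + 1 := by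
    intro j
    by_contra! h
    have hle : ∀ k, (f k : ℕ) ≤ j := by
      intro k
      induction k using Fin.induction with
      | zero => rw [h0]; exact Nat.zero_le _
      | succ k ih =>
        have := h k
        have := hf k
        omega
    have := hle (Fin.last n)
    rw [h1, Fin.val_last] at this
    omega
  choose c hc hc' using key
  refine ⟨fun j => v (c j), fun j => hv _, fun i hi => ?_⟩
  have hm : (f i.castSucc : ℕ) ≤ f i.succ := f.monotone (Fin.castSucc_lt_succ).le
  have hlt : (f i.castSucc : ℕ) < p := by
    have := (f i.succ).isLt
    omega
  rw [extendOne, dif_pos hlt]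
  congr 1
  have h2 := hc ⟨_, hlt⟩
  have h3 := hc' ⟨_, hlt⟩
  have h4 := hf i
  rcases lt_trichotomy (c ⟨_, hlt⟩) i with h | h | h
  · have h5 : (f (c ⟨_, hlt⟩).succ : ℕ) ≤ f i.castSucc := f.monotone (by
      rw [Fin.le_def, Fin.val_succ, Fin.val_castSucc]; exact h)
    simp only at h3
    omega
  · exact h
  · have h5 : (f i.succ : ℕ) ≤ f (c ⟨_, hlt⟩).castSucc := f.monotone (by
      rw [Fin.le_def, Fin.val_succ, Fin.val_castSucc]; exact h)
    simp only at h2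
    omega

theorem hochschildB_le_iSup (n : ℕ) :
    hochschildB (boxSubmodule V V') (M.tensor M') n ≤
      ⨆ i : PathIndex n, (hochschildBTensor V M V' M' i.1.1.1 i.1.1.2).map (pathMap M M' i.2) := by
  set S := ⨆ i : PathIndex n,
    (hochschildBTensor V M V' M' i.1.1.1 i.1.1.2).map (pathMap M M' i.2) with hS
  apply hochschildB_span
  intro m l hl
  choose v hv v' hv' hl using fun i => mem_boxSubmodule (hl i)
  obtain rfl : l = (fun i => v i ⊗ₜ 1) + fun i => 1 ⊗ₜ v' i := funext hl
  clear hl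
  -- The sum runs over the sets `c` of positions at which `v i ⊗ 1` is chosen.
  rw [MultilinearMap.map_add_univ, TensorProduct.tmul_sum]
  refine Submodule.sum_mem _ fun c _ => ?_
  suffices h : ∀ x : M.carrier ⊗[K] M'.carrier,
      (show (M.tensor M').carrier from x) ⊗ₜ[K] (PiTensorProduct.tprod K)
        (c.piecewise (fun i => v i ⊗ₜ[K] (1 : Λ')) fun i => 1 ⊗ₜ v' i) ∈ S from h m
  intro x
  induction x with
  | zero =>
    convert S.zero_mem
    exact TensorProduct.zero_tmul _ _
  | add x y hx hy =>
    convert S.add_mem hx hy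
    exact TensorProduct.add_tmul _ _ _
  | tmul m m' =>
    -- The path that is horizontal exactly at the positions in `c`; its endpoint `(p, q)` is
    -- determined by `c`.
    obtain ⟨p, q, s, hs⟩ := ShufflePath.exists_of_steps fun i => decide (i ∈ c)
    obtain ⟨w, hw, hw1⟩ := exists_of_steps s.fst s.fst_zero s.fst_last
      (fun i => by have := s.step i; omega) v hv
    obtain ⟨w', hw', hw1'⟩ := exists_of_steps s.snd s.snd_zero s.snd_last
      (fun i => by have := s.step i; omega) v' hv'
    refine Submodule.mem_iSup_of_mem s.toIndex ⟨(m ⊗ₜ PiTensorProduct.tprod K w) ⊗ₜ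
      (m' ⊗ₜ PiTensorProduct.tprod K w'), tmul_mem_range_mapIncl
        (tmul_tprod_mem_hochschildB V m w hw) (tmul_tprod_mem_hochschildB V' m' w' hw'), ?_⟩
    refine (pathMap_tmul_tprod s m w m' w').trans ?_
    congr 2
    funext i
    have h1 := s.step i
    have h2 := hs i
    by_cases hi : i ∈ c
    · rw [if_pos (by simpa using hi)] at h2
      rw [Finset.piecewise_eq_of_mem _ _ _ hi, if_neg (by omega), if_pos h2.symm,
        hw1 i (by omega)]
    · rw [if_neg (by simpa using hi)] at h2
      rw [Finset.piecewise_eq_of_notMem _ _ _ hi, if_pos h2.symm, if_neg (by omega),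
        hw1' i (by omega)]

theorem exists_eq_sum_pathMap {n : ℕ} {x : chains (M.tensor M') n}
    (hx : x ∈ hochschildB (boxSubmodule V V') (M.tensor M') n) :
    ∃ b : ∀ i : PathIndex n, chains M i.1.1.1 ⊗[K] chains M' i.1.1.2,
      (∀ i, b i ∈ hochschildBTensor V M V' M' i.1.1.1 i.1.1.2) ∧
        x = ∑ i, pathMap M M' i.2 (b i) := by
  obtain ⟨f, hf, rfl⟩ := (Submodule.mem_iSup_iff_exists_finsupp _ _).1 (hochschildB_le_iSup n hx)
  choose b hb hb' using hf
  refine ⟨b, hb, ?_⟩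
  rw [Finsupp.sum_fintype _ _ fun _ => rfl]
  exact Finset.sum_congr rfl fun i _ => (hb' i).symm

end Retract

end

/-! ### Cancellation at corners, the retraction, and the tensor isomorphism -/

section

section Normalized

variable {K : Type u} [Field K] {Λ Λ' : Type u} [Ring Λ] [Algebra K Λ] [Ring Λ'] [Algebra K Λ']
  {M : Bimodule K Λ} {M' : Bimodule K Λ'} {V : Submodule K Λ} {V' : Submodule K Λ'}

theorem chainsD_eq_sum {n : ℕ} (x : chains M (n + 1)) :
    chainsD M (n + 1) n x = ∑ i : Fin (n + 2), (-1 : ℤ) ^ (i : ℕ) • structureMap M (face i) x :=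
  hochschildComplex_d M x

theorem PathIndex.eq_or_eq_reflect {n p q : ℕ} {s : ShufflePath (n + 1) p q} {c : Fin n}
    (h : s.IsCorner c) {t : PathIndex (n + 1)}
    (ht : ∀ k ≠ c.castSucc.succ, (t.2.snd k : ℕ) = s.snd k) :
    t = s.toIndex ∨ t = (s.reflect c).toIndex := by
  have h1 := s.reflect_aux c
  have h2 := t.2.reflect_aux c
  have h3 := ht _ (ShufflePath.castSucc_castSucc_ne c)
  have h4 := ht _ (ShufflePath.succ_succ_ne c)
  have h5 := s.reflect_snd_self c
  unfold ShufflePath.IsCorner at h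
  by_cases he : (t.2.snd c.castSucc.succ : ℕ) = s.snd c.castSucc.succ
  · refine Or.inl (PathIndex.ext fun k => ?_)
    rcases eq_or_ne k c.castSucc.succ with rfl | hk
    · exact he
    · exact ht k hk
  · refine Or.inr (PathIndex.ext fun k => ?_)
    rcases eq_or_ne k c.castSucc.succ with rfl | hk
    · refine Eq.trans ?_ h5.symm
      omega
    · exact (ht k hk).trans (congrArg Fin.val (s.reflect_snd_of_ne c hk)).symm

/-- The member of a family over all paths at a given path. -/
def atPath {n : ℕ} (b : ∀ i : PathIndex n, chains M i.1.1.1 ⊗[K] chains M' i.1.1.2) {p q : ℕ}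
    (s : ShufflePath n p q) : chains M p ⊗[K] chains M' q := b s.toIndex

theorem atPath_mem {n : ℕ} {b : ∀ i : PathIndex n, chains M i.1.1.1 ⊗[K] chains M' i.1.1.2}
    (hb : ∀ i, b i ∈ hochschildBTensor V M V' M' i.1.1.1 i.1.1.2) {p q : ℕ}
    (s : ShufflePath n p q) : atPath b s ∈ hochschildBTensor V M V' M' p q := hb s.toIndex

/-- If the differential of a normalized sum over paths stays in the subcomplex, then the
contributions of two paths that differ by a reflection at a corner cancel. -/
theorem add_reflect_eq_zero {n : ℕ}
    (b : ∀ i : PathIndex (n + 1), chains M i.1.1.1 ⊗[K] chains M' i.1.1.2)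
    (hx : chainsD (M.tensor M') (n + 1) n
      (normProj (M.tensor M') (n + 1) (∑ i, pathMap M M' i.2 (b i))) ∈
        (hochschildB (boxSubmodule V V') (M.tensor M') n).map (normProj (M.tensor M') n))
    {p q : ℕ} (s : ShufflePath (n + 1) p q) (c : Fin n) (h : s.IsCorner c) :
    TensorProduct.map (reduce M p) (reduce M' q) (atPath b s) +
      TensorProduct.map (reduce M p) (reduce M' q) (atPath b (s.reflect c)) = 0 := by
  -- `r` detects the simplex obtained from `s` by cutting off the corner `c`, whose edge `c` is
  -- diagonal.
  obtain ⟨r, hr, hrs, hr0⟩ := exists_detect M M' (s.fst.comp (face c.castSucc.succ))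
    (s.snd.comp (face c.castSucc.succ))
    ((congrArg s.fst (ShufflePath.face_interior_zero c)).trans s.fst_zero)
    ((congrArg s.fst (ShufflePath.face_interior_last c)).trans s.fst_last)
    ((congrArg s.snd (ShufflePath.face_interior_zero c)).trans s.snd_zero)
    ((congrArg s.snd (ShufflePath.face_interior_last c)).trans s.snd_last) (s.cut_step h)
  -- Elements of `B` expand along paths, and a path moves in only one direction at edge `c`, so `r`
  -- kills them.
  have hB : ∀ y ∈ (hochschildB (boxSubmodule V V') (M.tensor M') n).map
      (normProj (M.tensor M') n), r y = 0 := by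
    rintro _ ⟨y, hy, rfl⟩
    rw [hr]
    obtain ⟨b', -, rfl⟩ := exists_eq_sum_pathMap hy
    rw [map_sum]
    refine Finset.sum_eq_zero fun i _ => hr0 _ _ _ _ ⟨c, ?_⟩ _
    have h1 := s.cut_step_self h
    rcases i.2.step c with ⟨-, h2⟩ | ⟨h2, -⟩
    · exact Or.inr ⟨fun e => h1.2.ne (congrArg Fin.val e), Fin.ext h2.symm⟩
    · exact Or.inl ⟨fun e => h1.1.ne (congrArg Fin.val e), Fin.ext h2.symm⟩
  -- Among all faces of all paths, `r` sees at most the face of `s` and of its reflection at the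
  -- corner.
  have hterm : ∀ (j : Fin (n + 2)) (i : PathIndex (n + 1)),
      (j = c.castSucc.succ ∧ (i = s.toIndex ∨ i = (s.reflect c).toIndex)) ∨
        r (structureMap (M.tensor M') (face j) (pathMap M M' i.2 (b i))) = 0 := by
    intro j i
    rw [or_iff_not_imp_right]
    intro hne
    rw [structureMap_pathMap] at hne
    have hno := fun hh => hne (hr0 _ _ (i.2.fst.comp (face j)) (i.2.snd.comp (face j)) hh (b i))
    obtain ⟨h1, h2⟩ := s.eq_of_face_steps h i.2 j
      (fun k hk e => hno ⟨k, Or.inl ⟨hk, e⟩⟩) (fun k hk e => hno ⟨k, Or.inr ⟨hk, e⟩⟩)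
    exact ⟨h1, PathIndex.eq_or_eq_reflect h h2⟩
  have hne : s.toIndex ≠ (s.reflect c).toIndex := fun e =>
    h.reflect_ne (eq_of_heq (Sigma.mk.inj e).2).symm
  have h0 := hB _ hx
  rw [normProj_chainsD, hr, chainsD_eq_sum, map_sum,
    Fintype.sum_eq_single c.castSucc.succ, map_zsmul, map_sum, map_sum,
    Fintype.sum_eq_add s.toIndex (s.reflect c).toIndex hne] at h0
  · rw [structureMap_pathMap, structureMap_pathMap] at h0
    have e1 := hrs (atPath b s)
    have e2 := hrs (atPath b (s.reflect c))
    rw [← s.reflect_fst_comp_face, ← s.reflect_snd_comp_face] at e2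
    rw [← e1, ← e2]
    -- Both surviving terms carry the sign of the same face; multiplying by it once more removes it.
    have h1 := congrArg (((-1 : ℤ) ^ ((c.castSucc.succ : Fin (n + 2)) : ℕ)) • ·) h0
    simp only [smul_smul, ← pow_add, ← two_mul] at h1
    rw [(even_two_mul _).neg_one_pow, one_smul] at h1
    exact h1.trans (smul_zero _)
  · rintro i ⟨h1, h2⟩
    exact (hterm _ i).resolve_left fun h3 => h3.2.elim h1 h2
  · intro j hj
    rw [map_zsmul, map_sum, map_sum, Finset.sum_eq_zero]
    · exact smul_zero _
    exact fun i _ => (hterm j i).resolve_left fun h3 => hj h3.1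

variable (M M') in
-- The detecting map of the path `base` returns reduced coefficients; normalizing afterwards makes
-- the composite with the shuffle map the identity on normalized chains.
theorem exists_retract {n p q : ℕ} (h : p + q = n) :
    ∃ r : chains (M.tensor M') n →ₗ[K] chains M p ⊗[K] chains M' q,
      (∀ x, r (normProj (M.tensor M') n x) = r x) ∧
      (∀ x, r (pathMap M M' (ShufflePath.base h) x) =
        TensorProduct.map (normProj M p) (normProj M' q) x) ∧
      ∀ (p' q' : ℕ) (s : ShufflePath n p' q'), s.toIndex ≠ (ShufflePath.base h).toIndex →
        ∀ x, r (pathMap M M' s x) = 0 := by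
  let t := ShufflePath.base h
  obtain ⟨r, hr, hrs, hr0⟩ := exists_detect M M' t.fst t.snd t.fst_zero t.fst_last t.snd_zero
    t.snd_last fun i => by
      have := t.step i
      simp only [Ne, Fin.ext_iff]
      omega
  refine ⟨TensorProduct.map (normProj M p) (normProj M' q) ∘ₗ r, fun x => ?_, fun x => ?_,
    fun p' q' s hs x => ?_⟩
  · rw [LinearMap.comp_apply, hr, LinearMap.comp_apply]
  · rw [LinearMap.comp_apply, pathMap_apply, hrs, map_normProj_reduce]
  · rw [LinearMap.comp_apply, pathMap_apply, hr0, map_zero]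
    apply ShufflePath.exists_step_ne
    by_contra! hc
    exact hs (PathIndex.ext hc)

variable (M M') in
/-- A retraction of the shuffle map. -/
def retract (p q n : ℕ) : chains (M.tensor M') n →ₗ[K] chains M p ⊗[K] chains M' q :=
  if h : p + q = n then (exists_retract M M' h).choose else 0

theorem retract_normProj {p q n : ℕ} (x : chains (M.tensor M') n) :
    retract M M' p q n (normProj (M.tensor M') n x) = retract M M' p q n x := by
  unfold retract
  split_ifs with h
  · exact (exists_retract M M' h).choose_spec.1 x
  · rfl

theorem retract_pathMap_base {p q n : ℕ} (h : p + q = n) (x : chains M p ⊗[K] chains M' q) :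
    retract M M' p q n (pathMap M M' (ShufflePath.base h) x) =
      TensorProduct.map (normProj M p) (normProj M' q) x := by
  rw [retract, dif_pos h]
  exact (exists_retract M M' h).choose_spec.2.1 x

theorem retract_pathMap_of_ne {p q n p' q' : ℕ} (h : p + q = n) (s : ShufflePath n p' q')
    (hs : s.toIndex ≠ (ShufflePath.base h).toIndex) (x : chains M p' ⊗[K] chains M' q') :
    retract M M' p q n (pathMap M M' s x) = 0 := by
  rw [retract, dif_pos h]
  exact (exists_retract M M' h).choose_spec.2.2 p' q' s hs x

theorem retract_shuffle {p q n : ℕ} (h : p + q = n) (x : chains M p ⊗[K] chains M' q) :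
    retract M M' p q n (shuffle M M' p q n x) =
      TensorProduct.map (normProj M p) (normProj M' q) x := by
  rw [shuffle_apply, map_sum, Fintype.sum_eq_single (ShufflePath.base h), map_zsmul,
    ShufflePath.sgn_base, one_smul, retract_pathMap_base]
  intro s hs
  rw [map_zsmul, retract_pathMap_of_ne h]
  · exact smul_zero _
  exact fun e => hs (eq_of_heq (Sigma.mk.inj e).2)

theorem retract_shuffle_of_ne {p q n p' q' : ℕ} (h : p + q = n) (hp : p ≠ p')
    (x : chains M p' ⊗[K] chains M' q') : retract M M' p q n (shuffle M M' p' q' n x) = 0 := by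
  rw [shuffle_apply, map_sum]
  refine Finset.sum_eq_zero fun s _ => ?_
  rw [map_zsmul, retract_pathMap_of_ne h]
  · exact smul_zero _
  exact fun e => hp (congrArg (fun i : PathIndex n => i.1.1.1) e).symm

theorem retract_sum_pathMap {n p q : ℕ} (h : p + q = n)
    (b : ∀ i : PathIndex n, chains M i.1.1.1 ⊗[K] chains M' i.1.1.2) :
    retract M M' p q n (∑ i, pathMap M M' i.2 (b i)) =
      TensorProduct.map (normProj M p) (normProj M' q) (atPath b (ShufflePath.base h)) := by
  rw [map_sum, Fintype.sum_eq_single (ShufflePath.base h).toIndex]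
  · exact retract_pathMap_base h _
  · intro i hi
    exact retract_pathMap_of_ne h i.2 hi _

theorem map_normProj_mem {p q : ℕ} {x : chains M p ⊗[K] chains M' q}
    (hx : x ∈ hochschildBTensor V M V' M' p q) :
    TensorProduct.map (normProj M p) (normProj M' q) x ∈ LinearMap.range (TensorProduct.mapIncl
      ((hochschildB V M p).map (normProj M p)) ((hochschildB V' M' q).map (normProj M' q))) :=
  (range_mapIncl_le_iff _ _ ((LinearMap.range (TensorProduct.mapIncl
      ((hochschildB V M p).map (normProj M p)) ((hochschildB V' M' q).map (normProj M' q)))).comap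
        (TensorProduct.map (normProj M p) (normProj M' q)))).2
    (fun _ ha _ ha' => tmul_mem_range_mapIncl (Submodule.mem_map_of_mem ha)
      (Submodule.mem_map_of_mem ha')) hx

theorem retract_mem {p q n : ℕ} (h : p + q = n) {x : chains (M.tensor M') n}
    (hx : x ∈ (hochschildB (boxSubmodule V V') (M.tensor M') n).map (normProj (M.tensor M') n)) :
    retract M M' p q n x ∈ LinearMap.range (TensorProduct.mapIncl
      ((hochschildB V M p).map (normProj M p)) ((hochschildB V' M' q).map (normProj M' q))) := by
  obtain ⟨x, hx, rfl⟩ := hx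
  obtain ⟨b, hb, rfl⟩ := exists_eq_sum_pathMap hx
  rw [retract_normProj, retract_sum_pathMap h]
  exact map_normProj_mem (atPath_mem hb _)

/-- This is where the boundary condition is used: it forces the coefficients at all paths with the
same endpoint to be, up to sign and modulo units, the one that `retract` reads off. -/
theorem sum_shuffle_retract {n : ℕ} {x : chains (M.tensor M') n}
    (hx : x ∈ (hochschildB (boxSubmodule V V') (M.tensor M') n).map (normProj (M.tensor M') n))
    (hd : chainsD (M.tensor M') n (n - 1) x ∈
      (hochschildB (boxSubmodule V V') (M.tensor M') (n - 1)).map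
        (normProj (M.tensor M') (n - 1))) :
    ∑ a ∈ Finset.HasAntidiagonal.antidiagonal n,
      shuffle M M' a.1 a.2 n (retract M M' a.1 a.2 n x) = x := by
  obtain ⟨x, hx, rfl⟩ := hx
  obtain ⟨b, hb, rfl⟩ := exists_eq_sum_pathMap hx
  have key : ∀ {p q : ℕ} (s : ShufflePath n p q),
      TensorProduct.map (reduce M p) (reduce M' q) (atPath b s) =
        s.sgn • TensorProduct.map (reduce M p) (reduce M' q)
          (atPath b (ShufflePath.base s.add_len)) := by
    intro p q s
    rcases n with _ | n
    · have : s = ShufflePath.base s.add_len := s.eq_base_of_forall_step fun i => i.elim0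
      rw [this, ShufflePath.sgn_base, one_smul]
    · exact ShufflePath.eq_sgn_smul
        (fun s => TensorProduct.map (reduce M p) (reduce M' q) (atPath b s))
        (fun s c h => add_reflect_eq_zero b hd s c h) s
  have hsum : normProj (M.tensor M') n (∑ i, pathMap M M' i.2 (b i)) =
      ∑ a : {a // a ∈ Finset.HasAntidiagonal.antidiagonal n}, ∑ s : ShufflePath n a.1.1 a.1.2,
        normProj (M.tensor M') n (pathMap M M' s (b ⟨a, s⟩)) := by
    rw [map_sum, Fintype.sum_sigma]
  rw [← Finset.sum_coe_sort]
  refine Eq.trans (Finset.sum_congr rfl fun a _ => ?_) hsum.symm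
  have ha := Finset.HasAntidiagonal.mem_antidiagonal.1 a.2
  rw [retract_normProj, retract_sum_pathMap ha, shuffle_normProj, shuffle_apply, map_sum]
  refine Finset.sum_congr rfl fun s _ => ?_
  -- The relation `key` holds only between reduced coefficients, which suffices under `normProj`.
  rw [map_zsmul, ← normProj_pathMap_reduce, ← map_zsmul, ← map_zsmul, ← key s,
    normProj_pathMap_reduce]
  rfl

theorem chainsD_normProj_eq_self {m n : ℕ} {x : chains M m} (h : normProj M m x = x) :
    normProj M n (chainsD M m n x) = chainsD M m n x := by
  rw [← normProj_chainsD, h]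

variable (M) in
/-- The normalized chains. -/
def normalized (n : ℕ) : Submodule K (chains M n) := LinearMap.eqLocus (normProj M n) LinearMap.id

theorem map_normProj_le_normalized (n : ℕ) :
    (hochschildB V M n).map (normProj M n) ≤ normalized M n := by
  rintro _ ⟨x, -, rfl⟩
  exact normProj_idem M x

theorem map_normProj_eq_self {p q : ℕ} {x : chains M p} {y : chains M' q}
    (hx : normProj M p x = x) (hy : normProj M' q y = y) :
    TensorProduct.map (normProj M p) (normProj M' q) (x ⊗ₜ y) = x ⊗ₜ y := by
  rw [TensorProduct.map_tmul, hx, hy]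

theorem shuffle_tmul_mem (hV : (1 : Λ) ∈ V) (hV' : (1 : Λ') ∈ V') {p q n : ℕ} {x : chains M p}
    (hx : x ∈ (hochschildB V M p).map (normProj M p)) {y : chains M' q}
    (hy : y ∈ (hochschildB V' M' q).map (normProj M' q)) :
    shuffle M M' p q n (x ⊗ₜ y) ∈
      (hochschildB (boxSubmodule V V') (M.tensor M') n).map (normProj (M.tensor M') n) := by
  obtain ⟨x, hx, rfl⟩ := hx
  obtain ⟨y, hy, rfl⟩ := hy
  rw [← TensorProduct.map_tmul, shuffle_normProj]
  exact Submodule.mem_map_of_mem (shuffle_mem hV hV' (tmul_mem_range_mapIncl hx hy))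

/-- The shuffle map of Hochschild complexes. -/
def shuffleData (hV : (1 : Λ) ∈ V) (hV' : (1 : Λ') ∈ V') (M : Bimodule K Λ) (M' : Bimodule K Λ') :
    ShuffleData (hochschildComplex M) (hochschildComplex M') (hochschildComplex (M.tensor M'))
      (fun n => (hochschildB V M n).map (normProj M n)) (normalized M)
      (fun n => (hochschildB V' M' n).map (normProj M' n)) (normalized M')
      (fun n => (hochschildB (boxSubmodule V V') (M.tensor M') n).map
        (normProj (M.tensor M') n)) where
  sh := shuffle M M'
  ret := retract M M'
  le := map_normProj_le_normalized
  le' := map_normProj_le_normalized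
  d_mem _ _ hx := chainsD_normProj_eq_self hx
  d_mem' _ _ hx := chainsD_normProj_eq_self hx
  d_sh _ _ _ _ _ hx _ hy := chainsD_shuffle hx hy
  sh_mem _ _ _ _ _ hx _ hy := shuffle_tmul_mem hV hV' hx hy
  ret_sh _ _ _ h x hx y hy := (retract_shuffle h (x ⊗ₜ y)).trans (map_normProj_eq_self hx hy)
  ret_sh_of_ne _ _ _ h _ _ _ hp x _ y _ := retract_shuffle_of_ne h hp (x ⊗ₜ y)
  ret_mem _ _ _ h _ hx := retract_mem h hx
  sum_sh_ret _ _ hx := sum_shuffle_retract (mem_omegaX.1 hx).1 ((mem_omegaX.1 hx).2 _)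

/-- `Ω(Λ ⊗ Λ', V ⊗ K + K ⊗ V', M ⊗ M') ≅ Ω(Λ, V, M) ⊗ Ω(Λ', V', M')`. -/
def omegaTensorIso (hV : (1 : Λ) ∈ V) (hV' : (1 : Λ') ∈ V') (M : Bimodule K Λ)
    (M' : Bimodule K Λ') :
    Omega (boxSubmodule V V') (one_mem_boxSubmodule hV V') (M.tensor M') ≅
      Omega V hV M ⊗ Omega V' hV' M' :=
  omegaIso _ _ _ ≪≫ (shuffleData hV hV' M M').tensorIso.symm ≪≫
    MonoidalCategory.tensorIso (omegaIso V hV M).symm (omegaIso V' hV' M').symm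

variable (K Λ Λ') in
-- An equality of bimodules rather than an isomorphism, so that the statement for regular bimodules
-- follows from the general one by rewriting.
theorem regular_tensor :
    (Bimodule.regular K Λ).tensor (Bimodule.regular K Λ') = Bimodule.regular K (Λ ⊗[K] Λ') := by
  have hm : ∀ (a x : Λ) (a' y : Λ'), (a ⊗ₜ[K] a') * (x ⊗ₜ[K] y) = (a * x) ⊗ₜ[K] (a' * y) :=
    fun a x a' y => Algebra.TensorProduct.tmul_mul_tmul a x a' y
  have h1 : ((Bimodule.regular K Λ).tensor (Bimodule.regular K Λ')).left =
      (Bimodule.regular K (Λ ⊗[K] Λ')).left := by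
    apply Algebra.TensorProduct.ext'
    intro a a'
    apply TensorProduct.ext'
    intro (x : Λ) (y : Λ')
    exact (hm a x a' y).symm
  have h2 : ((Bimodule.regular K Λ).tensor (Bimodule.regular K Λ')).right =
      (Bimodule.regular K (Λ ⊗[K] Λ')).right := by
    apply AlgHom.toLinearMap_injective
    apply LinearMap.ext
    intro b
    induction b using MulOpposite.rec' with
    | _ b =>
    induction b with
    | zero => exact (map_zero _).trans (map_zero _).symm
    | add x y hx hy =>
      exact (map_add _ _ _).trans ((congrArg₂ (· + ·) hx hy).trans (map_add _ _ _).symm)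
    | tmul a a' =>
      apply TensorProduct.ext'
      intro (x : Λ) (y : Λ')
      exact (hm x a y a').symm
  unfold Bimodule.tensor Bimodule.regular at *
  congr

end Normalized

end

/-- Isomorphic complexes have isomorphic graded homology. -/
def gradedHomologyIso {K : Type u} [CommRing K] {C C' : ChainComplex (ModuleCat.{u} K) ℕ}
    (e : C ≅ C') : (show GradedObject ℕ (ModuleCat.{u} K) from fun n => C.homology n) ≅
      (show GradedObject ℕ (ModuleCat.{u} K) from fun n => C'.homology n) :=
  GradedObject.isoMk _ _ fun n => HomologicalComplex.homologyMapIso e n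

end HochschildPath

end

theorem mainTheorem11 {K : Type u} [Field K] {Λ Λ' : Type u} [Ring Λ] [Algebra K Λ]
    [Ring Λ'] [Algebra K Λ'] (V : Submodule K Λ) (hV : (1 : Λ) ∈ V)
    (V' : Submodule K Λ') (hV' : (1 : Λ') ∈ V') :
    (∀ (M : HochschildPath.Bimodule K Λ) (M' : HochschildPath.Bimodule K Λ'),
      Nonempty (HochschildPath.Omega (HochschildPath.boxSubmodule V V')
          (HochschildPath.one_mem_boxSubmodule hV V') (M.tensor M') ≅
        HochschildPath.Omega V hV M ⊗ HochschildPath.Omega V' hV' M')) ∧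
    Nonempty (HochschildPath.Omega (HochschildPath.boxSubmodule V V')
        (HochschildPath.one_mem_boxSubmodule hV V')
        (HochschildPath.Bimodule.regular K (Λ ⊗[K] Λ')) ≅
      HochschildPath.Omega V hV (HochschildPath.Bimodule.regular K Λ) ⊗
        HochschildPath.Omega V' hV' (HochschildPath.Bimodule.regular K Λ')) ∧
    Nonempty (HochschildPath.HH (HochschildPath.boxSubmodule V V')
        (HochschildPath.one_mem_boxSubmodule hV V')
        (HochschildPath.Bimodule.regular K (Λ ⊗[K] Λ')) ≅
      HochschildPath.HH V hV (HochschildPath.Bimodule.regular K Λ) ⊗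
        HochschildPath.HH V' hV' (HochschildPath.Bimodule.regular K Λ')) := by
  have e := HochschildPath.omegaTensorIso hV hV' (HochschildPath.Bimodule.regular K Λ)
    (HochschildPath.Bimodule.regular K Λ')
  rw [HochschildPath.regular_tensor] at e
  exact ⟨fun M M' => ⟨HochschildPath.omegaTensorIso hV hV' M M'⟩, ⟨e⟩,
    ⟨HochschildPath.gradedHomologyIso e ≪≫ HochschildPath.kunnethIso _ _⟩⟩
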